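/- Let $d \ge 2$, $N = 2^{\lfloor (d+1)/2 \rfloor}$, and let $\gamma_1, \dots, \gamma_{d+1}$ be Hermitian $N \times N$ matrices with $\gamma_i\gamma_j + \gamma_j\gamma_i = 2\delta_{ij} I_N$. Put $\Phi_0(\xi) = \sum_{j=1}^d \xi_j \gamma_j$ for $\xi \in \mathbb{R}^d$, and let $\Phi_0$ also denote the operator $(\Phi_0 Y)(\omega) = \Phi_0(\omega) Y(\omega)$ on $\mathbb{C}^N$-valued functions on the unit sphere $S^{d-1}$. Let $\sigma$ be the surface measure of $S^{d-1}$ and let $H_k = H_k(S^{d-1}, \mathbb{C}^N)$ be the space of functions on $S^{d-1}$ all of whose components are restrictions of homogeneous harmonic polynomials of degree $k$ with complex coefficients. Define recursively $$V_0 = H_0, \qquad V_{k+1} = (\Phi_0 V_k)^{\perp} \cap H_{k+1}$$ (orthogonality in $L^2(S^{d-1}, \mathbb{C}^N)$), and for $\mu \in \{1,-1\}$ let $V_k^\mu = \{ Y \in V_k : \gamma_{d+1} Y = \mu Y \}$. For each $k \in \mathbb{N} = \{0, 1, 2, \dots\}$ and $\mu \in \{1,-1\}$ let $\{e_n^{k,\mu}\}_n$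 be an orthonormal basis of $V_k^\mu$, and define the $N \times 2$ matrix functions on $S^{d-1}$ by their columns: $$E_n^{k,\mu} = \begin{cases} \begin{pmatrix} e_n^{k,\mu} & \Phi_0 e_n^{k,\mu} \end{pmatrix}, & \mu = 1, \\ \begin{pmatrix} \Phi_0 e_n^{k,\mu} & e_n^{k,\mu} \end{pmatrix}, & \mu = -1. \end{cases}$$ (1) For every $f \in L^2(\mathbb{R}^d, \mathbb{C}^N)$ there is a unique family $\{f_n^{k,\mu}\} \subset L^2(\mathbb{R}_{>0}, \mathbb{C}^2)$ such that $$f(\xi) = |\xi|^{-(d-1)/2} \sum_{\mu \in \{1,-1\}} \sum_{k=0}^\infty \sum_n E_n^{k,\mu}(\xi/|\xi|)\, f_n^{k,\mu}(|\xi|) \quad \text{(unconditional convergence in } L^2(\mathbb{R}^d, \mathbb{C}^N)\text{)},$$ $$\|f\|_{L^2(\mathbb{R}^d, \mathbb{C}^N)}^2 = \sum_{\mu \in \{1,-1\}} \sum_{k=0}^\infty \sum_n \|f_n^{k,\mu}\|_{L^2(\mathbb{R}_{>0}, \mathbb{C}^2)}^2 .$$ Conversely, for every family $\{f_n^{k,\mu}\}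 \subset L^2(\mathbb{R}_{>0}, \mathbb{C}^2)$ with $\sum_{\mu,k,n} \|f_n^{k,\mu}\|^2 < \infty$, the series converges unconditionally in $L^2(\mathbb{R}^d, \mathbb{C}^N)$ and its sum $f$ satisfies the norm identity. (2) Let $w, \psi : (0,\infty) \to [0,\infty)$, and suppose that the Fourier transform of the function $x \mapsto w(|x|)$ on $\mathbb{R}^d$, with the normalisation $\int_{\mathbb{R}^d} w(|x|) e^{-ix\cdot\xi}\,dx$ and in the sense of tempered distributions, is a function $\xi \mapsto F_w(|\xi|)$ with $F_w$ real-valued, where $w(|\cdot|)$ and $F_w(|\cdot|)$ are integrable against every Schwartz function. Let $P_k$ be the Legendre polynomial of degree $k$ in $d$ dimensions, that is, $P_0(t) = 1$, $P_1(t) = t$, and $(k+d-3)P_k(t) = (2k+d-4)\,t\,P_{k-1}(t) - (k-1)P_{k-2}(t)$ for $k \ge 2$, and put $$\lambda_k(r) = \frac{\pi^{(d-1)/2}}{\Gamma((d-1)/2)}\, r^{d-2} \psi(r)^2 \int_{-1}^1 F_w\big(r\sqrt{2(1-t)}\big) P_k(t) (1-t^2)^{(d-3)/2}\,dt ,$$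 $$\Lambda_k^{1}(r) = \begin{pmatrix} \lambda_k(r) & 0 \\ 0 & \lambda_{k+1}(r) \end{pmatrix}, \qquad \Lambda_k^{-1}(r) = \begin{pmatrix} \lambda_{k+1}(r) & 0 \\ 0 & \lambda_k(r) \end{pmatrix}.$$ Then for every $\xi \ne 0$ such that $t \mapsto F_w(|\xi|\sqrt{2(1-t)})$ belongs to $L^1([-1,1], (1-t^2)^{(d-3)/2}dt)$, and for all $\mu, k, n$, the following integral converges absolutely and $$\frac12 |\xi|^{d-2} \psi(|\xi|)^2 \int_{S^{d-1}} F_w\Big(|\xi|\sqrt{2\big(1 - (\xi/|\xi|)\cdot\eta\big)}\Big) E_n^{k,\mu}(\eta)\,d\sigma(\eta) = E_n^{k,\mu}(\xi/|\xi|)\, \Lambda_k^{\mu}(|\xi|).$$ Moreover, for every $\xi \ne 0$ and all $\mu, k, n$, $$\Phi_0(\xi) E_n^{k,\mu}(\xi/|\xi|) = |\xi|\, E_n^{k,\mu}(\xi/|\xi|)\, \sigma_1, \qquad \gamma_{d+1} E_n^{k,\mu}(\xi/|\xi|) = E_n^{k,\mu}(\xi/|\xi|)\, \sigma_3,$$ where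 $\sigma_1 = \begin{pmatrix} 0 & 1 \\ 1 & 0 \end{pmatrix}$ and $\sigma_3 = \begin{pmatrix} 1 & 0 \\ 0 & -1 \end{pmatrix}$. -/

import Mathlib

open MeasureTheory Filter Topology
open scoped SchwartzMap Matrix

noncomputable section

namespace DiracHarmonics

/-- Euclidean space of dimension `d`. -/
abbrev Space (d : ℕ) : Type := EuclideanSpace ℝ (Fin d)

/-- The unit sphere of `ℝ^d`. -/
abbrev Sphere (d : ℕ) : Type := Metric.sphere (0 : Space d) 1

/-- The number `N = 2 ^ ⌊(d + 1) / 2⌋` of spinor components. -/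
abbrev spinorDim (d : ℕ) : ℕ := 2 ^ ((d + 1) / 2)

/-- The space `ℂ^N` with its Hermitian norm. -/
abbrev Spinor (d : ℕ) : Type := EuclideanSpace ℂ (Fin (spinorDim d))

/-- Complex `N × N` matrices. -/
abbrev SpinorMatrix (d : ℕ) : Type := Matrix (Fin (spinorDim d)) (Fin (spinorDim d)) ℂ

/-- The surface measure of the unit sphere. -/
abbrev surfaceMeasure (d : ℕ) : Measure (Sphere d) := (volume : Measure (Space d)).toSphere

/-- A family of gamma matrices: Hermitian, with
`γ_i γ_j + γ_j γ_i = 2 δ_{ij} I`. The last index, `Fin.last d`, is that of `γ_{d+1}`. -/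
structure IsGammaFamily {d : ℕ} (γ : Fin (d + 1) → SpinorMatrix d) : Prop where
  isHermitian : ∀ i, (γ i).IsHermitian
  anticomm : ∀ i j, γ i * γ j + γ j * γ i = (if i = j then (2 : ℂ) else 0) • 1

/-- The massless Dirac symbol `Φ₀(ξ) = ∑_{j ≤ d} ξ_j γ_j`. -/
def diracSymbol {d : ℕ} (γ : Fin (d + 1) → SpinorMatrix d) (ξ : Space d) : SpinorMatrix d :=
  ∑ j : Fin d, (ξ j : ℂ) • γ j.castSucc

/-! ### Vector-valued functions on the sphere -/

/-- Continuous `ℂ^N`-valued functions on the sphere. -/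
abbrev SpinorField (d : ℕ) : Type := C(Sphere d, Spinor d)

/-- Pointwise multiplication of a `ℂ^N`-valued function by a matrix-valued function. -/
def matrixMul {d : ℕ} (A : C(Sphere d, SpinorMatrix d)) : SpinorField d →ₗ[ℂ] SpinorField d where
  toFun Y :=
    { toFun := fun ω => WithLp.toLp 2 (A ω *ᵥ (Y ω).ofLp)
      continuous_toFun := (PiLp.continuous_toLp 2 _).comp
        (A.continuous.matrix_mulVec ((PiLp.continuous_ofLp 2 _).comp Y.continuous)) }
  map_add' Y Z := by
    ext ω a
    simp [Matrix.mulVec_add]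
  map_smul' c Y := by
    ext ω a
    simp [Matrix.mulVec_smul]

/-- `(Φ₀ Y)(ω) = Φ₀(ω) Y(ω)`. -/
def diracMul {d : ℕ} (γ : Fin (d + 1) → SpinorMatrix d) : SpinorField d →ₗ[ℂ] SpinorField d :=
  matrixMul
    { toFun := fun ω => diracSymbol γ ω
      continuous_toFun := by
        unfold diracSymbol
        fun_prop }

/-- `(γ_{d+1} Y)(ω) = γ_{d+1} Y(ω)`. -/
def gammaMul {d : ℕ} (γ : Fin (d + 1) → SpinorMatrix d) : SpinorField d →ₗ[ℂ] SpinorField d :=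
  matrixMul (ContinuousMap.const _ (γ (Fin.last d)))

/-- The inner product of `L²(S^{d-1}, ℂ^N)`, conjugate-linear in the first argument. -/
def sphereInner {d : ℕ} (Y Z : SpinorField d) : ℂ :=
  ∫ ω, inner ℂ (Y ω) (Z ω) ∂(surfaceMeasure d)

theorem integrable_sphereInner {d : ℕ} (Y Z : SpinorField d) :
    Integrable (fun ω => inner ℂ (Y ω) (Z ω)) (surfaceMeasure d) :=
  (Y.continuous.inner Z.continuous).integrable_of_hasCompactSupport
    (HasCompactSupport.of_compactSpace _)

/-- The orthogonal complement in `L²(S^{d-1}, ℂ^N)`, among continuous functions. -/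
def orthogonal {d : ℕ} (W : Submodule ℂ (SpinorField d)) : Submodule ℂ (SpinorField d) where
  carrier := {Y | ∀ Z ∈ W, sphereInner Z Y = 0}
  zero_mem' := by
    intro Z _
    simp [sphereInner]
  add_mem' := by
    intro X Y hX hY Z hZ
    have h : sphereInner Z (X + Y) = sphereInner Z X + sphereInner Z Y := by
      simp only [sphereInner, ContinuousMap.add_apply, inner_add_right]
      exact integral_add (integrable_sphereInner Z X) (integrable_sphereInner Z Y)
    rw [h, hX Z hZ, hY Z hZ, add_zero]
  smul_mem' := by
    intro c Y hY Z hZ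
    have h : sphereInner Z (c • Y) = c * sphereInner Z Y := by
      simp only [sphereInner, ContinuousMap.smul_apply, inner_smul_right]
      exact integral_const_mul c _
    rw [h, hY Z hZ, mul_zero]

/-- Homogeneous harmonic polynomials of degree `k` in `d` variables. -/
def harmonicPolynomial (d k : ℕ) : Submodule ℂ (MvPolynomial (Fin d) ℂ) :=
  MvPolynomial.homogeneousSubmodule (Fin d) ℂ k ⊓
    LinearMap.ker (∑ j : Fin d,
      (MvPolynomial.pderiv (R := ℂ) j).toLinearMap ∘ₗ (MvPolynomial.pderiv (R := ℂ) j).toLinearMap)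

/-- `ℂ^N`-valued spherical harmonics of degree `k`: every component is the restriction to the
sphere of a homogeneous harmonic polynomial of degree `k`. -/
def sphericalHarmonic (d k : ℕ) : Submodule ℂ (SpinorField d) where
  carrier := {Y | ∀ a, ∃ p ∈ harmonicPolynomial d k,
    ∀ ω : Sphere d, Y ω a = MvPolynomial.eval (fun j => ((ω : Space d) j : ℂ)) p}
  zero_mem' a := ⟨0, Submodule.zero_mem _, by simp⟩
  add_mem' := by
    intro X Y hX hY a
    obtain ⟨p, hp, hpX⟩ := hX a
    obtain ⟨q, hq, hqY⟩ := hY a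
    exact ⟨p + q, Submodule.add_mem _ hp hq, fun ω => by simp [hpX, hqY]⟩
  smul_mem' := by
    intro c Y hY a
    obtain ⟨p, hp, hpY⟩ := hY a
    exact ⟨c • p, Submodule.smul_mem _ c hp, fun ω => by simp [hpY, MvPolynomial.smul_eval]⟩

/-- `V₀ = H₀` and `V_{k+1} = (Φ₀ V_k)^⊥ ∩ H_{k+1}`. -/
def harmonicSubspace {d : ℕ} (γ : Fin (d + 1) → SpinorMatrix d) : ℕ → Submodule ℂ (SpinorField d)
  | 0 => sphericalHarmonic d 0
  | k + 1 => orthogonal ((harmonicSubspace γ k).map (diracMul γ)) ⊓ sphericalHarmonic d (k + 1)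

/-- `V_k^μ = {Y ∈ V_k | γ_{d+1} Y = μ Y}`; the sign `μ ∈ {1, -1}` is a unit of `ℤ`. -/
def signedSubspace {d : ℕ} (γ : Fin (d + 1) → SpinorMatrix d) (μ : ℤˣ) (k : ℕ) :
    Submodule ℂ (SpinorField d) :=
  harmonicSubspace γ k ⊓ Module.End.eigenspace (gammaMul γ) ((μ : ℤ) : ℂ)

/-- `e` is an orthonormal basis of `W` for the inner product of `L²(S^{d-1}, ℂ^N)`. -/
structure IsOrthonormalBasis {d : ℕ} {ι : Type*} (W : Submodule ℂ (SpinorField d)) (e : ι → SpinorField d) :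
    Prop where
  norm_one : ∀ n, sphereInner (e n) (e n) = 1
  orthogonal : ∀ m n, m ≠ n → sphereInner (e m) (e n) = 0
  span_eq : Submodule.span ℂ (Set.range e) = W

/-! ### The blocks and the expansion -/

/-- The `N × 2` matrix with the columns `x` and `y`. -/
def twoColumns {d : ℕ} (x y : Spinor d) : Matrix (Fin (spinorDim d)) (Fin 2) ℂ :=
  Matrix.of fun a => ![x a, y a]

/-- The block `(e  Φ₀e)` if `μ = 1` and `(Φ₀e  e)` if `μ = -1`. -/
def block {d : ℕ} (γ : Fin (d + 1) → SpinorMatrix d) (μ : ℤˣ) (e : SpinorField d) (ω : Sphere d) :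
    Matrix (Fin (spinorDim d)) (Fin 2) ℂ :=
  if μ = 1 then twoColumns (e ω) (diracMul γ e ω) else twoColumns (diracMul γ e ω) (e ω)

/-- The direction `ξ / |ξ|` of a nonzero vector. -/
def direction {d : ℕ} (ξ : Space d) (hξ : ξ ≠ 0) : Sphere d :=
  ⟨‖ξ‖⁻¹ • ξ, by simp [norm_smul, hξ]⟩

/-- `L²(ℝ^d, ℂ^N)`. -/
abbrev SpinorL2 (d : ℕ) : Type := Lp (Spinor d) 2 (volume : Measure (Space d))

/-- `L²(ℝ_{>0}, ℂ²)`. -/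
abbrev RadialL2 : Type := Lp (EuclideanSpace ℂ (Fin 2)) 2 (volume.restrict (Set.Ioi (0 : ℝ)))

/-- The function `ξ ↦ |ξ|^{-(d-1)/2} E(ξ/|ξ|) g(|ξ|)` (its value at the origin is irrelevant). -/
def radialTerm {d : ℕ} (E : Sphere d → Matrix (Fin (spinorDim d)) (Fin 2) ℂ)
    (g : ℝ → EuclideanSpace ℂ (Fin 2)) (ξ : Space d) : Spinor d :=
  open Classical in
  if hξ : ξ = 0 then 0
  else (‖ξ‖ ^ (-((d : ℝ) - 1) / 2)) • WithLp.toLp 2 (E (direction ξ hξ) *ᵥ (g ‖ξ‖).ofLp)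

/-- `f(ξ) = |ξ|^{-(d-1)/2} ∑_i E_i(ξ/|ξ|) g_i(|ξ|)`, the series converging unconditionally in
`L²(ℝ^d, ℂ^N)`. -/
def IsBlockExpansion {d : ℕ} {I : Type*}
    (E : I → Sphere d → Matrix (Fin (spinorDim d)) (Fin 2) ℂ)
    (f : SpinorL2 d) (g : I → RadialL2) : Prop :=
  Tendsto (fun s : Finset I =>
      eLpNorm (fun ξ => f ξ - ∑ i ∈ s, radialTerm (E i) (g i) ξ) 2 volume)
    atTop (𝓝 0)

/-! ### The Funk--Hecke multipliers -/

/-- The Legendre polynomial of degree `k` in `d` dimensions. The last case is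
`(k + d - 3) P_k(t) = (2k + d - 4) t P_{k-1}(t) - (k - 1) P_{k-2}(t)` with `k + 2` for `k`. -/
def legendre (d : ℕ) : ℕ → ℝ → ℝ
  | 0, _ => 1
  | 1, t => t
  | k + 2, t =>
    ((2 * k + d) * t * legendre d (k + 1) t - (k + 1) * legendre d k t) / (k + d - 1)

/-- `F(|·|)` is the Fourier transform of the radial function `w(|·|)` on `ℝ^d`, with the
normalisation `∫ w(|x|) e^{-i x·ξ} dx`. The transform is that of tempered distributions, since
weights such as `w(r) = r^{-s}` with `1 < s < d` are not integrable. -/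
structure IsRadialFourierTransform (d : ℕ) (w F : ℝ → ℝ) : Prop where
  integrable_weight : ∀ φ : 𝓢(Space d, ℂ), Integrable fun x => (w ‖x‖ : ℂ) * φ x
  integrable_transform : ∀ φ : 𝓢(Space d, ℂ), Integrable fun ξ => (F ‖ξ‖ : ℂ) * φ ξ
  integral_eq : ∀ φ : 𝓢(Space d, ℂ),
    ∫ ξ, (F ‖ξ‖ : ℂ) * φ ξ =
      ∫ x, (w ‖x‖ : ℂ) * ∫ ξ, Complex.exp (-Complex.I * (inner ℝ x ξ : ℝ)) * φ ξ

/-- `F(r √(2(1 - ·)))` belongs to `L¹([-1, 1], (1 - t²)^{(d-3)/2} dt)`. -/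
def FunkHeckeIntegrable (d : ℕ) (F : ℝ → ℝ) (r : ℝ) : Prop :=
  IntegrableOn (fun t : ℝ => F (r * √(2 * (1 - t))) * (1 - t ^ 2) ^ (((d : ℝ) - 3) / 2))
    (Set.Ioo (-1) 1)

/-- `λ_k(r) = π^{(d-1)/2} / Γ((d-1)/2) r^{d-2} ψ(r)²
  ∫_{-1}^{1} F(r √(2(1-t))) P_k(t) (1-t²)^{(d-3)/2} dt`. -/
def multiplier (d : ℕ) (F ψ : ℝ → ℝ) (k : ℕ) (r : ℝ) : ℝ :=
  Real.pi ^ (((d : ℝ) - 1) / 2) / Real.Gamma (((d : ℝ) - 1) / 2) * r ^ (d - 2) * ψ r ^ 2 *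
    ∫ t in Set.Ioo (-1 : ℝ) 1,
      F (r * √(2 * (1 - t))) * legendre d k t * (1 - t ^ 2) ^ (((d : ℝ) - 3) / 2)

/-- The diagonal matrix of multipliers of the two columns of a block: the column `e` has degree
`k` and the column `Φ₀e` has degree `k + 1`, so it is `diag(λ_k, λ_{k+1})` for `μ = 1` and
`diag(λ_{k+1}, λ_k)` for `μ = -1`. -/
def multiplierMatrix (d : ℕ) (F ψ : ℝ → ℝ) (μ : ℤˣ) (k : ℕ) (r : ℝ) : Matrix (Fin 2) (Fin 2) ℂ :=
  if μ = 1 then !![(multiplier d F ψ k r : ℂ), 0; 0, (multiplier d F ψ (k + 1) r : ℂ)]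
  else !![(multiplier d F ψ (k + 1) r : ℂ), 0; 0, (multiplier d F ψ k r : ℂ)]

/-- The kernel `F(r √(2(1 - ω·η)))`. -/
def funkHeckeKernel {d : ℕ} (F : ℝ → ℝ) (r : ℝ) (ω η : Sphere d) : ℝ :=
  F (r * √(2 * (1 - inner ℝ (ω : Space d) (η : Space d))))

/-- `½ r^{d-2} ψ(r)² ∫_{η ∈ S^{d-1}} F(r √(2(1 - ω·η))) E(η) dσ(η)`, entry by entry. -/
def funkHeckeOperator {d : ℕ} (F ψ : ℝ → ℝ) (r : ℝ)
    (E : Sphere d → Matrix (Fin (spinorDim d)) (Fin 2) ℂ) (ω : Sphere d) :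
    Matrix (Fin (spinorDim d)) (Fin 2) ℂ :=
  Matrix.of fun a c => ((1 / 2 * r ^ (d - 2) * ψ r ^ 2 : ℝ) : ℂ) *
    ∫ η, (funkHeckeKernel F r ω η : ℂ) * E η a c ∂(surfaceMeasure d)

/-- The Pauli matrix `σ₁`. -/
def pauli1 : Matrix (Fin 2) (Fin 2) ℂ := !![0, 1; 1, 0]

/-- The Pauli matrix `σ₃`. -/
def pauli3 : Matrix (Fin 2) (Fin 2) ℂ := !![1, 0; 0, -1]

end DiracHarmonics

end

open DiracHarmonics

namespace DiracHarmonics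

/-! ### Polar coordinates -/

section Polar

variable {d : ℕ}

/-! The key is to recognise `V_k` as the restrictions to the sphere of the monogenic polynomials of
degree `k`, the homogeneous solutions of `D p = 0` with `D = ∑ γ_j ∂_j` (`harmonicSubspace_eq`). If
`x` denotes multiplication by `∑ x_j γ_j` and `E` the Euler operator, then `D² = Δ` and `D x + x D =
d + 2E`. Hence a harmonic `p` of degree `k + 1` is a monogenic plus `(d + 2k)⁻¹ x D p`, which gives
`H_{k+1} = V_{k+1} + Φ₀ V_k`; the sum is orthogonal by the divergence theorem. In particular `Φ₀
V_k` has degree `k + 1`. Since `Φ₀` is a Hermitian involution on the sphere, the columns `e` and `Φ₀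
e` of all blocks are orthonormal (`sphereInner_column`) and span the spherical harmonics.

For the expansion, polar coordinates turn each block into an isometry of `L²(ℝ_{>0}, ℂ²)` into
`L²(ℝ^d, ℂ^N)`, with orthogonal ranges for different blocks. The ranges are total because
polynomials cut off to balls are dense and, on the sphere, every polynomial is a sum of harmonics.
This is a Hilbert sum.

For the multipliers (`funk_hecke`), a harmonic `p` of degree `k` is `p(ω)` times the zonal harmonic
with pole `ω` plus a harmonic that vanishes at `ω`. The latter is orthogonal to all powers of `ω ·
η`, hence to every integrable function of it. The zonal part leaves a one-dimensional integral
against the law of `ω · η`, which is identified by its moments.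

The integrations by parts on the sphere all come from one identity, `sphInt_X_mul`, obtained from
the Gaussian on `ℝ^d`. -/

theorem sphere_smul_ne_zero {r : ℝ} (hr : 0 < r) (ω : Sphere d) : r • (ω : Space d) ≠ 0 := by
  have h : ‖(ω : Space d)‖ = 1 := by simp
  intro h0
  rw [smul_eq_zero] at h0
  rcases h0 with h0 | h0
  · exact hr.ne' h0
  · simp [h0] at h

theorem norm_sphere_smul {r : ℝ} (hr : 0 < r) (ω : Sphere d) : ‖r • (ω : Space d)‖ = r := by
  have h : ‖(ω : Space d)‖ = 1 := by simp
  rw [norm_smul, h, mul_one, Real.norm_of_nonneg hr.le]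

theorem direction_smul {r : ℝ} (hr : 0 < r) (ω : Sphere d) (h : r • (ω : Space d) ≠ 0) :
    direction (r • (ω : Space d)) h = ω := by
  apply Subtype.ext
  simp only [direction]
  rw [norm_sphere_smul hr, smul_smul, inv_mul_cancel₀ hr.ne', one_smul]

theorem norm_smul_direction {ξ : Space d} (hξ : ξ ≠ 0) :
    ‖ξ‖ • (direction ξ hξ : Space d) = ξ := by
  simp only [direction]
  rw [smul_smul, mul_inv_cancel₀ (norm_ne_zero_iff.mpr hξ), one_smul]

theorem measurableEmbedding_polar :
    MeasurableEmbedding (fun z : Sphere d × Set.Ioi (0 : ℝ) => (z.2 : ℝ) • (z.1 : Space d)) :=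
  (MeasurableEmbedding.subtype_coe (measurableSet_singleton (0 : Space d)).compl).comp
    (homeomorphUnitSphereProd (Space d)).toMeasurableEquiv.symm.measurableEmbedding

variable [NeZero d]

/-- The map `(ω, r) ↦ rω` is a measurable embedding that carries the product of the surface
measure and `r^{d-1} dr` to the Lebesgue measure. -/
theorem measurePreserving_polar :
    MeasurePreserving (fun z : Sphere d × Set.Ioi (0 : ℝ) => (z.2 : ℝ) • (z.1 : Space d))
      ((surfaceMeasure d).prod (Measure.volumeIoiPow (d - 1))) volume := by
  have h := (volume : Measure (Space d)).measurePreserving_homeomorphUnitSphereProd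
  have h' := MeasurePreserving.symm
    (homeomorphUnitSphereProd (Space d)).toMeasurableEquiv h
  rw [finrank_euclideanSpace_fin] at h'
  have h2 : MeasurePreserving (Subtype.val : ({0}ᶜ : Set (Space d)) → Space d)
      (Measure.comap Subtype.val volume) volume := by
    refine ⟨measurable_subtype_coe, ?_⟩
    rw [map_comap_subtype_coe (measurableSet_singleton _).compl, restrict_compl_singleton]
  exact h2.comp h'

variable {𝕜 : Type*} [RCLike 𝕜]

theorem integral_volumeIoiPow {F : Type*} [NormedAddCommGroup F] [NormedSpace ℝ F]
    (n : ℕ) (b : ℝ → F) :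
    ∫ r : Set.Ioi (0 : ℝ), b r ∂Measure.volumeIoiPow n = ∫ r in Set.Ioi (0 : ℝ), r ^ n • b r := by
  simp only [Measure.volumeIoiPow, ENNReal.ofReal]
  rw [integral_withDensity_eq_integral_smul,
    integral_subtype_comap measurableSet_Ioi fun a ↦ Real.toNNReal (a ^ n) • b a,
    setIntegral_congr_fun measurableSet_Ioi fun x hx ↦ ?_]
  · rw [NNReal.smul_def, Real.coe_toNNReal _ (pow_nonneg hx.out.le _)]
  · exact (measurable_subtype_coe.pow_const _).real_toNNReal

theorem integrable_volumeIoiPow {F : Type*} [NormedAddCommGroup F] [NormedSpace ℝ F]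
    (n : ℕ) (b : ℝ → F) :
    Integrable (fun r : Set.Ioi (0 : ℝ) => b r) (Measure.volumeIoiPow n) ↔
      IntegrableOn (fun r => r ^ n • b r) (Set.Ioi (0 : ℝ)) := by
  rw [integrableOn_iff_comap_subtypeVal measurableSet_Ioi, Measure.volumeIoiPow,
    integrable_withDensity_iff_integrable_smul', integrable_congr]
  · refine .of_forall ?_
    rintro ⟨x, hx : 0 < x⟩
    simp (disch := positivity) [ENNReal.toReal_ofReal]
  · fun_prop
  · simp

theorem integral_polar {f : Space d → 𝕜} {a : Sphere d → 𝕜} {b : ℝ → 𝕜}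
    (hf : ∀ ω : Sphere d, ∀ r : ℝ, 0 < r → f (r • (ω : Space d)) = a ω * b r) :
    ∫ x, f x = (∫ ω, a ω ∂surfaceMeasure d) * ∫ r in Set.Ioi (0 : ℝ), r ^ (d - 1) • b r := by
  rw [← measurePreserving_polar.integral_comp measurableEmbedding_polar, ← integral_volumeIoiPow,
    ← integral_prod_mul]
  exact integral_congr_ae (.of_forall fun z => hf z.1 z.2 z.2.2)

theorem integrable_polar {f : Space d → 𝕜} {a : Sphere d → 𝕜} {b : ℝ → 𝕜}
    (hf : ∀ ω : Sphere d, ∀ r : ℝ, 0 < r → f (r • (ω : Space d)) = a ω * b r)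
    (ha : Integrable a (surfaceMeasure d))
    (hb : IntegrableOn (fun r => r ^ (d - 1) • b r) (Set.Ioi (0 : ℝ))) : Integrable f := by
  rw [← measurePreserving_polar.integrable_comp_emb measurableEmbedding_polar]
  have h := ha.mul_prod ((integrable_volumeIoiPow (d - 1) b).mpr hb)
  exact h.congr (.of_forall fun z => (hf z.1 z.2 z.2.2).symm)

/-- The measure `r^{d-1} dr` is absolutely continuous, so null sets of radii lift to null sets of
vectors. This carries identities between `L²` representatives from the half-line to `ℝ^d`. -/
theorem ae_of_ae_norm {P : ℝ → Prop} (h : ∀ᵐ r ∂(volume.restrict (Set.Ioi (0 : ℝ))), P r) :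
    ∀ᵐ x : Space d, P ‖x‖ := by
  rw [← measurePreserving_polar.map_eq, measurableEmbedding_polar.ae_map_iff]
  have h1 : ∀ᵐ r : Set.Ioi (0 : ℝ) ∂Measure.volumeIoiPow (d - 1), P r := by
    have : Measure.volumeIoiPow (d - 1) ≪ Measure.comap Subtype.val volume :=
      withDensity_absolutelyContinuous _ _
    apply this.ae_le
    exact (ae_restrict_iff_subtype measurableSet_Ioi).mp h
  have h2 := (Measure.quasiMeasurePreserving_snd (μ := surfaceMeasure d)
    (ν := Measure.volumeIoiPow (d - 1))).ae h1
  filter_upwards [h2] with z hz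
  rw [norm_sphere_smul z.2.2]
  exact hz

end Polar

/-! ### Integrals of polynomials over the sphere -/

section PolynomialIntegral

variable {d : ℕ}

/-- Evaluation of a complex polynomial at a point of `ℝ^d`. -/
abbrev evalAt (x : Space d) : MvPolynomial (Fin d) ℂ →+* ℂ :=
  MvPolynomial.eval fun j => (x j : ℂ)

theorem continuous_evalAt (p : MvPolynomial (Fin d) ℂ) :
    Continuous fun x : Space d => evalAt x p :=
  (MvPolynomial.continuous_eval p).comp (by fun_prop)

theorem evalAt_smul {p : MvPolynomial (Fin d) ℂ} {k : ℕ} (hp : p.IsHomogeneous k) (r : ℝ)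
    (x : Space d) : evalAt (r • x) p = (r : ℂ) ^ k * evalAt x p := by
  rw [evalAt, evalAt, MvPolynomial.eval_eq', MvPolynomial.eval_eq', Finset.mul_sum]
  refine Finset.sum_congr rfl fun m hm => ?_
  have hk : ∑ i, m i = k := by
    have := hp (MvPolynomial.mem_support_iff.mp hm)
    rw [← this, Finsupp.weight_apply, Finsupp.sum_fintype _ _ (by simp)]
    simp
  rw [← hk, ← Finset.prod_pow_eq_pow_sum]
  simp only [PiLp.smul_apply, smul_eq_mul, Complex.ofReal_mul, mul_pow, Finset.prod_mul_distrib]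
  ring

/-- Links the formal `pderiv` to the Fréchet derivative, so that analytic integration by parts
applies to polynomials. -/
theorem hasFDerivAt_evalAt (p : MvPolynomial (Fin d) ℂ) (x : Space d) :
    HasFDerivAt (fun y : Space d => evalAt y p)
      (∑ j, evalAt x (MvPolynomial.pderiv j p) •
        (Complex.ofRealCLM ∘L (EuclideanSpace.proj j : Space d →L[ℝ] ℝ))) x := by
  induction p using MvPolynomial.induction_on with
  | C a =>
    simp only [MvPolynomial.eval_C, MvPolynomial.pderiv_C, map_zero]
    exact (hasFDerivAt_const a x).congr_fderiv (by ext; simp)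
  | add p q hp hq =>
    simp only [map_add]
    refine (hp.add hq).congr_fderiv ?_
    ext v
    simp [add_mul, Finset.sum_add_distrib]
  | mul_X p i hp =>
    have hX : HasFDerivAt (fun y : Space d => ((y i : ℝ) : ℂ))
        (Complex.ofRealCLM ∘L (EuclideanSpace.proj i : Space d →L[ℝ] ℝ)) x :=
      (Complex.ofRealCLM ∘L (EuclideanSpace.proj i : Space d →L[ℝ] ℝ)).hasFDerivAt
    have h := hp.mul hX
    simp only [map_mul, MvPolynomial.eval_X]
    refine h.congr_fderiv ?_
    ext v
    simp [MvPolynomial.pderiv_X, Pi.single_apply, Finset.sum_add_distrib, Finset.mul_sum, add_mul,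
      apply_ite, mul_assoc]

theorem fderiv_evalAt_single (p : MvPolynomial (Fin d) ℂ) (x : Space d) (j : Fin d) :
    fderiv ℝ (fun y : Space d => evalAt y p) x (EuclideanSpace.single j 1) =
      evalAt x (MvPolynomial.pderiv j p) := by
  rw [(hasFDerivAt_evalAt p x).fderiv]
  simp [apply_ite]

theorem continuous_evalAt_sphere (p : MvPolynomial (Fin d) ℂ) :
    Continuous fun ω : Sphere d => evalAt (ω : Space d) p :=
  (continuous_evalAt p).comp continuous_subtype_val

theorem integrable_of_continuous {E : Type*} [NormedAddCommGroup E] {f : Sphere d → E}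
    (hf : Continuous f) : Integrable f (surfaceMeasure d) :=
  hf.integrable_of_hasCompactSupport (HasCompactSupport.of_compactSpace _)

/-- The integral of a polynomial over the unit sphere. -/
noncomputable def sphInt : MvPolynomial (Fin d) ℂ →ₗ[ℂ] ℂ where
  toFun p := ∫ ω, evalAt (ω : Space d) p ∂surfaceMeasure d
  map_add' p q := by
    simp only [map_add]
    exact integral_add (integrable_of_continuous (continuous_evalAt_sphere p))
      (integrable_of_continuous (continuous_evalAt_sphere q))
  map_smul' c p := by
    simp only [MvPolynomial.smul_eval, RingHom.id_apply, smul_eq_mul]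
    exact integral_const_mul c _

theorem sphInt_apply (p : MvPolynomial (Fin d) ℂ) :
    sphInt p = ∫ ω, evalAt (ω : Space d) p ∂surfaceMeasure d := rfl

/-- The Gaussian `e^{-|x|²}`. -/
noncomputable def gaussian (x : Space d) : ℂ := (Real.exp (-‖x‖ ^ 2) : ℝ)

theorem hasFDerivAt_gaussian (x : Space d) :
    HasFDerivAt (gaussian : Space d → ℂ)
      (Complex.ofRealCLM ∘L (Real.exp (-‖x‖ ^ 2) • -(2 • innerSL ℝ x))) x :=
  Complex.ofRealCLM.hasFDerivAt.comp x
    ((hasStrictFDerivAt_norm_sq x).hasFDerivAt.neg.exp)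

theorem fderiv_gaussian_single (x : Space d) (j : Fin d) :
    fderiv ℝ (gaussian : Space d → ℂ) x (EuclideanSpace.single j 1) =
      -2 * evalAt x (MvPolynomial.X j) * gaussian x := by
  rw [(hasFDerivAt_gaussian x).fderiv]
  simp [gaussian, EuclideanSpace.inner_single_right]
  ring

theorem integrableOn_pow_mul_exp_neg_sq (n : ℕ) :
    IntegrableOn (fun r : ℝ => r ^ n * Real.exp (-r ^ 2)) (Set.Ioi 0) := by
  have h := integrableOn_rpow_mul_exp_neg_rpow (p := 2) (s := n)
    (lt_of_lt_of_le (by norm_num) n.cast_nonneg) two_pos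
  simpa using h

theorem integral_pow_mul_exp_neg_sq (n : ℕ) :
    ∫ r in Set.Ioi (0 : ℝ), r ^ n * Real.exp (-r ^ 2) = 1 / 2 * Real.Gamma ((n + 1) / 2) := by
  have h := integral_rpow_mul_exp_neg_rpow (p := 2) (q := n) two_pos
    (lt_of_lt_of_le (by norm_num) n.cast_nonneg)
  simpa using h

theorem evalAt_mul_gaussian_smul {p : MvPolynomial (Fin d) ℂ} {k : ℕ} (hp : p.IsHomogeneous k)
    (ω : Sphere d) (r : ℝ) (hr : 0 < r) :
    evalAt (r • (ω : Space d)) p * gaussian (r • (ω : Space d)) =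
      evalAt (ω : Space d) p * ((r ^ k * Real.exp (-r ^ 2) : ℝ) : ℂ) := by
  rw [evalAt_smul hp, gaussian, norm_sphere_smul hr]
  push_cast
  ring

variable [NeZero d]

theorem integrable_evalAt_mul_gaussian {p : MvPolynomial (Fin d) ℂ} {k : ℕ}
    (hp : p.IsHomogeneous k) : Integrable fun x : Space d => evalAt x p * gaussian x := by
  refine integrable_polar (evalAt_mul_gaussian_smul hp)
    (integrable_of_continuous (continuous_evalAt_sphere p)) ?_
  have h := (integrableOn_pow_mul_exp_neg_sq (d - 1 + k)).ofReal (𝕜 := ℂ)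
  refine h.congr (.of_forall fun r => ?_)
  simp [pow_add]
  ring

/-- In polar coordinates the spherical integral splits off and the radial Gaussian leaves a Gamma
factor depending only on the degree. Integrals over the sphere become integrals over `ℝ^d`, where
integration by parts has no boundary terms. -/
theorem integral_evalAt_mul_gaussian {p : MvPolynomial (Fin d) ℂ} {k : ℕ}
    (hp : p.IsHomogeneous k) :
    ∫ x : Space d, evalAt x p * gaussian x =
      sphInt p * ((1 / 2 * Real.Gamma ((k + d) / 2) : ℝ) : ℂ) := by
  rw [integral_polar (evalAt_mul_gaussian_smul hp), sphInt_apply]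
  have h := integral_pow_mul_exp_neg_sq (d - 1 + k)
  have hd : ((d - 1 + k : ℕ) : ℝ) + 1 = k + d := by
    have : 1 ≤ d := NeZero.one_le
    push_cast [Nat.cast_sub this]
    ring
  rw [hd] at h
  rw [← h, ← integral_complex_ofReal]
  congr 1
  refine integral_congr_ae (.of_forall fun r => ?_)
  simp [pow_add]
  ring

/-- Integration by parts against the Gaussian, restricted to the sphere. -/
theorem sphInt_X_mul {p : MvPolynomial (Fin d) ℂ} {k : ℕ} (hp : p.IsHomogeneous k) (j : Fin d) :
    ((d : ℂ) + k - 1) * sphInt (MvPolynomial.X j * p) = sphInt (MvPolynomial.pderiv j p) := by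
  have hX : (MvPolynomial.X j * p).IsHomogeneous (1 + k) :=
    (MvPolynomial.isHomogeneous_X ℂ j).mul hp
  have hpar := integral_mul_fderiv_eq_neg_fderiv_mul_of_integrable (μ := (volume : Measure (Space d)))
    (f := fun x => evalAt x p) (g := gaussian) (v := EuclideanSpace.single j (1 : ℝ))
    (by simpa only [fderiv_evalAt_single] using integrable_evalAt_mul_gaussian hp.pderiv)
    (by
      simp only [fderiv_gaussian_single]
      refine ((integrable_evalAt_mul_gaussian hX).const_mul (-2)).congr (.of_forall fun x => ?_)
      simp only [map_mul]
      ring)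
    (integrable_evalAt_mul_gaussian hp)
    (fun x _ => (hasFDerivAt_evalAt p x).differentiableAt)
    (fun x _ => (hasFDerivAt_gaussian x).differentiableAt)
  simp only [fderiv_evalAt_single, fderiv_gaussian_single] at hpar
  have h1 : ∫ x : Space d, evalAt x p * (-2 * evalAt x (MvPolynomial.X j) * gaussian x) =
      -2 * (sphInt (MvPolynomial.X j * p) * ((1 / 2 * Real.Gamma (((1 + k : ℕ) + d) / 2) : ℝ) : ℂ)) := by
    rw [← integral_evalAt_mul_gaussian hX, ← integral_const_mul]
    refine integral_congr_ae (.of_forall fun x => ?_)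
    simp only [map_mul]
    ring
  rw [h1, integral_evalAt_mul_gaussian hp.pderiv] at hpar
  have hd : 0 < (d : ℝ) := Nat.cast_pos.mpr (NeZero.pos d)
  rcases k with _ | k
  -- The Gamma recursion does not apply in degree zero, where the degree `k - 1` is truncated; there
  -- the derivative vanishes, and the integral of `X j * p` with it.
  · have hC : MvPolynomial.pderiv j p = 0 := by
      rw [← MvPolynomial.totalDegree_zero_iff_isHomogeneous,
        MvPolynomial.totalDegree_eq_zero_iff_eq_C] at hp
      rw [hp, MvPolynomial.pderiv_C]
    have hG : Real.Gamma ((1 + d) / 2) ≠ 0 := (Real.Gamma_pos_of_pos (by positivity)).ne'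
    rw [hC, map_zero, zero_mul, neg_zero] at hpar
    rw [hC, map_zero]
    have : sphInt (MvPolynomial.X j * p) = 0 := by simpa [hG] using hpar
    rw [this, mul_zero]
  -- The degrees of `X j * p` and `pderiv j p` differ by two, so their Gamma factors differ by one
  -- step of the functional equation. This is the origin of the factor `d + k - 1`.
  · have hG : Real.Gamma (((1 + (k + 1) : ℕ) + d) / 2) =
        ((k : ℝ) + d) / 2 * Real.Gamma (((k : ℝ) + d) / 2) := by
      rw [← Real.Gamma_add_one (by positivity)]
      congr 1
      push_cast
      ring
    have hG0 : ((Real.Gamma (((k : ℝ) + d) / 2) : ℝ) : ℂ) ≠ 0 :=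
      Complex.ofReal_ne_zero.mpr (Real.Gamma_pos_of_pos (by positivity)).ne'
    rw [hG, Nat.add_sub_cancel] at hpar
    apply mul_right_cancel₀ hG0
    simp only [Complex.ofReal_mul, Complex.ofReal_div, Complex.ofReal_add,
      Complex.ofReal_natCast, Complex.ofReal_ofNat, Complex.ofReal_one] at hpar
    push_cast
    linear_combination (-2) * hpar

/-- The divergence theorem on the unit ball, for homogeneous polynomial vector fields. -/
theorem sphInt_sum_X_mul {a : Fin d → MvPolynomial (Fin d) ℂ} {k : ℕ}
    (ha : ∀ j, (a j).IsHomogeneous k) :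
    ((d : ℂ) + k - 1) * sphInt (∑ j, MvPolynomial.X j * a j) =
      sphInt (∑ j, MvPolynomial.pderiv j (a j)) := by
  rw [map_sum, map_sum, Finset.mul_sum]
  exact Finset.sum_congr rfl fun j _ => sphInt_X_mul (ha j) j

end PolynomialIntegral

/-! ### Harmonic polynomials -/

section Harmonic

variable {d : ℕ}

/-- The Laplacian on polynomials. -/
noncomputable def laplacian : MvPolynomial (Fin d) ℂ →ₗ[ℂ] MvPolynomial (Fin d) ℂ :=
  ∑ j : Fin d,
    (MvPolynomial.pderiv (R := ℂ) j).toLinearMap ∘ₗ (MvPolynomial.pderiv (R := ℂ) j).toLinearMap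

theorem laplacian_apply (p : MvPolynomial (Fin d) ℂ) :
    laplacian p = ∑ j, MvPolynomial.pderiv j (MvPolynomial.pderiv j p) := by
  simp [laplacian]

theorem mem_harmonicPolynomial {k : ℕ} {p : MvPolynomial (Fin d) ℂ} :
    p ∈ harmonicPolynomial d k ↔ p.IsHomogeneous k ∧ laplacian p = 0 := by
  simp [harmonicPolynomial, laplacian]

theorem pderiv_eq_zero_of_isHomogeneous_zero {p : MvPolynomial (Fin d) ℂ}
    (hp : p.IsHomogeneous 0) (j : Fin d) : MvPolynomial.pderiv j p = 0 := by
  rw [← MvPolynomial.totalDegree_zero_iff_isHomogeneous,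
    MvPolynomial.totalDegree_eq_zero_iff_eq_C] at hp
  rw [hp, MvPolynomial.pderiv_C]

theorem pderiv_comm (i j : Fin d) (p : MvPolynomial (Fin d) ℂ) :
    MvPolynomial.pderiv i (MvPolynomial.pderiv j p) =
      MvPolynomial.pderiv j (MvPolynomial.pderiv i p) := by
  -- A commutator of derivations is a derivation, so it is enough that it kills the variables.
  have h : ⁅MvPolynomial.pderiv (R := ℂ) i, MvPolynomial.pderiv (R := ℂ) j⁆ = 0 := by
    apply MvPolynomial.derivation_ext
    intro k
    simp [Derivation.commutator_apply, MvPolynomial.pderiv_X, Pi.single_apply, apply_ite]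
  have h2 := congrArg (fun D => D p) h
  simpa [Derivation.commutator_apply, sub_eq_zero] using h2

theorem laplacian_pderiv (j : Fin d) (p : MvPolynomial (Fin d) ℂ) :
    laplacian (MvPolynomial.pderiv j p) = MvPolynomial.pderiv j (laplacian p) := by
  simp only [laplacian_apply, map_sum]
  refine Finset.sum_congr rfl fun i _ => ?_
  rw [pderiv_comm i j p, pderiv_comm i j]

theorem pderiv_mem_harmonicPolynomial {k : ℕ} {p : MvPolynomial (Fin d) ℂ}
    (hp : p ∈ harmonicPolynomial d k) (j : Fin d) :
    MvPolynomial.pderiv j p ∈ harmonicPolynomial d (k - 1) := by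
  rw [mem_harmonicPolynomial] at hp ⊢
  exact ⟨hp.1.pderiv, by rw [laplacian_pderiv, hp.2, map_zero]⟩

theorem laplacian_mul (p q : MvPolynomial (Fin d) ℂ) :
    laplacian (p * q) = p * laplacian q + q * laplacian p +
      2 * ∑ j, MvPolynomial.pderiv j p * MvPolynomial.pderiv j q := by
  simp only [laplacian_apply, Derivation.leibniz, smul_eq_mul, map_add, Finset.mul_sum,
    ← Finset.sum_add_distrib]
  refine Finset.sum_congr rfl fun j _ => ?_
  ring

/-- The truncated subtraction is harmless: for `l = 0` the derivative is zero, and zero is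
homogeneous of every degree. -/
theorem isHomogeneous_mul_pderiv {p q : MvPolynomial (Fin d) ℂ} {k l : ℕ}
    (hp : p.IsHomogeneous k) (hq : q.IsHomogeneous l) (j : Fin d) :
    (p * MvPolynomial.pderiv j q).IsHomogeneous (k + l - 1) := by
  rcases l with _ | l
  · rw [pderiv_eq_zero_of_isHomogeneous_zero hq, mul_zero]
    exact MvPolynomial.isHomogeneous_zero _ _ _
  · exact hp.mul hq.pderiv

/-- Harmonic polynomials of different degrees are orthogonal on the sphere. -/
theorem sphInt_mul_eq_zero (hd : 2 ≤ d) {p q : MvPolynomial (Fin d) ℂ} {k l : ℕ} (hkl : k ≠ l)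
    (hp : p ∈ harmonicPolynomial d k) (hq : q ∈ harmonicPolynomial d l) : sphInt (p * q) = 0 := by
  have : NeZero d := ⟨by omega⟩
  rw [mem_harmonicPolynomial] at hp hq
  -- Green's second identity: the field `p ∇q - q ∇p` has divergence `p Δq - q Δp = 0`, while by
  -- Euler's identity its radial component is `(l - k) p q`.
  have h := sphInt_sum_X_mul (k := k + l - 1)
    (a := fun j => p * MvPolynomial.pderiv j q - q * MvPolynomial.pderiv j p)
    (fun j => (isHomogeneous_mul_pderiv hp.1 hq.1 j).sub
      (by simpa only [add_comm l k] using isHomogeneous_mul_pderiv hq.1 hp.1 j))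
  have h1 : ∑ j, MvPolynomial.X j * (p * MvPolynomial.pderiv j q - q * MvPolynomial.pderiv j p) =
      ((l : ℂ) - k) • (p * q) := by
    have e1 := hp.1.sum_X_mul_pderiv
    have e2 := hq.1.sum_X_mul_pderiv
    calc _ = p * ∑ j, MvPolynomial.X j * MvPolynomial.pderiv j q
          - q * ∑ j, MvPolynomial.X j * MvPolynomial.pderiv j p := by
            rw [Finset.mul_sum, Finset.mul_sum, ← Finset.sum_sub_distrib]
            exact Finset.sum_congr rfl fun j _ => by ring
      _ = _ := by
        rw [e1, e2, ← Nat.cast_smul_eq_nsmul ℂ, ← Nat.cast_smul_eq_nsmul ℂ, mul_smul_comm,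
          mul_smul_comm, mul_comm q p, sub_smul]
  have h2 : ∑ j, MvPolynomial.pderiv j
      (p * MvPolynomial.pderiv j q - q * MvPolynomial.pderiv j p) = 0 := by
    calc _ = p * laplacian q - q * laplacian p := by
            simp only [laplacian_apply, map_sub, Derivation.leibniz, smul_eq_mul, Finset.mul_sum,
              ← Finset.sum_sub_distrib]
            exact Finset.sum_congr rfl fun j _ => by ring
      _ = 0 := by rw [hp.2, hq.2]; simp
  rw [h1, h2, map_zero, map_smul, smul_eq_mul, mul_eq_zero, mul_eq_zero] at h
  rcases h with h | h | h
  · exfalso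
    have h3 : ((d + (k + l - 1) : ℕ) : ℂ) = (1 : ℕ) := by
      push_cast
      linear_combination h
    have := Nat.cast_injective h3
    omega
  · exact absurd (Nat.cast_injective (sub_eq_zero.mp h)).symm hkl
  · exact h

/-- `|x|²` as a polynomial. -/
noncomputable def normSq (d : ℕ) : MvPolynomial (Fin d) ℂ := ∑ j, MvPolynomial.X j ^ 2

theorem pderiv_normSq (j : Fin d) :
    MvPolynomial.pderiv j (normSq d) = 2 * MvPolynomial.X j := by
  simp [normSq, Derivation.leibniz_pow, MvPolynomial.pderiv_X, Pi.single_apply]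

theorem isHomogeneous_normSq : (normSq d).IsHomogeneous 2 :=
  MvPolynomial.IsHomogeneous.sum _ _ _ fun j _ => by
    simpa using (MvPolynomial.isHomogeneous_X ℂ j).pow 2

theorem evalAt_normSq (x : Space d) : evalAt x (normSq d) = ((‖x‖ ^ 2 : ℝ) : ℂ) := by
  simp [normSq, EuclideanSpace.norm_sq_eq]

theorem evalAt_normSq_sphere (ω : Sphere d) : evalAt (ω : Space d) (normSq d) = 1 := by
  simp [evalAt_normSq]

/-- In the Leibniz rule the Laplacian of `|x|²` is `2d`, and the mixed term is four times the Euler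
operator, that is, `4m`. -/
theorem laplacian_normSq_mul {q : MvPolynomial (Fin d) ℂ} {m : ℕ} (hq : q.IsHomogeneous m) :
    laplacian (normSq d * q) = ((2 * d + 4 * m : ℕ) : ℂ) • q + normSq d * laplacian q := by
  have h1 : laplacian (normSq d) = ((2 * d : ℕ) : MvPolynomial (Fin d) ℂ) := by
    have h2 : ∀ j : Fin d, MvPolynomial.pderiv j (2 : MvPolynomial (Fin d) ℂ) = 0 := fun j => by
      rw [← map_ofNat MvPolynomial.C 2, MvPolynomial.pderiv_C]
    simp [laplacian_apply, pderiv_normSq, h2, mul_comm]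
  have h2 : ∑ j, MvPolynomial.pderiv j (normSq d) * MvPolynomial.pderiv j q =
      ((2 * m : ℕ) : MvPolynomial (Fin d) ℂ) * q := by
    have := hq.sum_X_mul_pderiv
    simp only [pderiv_normSq, mul_assoc, ← Finset.mul_sum, this, nsmul_eq_mul]
    push_cast
    ring
  rw [laplacian_mul, h1, h2, Nat.cast_smul_eq_nsmul, nsmul_eq_mul]
  push_cast
  ring

/-- Each further factor `|x|²` adds a positive amount to the constant, so it never vanishes and may
be divided out to invert the Laplacian. -/
theorem exists_laplacian_normSq_pow_mul [NeZero d] {h : MvPolynomial (Fin d) ℂ} {l : ℕ}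
    (hh : h ∈ harmonicPolynomial d l) (j : ℕ) : ∃ c : ℕ, 0 < c ∧
      laplacian (normSq d ^ (j + 1) * h) = (c : ℂ) • (normSq d ^ j * h) := by
  rw [mem_harmonicPolynomial] at hh
  have hd : 0 < d := NeZero.pos d
  induction j with
  | zero =>
    refine ⟨2 * d + 4 * l, by omega, ?_⟩
    rw [zero_add, pow_one, laplacian_normSq_mul hh.1, hh.2]
    simp
  | succ j ih =>
    obtain ⟨c, -, hcj⟩ := ih
    have hm : (normSq d ^ (j + 1) * h).IsHomogeneous (2 * (j + 1) + l) :=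
      (isHomogeneous_normSq.pow (j + 1)).mul hh.1
    refine ⟨2 * d + 4 * (2 * (j + 1) + l) + c, by omega, ?_⟩
    rw [pow_succ' _ (j + 1), mul_assoc, laplacian_normSq_mul hm, hcj, mul_smul_comm, ← mul_assoc,
      ← pow_succ']
    push_cast
    module

/-- The span of the products `|x|^{2j} h`, `h` harmonic and homogeneous, of degree `k`. -/
noncomputable def harmonicSpan (d k : ℕ) : Submodule ℂ (MvPolynomial (Fin d) ℂ) :=
  Submodule.span ℂ {q | ∃ j l, l + 2 * j = k ∧ ∃ h ∈ harmonicPolynomial d l, q = normSq d ^ j * h}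

theorem isHomogeneous_of_mem_harmonicSpan {k : ℕ} {q : MvPolynomial (Fin d) ℂ}
    (hq : q ∈ harmonicSpan d k) : q.IsHomogeneous k := by
  rw [← MvPolynomial.mem_homogeneousSubmodule]
  refine Submodule.span_le.mpr ?_ hq
  rintro _ ⟨j, l, rfl, h, hh, rfl⟩
  rw [SetLike.mem_coe, MvPolynomial.mem_homogeneousSubmodule, add_comm l]
  exact (isHomogeneous_normSq.pow j).mul (mem_harmonicPolynomial.mp hh).1

theorem exists_laplacian_eq [NeZero d] {k : ℕ} {p : MvPolynomial (Fin d) ℂ}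
    (hp : p ∈ harmonicSpan d k) : ∃ q ∈ harmonicSpan d (k + 2), laplacian q = p := by
  induction hp using Submodule.span_induction with
  | mem p hp =>
    obtain ⟨j, l, rfl, h, hh, rfl⟩ := hp
    obtain ⟨c, hc, hcj⟩ := exists_laplacian_normSq_pow_mul hh j
    refine ⟨(c : ℂ)⁻¹ • (normSq d ^ (j + 1) * h), Submodule.smul_mem _ _
      (Submodule.subset_span ⟨j + 1, l, by ring, h, hh, rfl⟩), ?_⟩
    rw [map_smul, hcj, smul_smul, inv_mul_cancel₀ (Nat.cast_ne_zero.mpr hc.ne'), one_smul]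
  | zero => exact ⟨0, Submodule.zero_mem _, map_zero _⟩
  | add p q _ _ hp hq =>
    obtain ⟨p', hp', rfl⟩ := hp
    obtain ⟨q', hq', rfl⟩ := hq
    exact ⟨p' + q', Submodule.add_mem _ hp' hq', map_add _ _ _⟩
  | smul c p _ hp =>
    obtain ⟨p', hp', rfl⟩ := hp
    exact ⟨c • p', Submodule.smul_mem _ c hp', map_smul _ _ _⟩

theorem isHomogeneous_laplacian {k : ℕ} {p : MvPolynomial (Fin d) ℂ} (hp : p.IsHomogeneous k) :
    (laplacian p).IsHomogeneous (k - 1 - 1) := by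
  rw [laplacian_apply]
  exact MvPolynomial.IsHomogeneous.sum _ _ _ fun j _ => hp.pderiv.pderiv

theorem laplacian_eq_zero_of_isHomogeneous {k : ℕ} (hk : k < 2) {p : MvPolynomial (Fin d) ℂ}
    (hp : p.IsHomogeneous k) : laplacian p = 0 := by
  rw [laplacian_apply]
  refine Finset.sum_eq_zero fun j _ => pderiv_eq_zero_of_isHomogeneous_zero ?_ j
  have h : k - 1 = 0 := by omega
  rw [← h]
  exact hp.pderiv

/-- Every homogeneous polynomial is a sum of products `|x|^{2j} h` with `h` harmonic. -/
theorem mem_harmonicSpan [NeZero d] (k : ℕ) (p : MvPolynomial (Fin d) ℂ) (hp : p.IsHomogeneous k) :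
    p ∈ harmonicSpan d k := by
  induction k using Nat.strong_induction_on generalizing p with
  | _ k ih =>
    have hharm : ∀ q : MvPolynomial (Fin d) ℂ, q ∈ harmonicPolynomial d k → q ∈ harmonicSpan d k :=
      fun q hq => Submodule.subset_span ⟨0, k, rfl, q, hq, by simp⟩
    by_cases hk : k < 2
    · exact hharm p (mem_harmonicPolynomial.mpr ⟨hp, laplacian_eq_zero_of_isHomogeneous hk hp⟩)
    · obtain ⟨m, rfl⟩ : ∃ m, k = m + 2 := ⟨k - 2, by omega⟩
      -- By induction `Δp` lies in the span of lower degree, hence is the Laplacian of some `q` in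
      -- the span; the remainder `p - q` is harmonic.
      obtain ⟨q, hq, hqp⟩ := exists_laplacian_eq
        (ih m (by omega) _ (by simpa using isHomogeneous_laplacian hp))
      have h := hharm (p - q) (mem_harmonicPolynomial.mpr
        ⟨hp.sub (isHomogeneous_of_mem_harmonicSpan hq), by rw [map_sub, hqp, sub_self]⟩)
      simpa using Submodule.add_mem _ h hq

/-- The polynomial with conjugate coefficients. -/
noncomputable abbrev conjPoly : MvPolynomial (Fin d) ℂ →+* MvPolynomial (Fin d) ℂ :=
  MvPolynomial.map (starRingEnd ℂ)

/-- The coordinates of `x` are real, so only the coefficients need conjugating; complex conjugates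
of polynomial functions remain polynomial. -/
theorem evalAt_conjPoly (x : Space d) (p : MvPolynomial (Fin d) ℂ) :
    evalAt x (conjPoly p) = starRingEnd ℂ (evalAt x p) := by
  induction p using MvPolynomial.induction_on with
  | C a => simp
  | add p q hp hq => simp only [map_add, hp, hq]
  | mul_X p i hp => simp [hp]

theorem laplacian_conjPoly (p : MvPolynomial (Fin d) ℂ) :
    laplacian (conjPoly p) = conjPoly (laplacian p) := by
  simp [laplacian_apply, MvPolynomial.pderiv_map]

theorem conjPoly_mem_harmonicPolynomial {k : ℕ} {p : MvPolynomial (Fin d) ℂ}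
    (hp : p ∈ harmonicPolynomial d k) : conjPoly p ∈ harmonicPolynomial d k := by
  rw [mem_harmonicPolynomial] at hp ⊢
  exact ⟨hp.1.map _, by rw [laplacian_conjPoly, hp.2, map_zero]⟩

end Harmonic

/-! ### Polynomial spinors -/

section PolySpinor

variable {d : ℕ}

/-- `ℂ^N`-valued polynomials. -/
abbrev PolySpinor (d : ℕ) : Type := Fin (spinorDim d) → MvPolynomial (Fin d) ℂ

/-- The restriction of a `ℂ^N`-valued polynomial to the sphere. -/
noncomputable def toField : PolySpinor d →ₗ[ℂ] SpinorField d where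
  toFun p :=
    { toFun := fun ω => WithLp.toLp 2 fun a => evalAt (ω : Space d) (p a)
      continuous_toFun := (PiLp.continuous_toLp 2 _).comp
        (continuous_pi fun a => continuous_evalAt_sphere (p a)) }
  map_add' p q := by
    ext ω a
    simp
  map_smul' c p := by
    ext ω a
    simp [MvPolynomial.smul_eval]

@[simp]
theorem toField_apply (p : PolySpinor d) (ω : Sphere d) (a : Fin (spinorDim d)) :
    toField p ω a = evalAt (ω : Space d) (p a) := rfl

theorem mem_sphericalHarmonic {k : ℕ} {Y : SpinorField d} :
    Y ∈ sphericalHarmonic d k ↔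
      ∃ p : PolySpinor d, (∀ a, p a ∈ harmonicPolynomial d k) ∧ Y = toField p := by
  constructor
  · intro h
    choose p hp hpY using h
    exact ⟨p, hp, by ext ω a; exact hpY a ω⟩
  · rintro ⟨p, hp, rfl⟩ a
    exact ⟨p a, hp a, fun ω => rfl⟩

theorem sphereInner_toField (p q : PolySpinor d) :
    sphereInner (toField p) (toField q) = ∑ a, sphInt (conjPoly (p a) * q a) := by
  simp only [sphereInner, sphInt_apply]
  rw [← integral_finsetSum _ fun a _ => integrable_of_continuous (continuous_evalAt_sphere _)]
  refine integral_congr_ae (.of_forall fun ω => ?_)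
  simp only [PiLp.inner_apply, toField_apply, map_mul, evalAt_conjPoly, RCLike.inner_apply]
  exact Finset.sum_congr rfl fun a _ => mul_comm _ _

/-- Spherical harmonics of different degrees are orthogonal. -/
theorem sphereInner_eq_zero_of_degree_ne (hd : 2 ≤ d) {k l : ℕ} (hkl : k ≠ l) {Y Z : SpinorField d}
    (hY : Y ∈ sphericalHarmonic d k) (hZ : Z ∈ sphericalHarmonic d l) : sphereInner Y Z = 0 := by
  obtain ⟨p, hp, rfl⟩ := mem_sphericalHarmonic.mp hY
  obtain ⟨q, hq, rfl⟩ := mem_sphericalHarmonic.mp hZ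
  rw [sphereInner_toField]
  exact Finset.sum_eq_zero fun a _ =>
    sphInt_mul_eq_zero hd hkl (conjPoly_mem_harmonicPolynomial (hp a)) (hq a)

/-- On the sphere the factors `|x|^{2j}` of the harmonic decomposition are one, which leaves
harmonics of possibly lower degrees. -/
theorem toField_mem_iSup_of_isHomogeneous [NeZero d] {p : PolySpinor d} {k : ℕ}
    (hp : ∀ a, (p a).IsHomogeneous k) : toField p ∈ ⨆ l, sphericalHarmonic d l := by
  have hsingle : ∀ a, ∀ q ∈ harmonicSpan d k,
      toField (Pi.single a q) ∈ ⨆ l, sphericalHarmonic d l := by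
    intro a q hq
    induction hq using Submodule.span_induction with
    | mem q hq =>
      obtain ⟨j, l, -, h, hh, rfl⟩ := hq
      refine Submodule.mem_iSup_of_mem l (mem_sphericalHarmonic.mpr ⟨Pi.single a h, ?_, ?_⟩)
      · intro b
        by_cases hb : b = a
        · subst hb; simpa using hh
        · simp [Pi.single_eq_of_ne hb]
      · ext ω b
        by_cases hb : b = a
        · subst hb; simp [evalAt_normSq]
        · simp [Pi.single_eq_of_ne hb]
    | zero => simp
    | add q r _ _ hq hr =>
      rw [Pi.single_add, map_add]
      exact Submodule.add_mem _ hq hr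
    | smul c q _ hq =>
      rw [Pi.single_smul, map_smul]
      exact Submodule.smul_mem _ c hq
  rw [← Finset.univ_sum_single p, map_sum]
  exact Submodule.sum_mem _ fun a _ => hsingle a _ (mem_harmonicSpan k _ (hp a))

end PolySpinor

/-! ### The inner product of the sphere -/

section SphereInner

variable {d : ℕ}

theorem sphereInner_add_right (X Y Z : SpinorField d) :
    sphereInner X (Y + Z) = sphereInner X Y + sphereInner X Z := by
  simp only [sphereInner, ContinuousMap.add_apply, inner_add_right]
  exact integral_add (integrable_sphereInner X Y) (integrable_sphereInner X Z)

theorem conj_sphereInner (X Y : SpinorField d) :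
    starRingEnd ℂ (sphereInner X Y) = sphereInner Y X := by
  simp only [sphereInner, ← integral_conj, inner_conj_symm]

theorem sphereInner_eq_zero_comm {X Y : SpinorField d} (h : sphereInner X Y = 0) :
    sphereInner Y X = 0 := by
  rw [← conj_sphereInner, h, map_zero]

theorem sphereInner_smul_right (c : ℂ) (X Y : SpinorField d) :
    sphereInner X (c • Y) = c * sphereInner X Y := by
  simp only [sphereInner, ContinuousMap.smul_apply, inner_smul_right]
  exact integral_const_mul c _

theorem sphereInner_smul_left (c : ℂ) (X Y : SpinorField d) :
    sphereInner (c • X) Y = starRingEnd ℂ c * sphereInner X Y := by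
  rw [← conj_sphereInner, sphereInner_smul_right, map_mul, conj_sphereInner]

/-- Continuity and the full support of the surface measure upgrade vanishing almost everywhere to
vanishing everywhere. -/
theorem eq_zero_of_sphereInner_self {Y : SpinorField d} (hY : sphereInner Y Y = 0) : Y = 0 := by
  have h1 : ∫ ω, ‖Y ω‖ ^ 2 ∂surfaceMeasure d = 0 := by
    apply Complex.ofReal_injective
    rw [← integral_complex_ofReal, Complex.ofReal_zero, ← hY, sphereInner]
    refine integral_congr_ae (.of_forall fun ω => ?_)
    simp only [inner_self_eq_norm_sq_to_K]
    simp
  have hc : Continuous fun ω => ‖Y ω‖ ^ 2 := by fun_prop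
  rw [integral_eq_zero_iff_of_nonneg (fun ω => by positivity) (integrable_of_continuous hc)] at h1
  have h2 := (Continuous.ae_eq_iff_eq (surfaceMeasure d) hc continuous_const).mp h1
  ext1 ω
  have h3 : ‖Y ω‖ ^ 2 = 0 := congrFun h2 ω
  simpa using h3

end SphereInner

/-! ### The algebra of the Dirac symbol -/

section Symbol

variable {d : ℕ} {γ : Fin (d + 1) → SpinorMatrix d}

theorem IsGammaFamily.sq (hγ : IsGammaFamily γ) (i : Fin (d + 1)) : γ i * γ i = 1 := by
  have h := hγ.anticomm i i
  rw [if_pos rfl, ← two_smul ℂ] at h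
  exact smul_right_injective _ (two_ne_zero' ℂ) h

theorem IsGammaFamily.mul_comm_neg (hγ : IsGammaFamily γ) {i j : Fin (d + 1)} (hij : i ≠ j) :
    γ i * γ j = -(γ j * γ i) := by
  have h := hγ.anticomm i j
  rw [if_neg hij, zero_smul] at h
  exact eq_neg_of_add_eq_zero_left h

theorem isHermitian_diracSymbol (hγ : IsGammaFamily γ) (ξ : Space d) :
    (diracSymbol γ ξ).IsHermitian := by
  rw [Matrix.IsHermitian, diracSymbol, Matrix.conjTranspose_sum]
  refine Finset.sum_congr rfl fun j _ => ?_
  rw [Matrix.conjTranspose_smul, (hγ.isHermitian _).eq]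
  simp

/-- Symmetrising the double sum produces anticommutators, of which only the diagonal ones survive.
-/
theorem diracSymbol_mul_self (hγ : IsGammaFamily γ) (ξ : Space d) :
    diracSymbol γ ξ * diracSymbol γ ξ = ((‖ξ‖ ^ 2 : ℝ) : ℂ) • 1 := by
  have h2 : (2 : ℂ) • (diracSymbol γ ξ * diracSymbol γ ξ) =
      (2 : ℂ) • (((‖ξ‖ ^ 2 : ℝ) : ℂ) • 1) := by
    have h1 : diracSymbol γ ξ * diracSymbol γ ξ = ∑ i : Fin d, ∑ j : Fin d,
        ((ξ i : ℂ) * ξ j) • (γ i.castSucc * γ j.castSucc) := by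
      simp only [diracSymbol, Finset.sum_mul, Finset.mul_sum, smul_mul_smul_comm]
      exact Finset.sum_comm
    have h3 : diracSymbol γ ξ * diracSymbol γ ξ = ∑ i : Fin d, ∑ j : Fin d,
        ((ξ i : ℂ) * ξ j) • (γ j.castSucc * γ i.castSucc) := by
      rw [h1, Finset.sum_comm]
      simp only [mul_comm]
    rw [two_smul]
    nth_rw 1 [h1]
    rw [h3, ← Finset.sum_add_distrib]
    simp only [← Finset.sum_add_distrib, ← smul_add, hγ.anticomm, Fin.castSucc_inj]
    simp only [ite_smul, zero_smul, smul_ite, smul_zero, Finset.sum_ite_eq, Finset.mem_univ,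
      if_true]
    rw [← Finset.sum_smul, smul_comm, EuclideanSpace.norm_sq_eq]
    simp [pow_two]
  exact smul_right_injective _ (two_ne_zero' ℂ) h2

theorem diracSymbol_smul (r : ℝ) (ξ : Space d) :
    diracSymbol γ (r • ξ) = (r : ℂ) • diracSymbol γ ξ := by
  simp only [diracSymbol, Finset.smul_sum, smul_smul, PiLp.smul_apply, smul_eq_mul,
    Complex.ofReal_mul]

theorem gamma_last_mul_diracSymbol (hγ : IsGammaFamily γ) (ξ : Space d) :
    γ (Fin.last d) * diracSymbol γ ξ = -(diracSymbol γ ξ * γ (Fin.last d)) := by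
  rw [diracSymbol, Finset.mul_sum, Finset.sum_mul, ← Finset.sum_neg_distrib]
  refine Finset.sum_congr rfl fun j _ => ?_
  rw [mul_smul_comm, smul_mul_assoc, hγ.mul_comm_neg (Fin.castSucc_ne_last j).symm, smul_neg]

theorem diracMul_apply (Y : SpinorField d) (ω : Sphere d) :
    diracMul γ Y ω = WithLp.toLp 2 (diracSymbol γ ω *ᵥ (Y ω).ofLp) := rfl

theorem gammaMul_apply (Y : SpinorField d) (ω : Sphere d) :
    gammaMul γ Y ω = WithLp.toLp 2 (γ (Fin.last d) *ᵥ (Y ω).ofLp) := rfl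

theorem diracMul_diracMul (hγ : IsGammaFamily γ) (Y : SpinorField d) :
    diracMul γ (diracMul γ Y) = Y := by
  ext1 ω
  rw [diracMul_apply, diracMul_apply, Matrix.mulVec_mulVec, diracSymbol_mul_self hγ]
  simp

theorem gammaMul_gammaMul (hγ : IsGammaFamily γ) (Y : SpinorField d) :
    gammaMul γ (gammaMul γ Y) = Y := by
  ext1 ω
  rw [gammaMul_apply, gammaMul_apply, Matrix.mulVec_mulVec, hγ.sq]
  simp

theorem gammaMul_diracMul (hγ : IsGammaFamily γ) (Y : SpinorField d) :
    gammaMul γ (diracMul γ Y) = -diracMul γ (gammaMul γ Y) := by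
  ext1 ω
  rw [ContinuousMap.neg_apply, gammaMul_apply, diracMul_apply, diracMul_apply, gammaMul_apply,
    Matrix.mulVec_mulVec, Matrix.mulVec_mulVec, gamma_last_mul_diracSymbol hγ, Matrix.neg_mulVec]
  rfl

theorem inner_mulVec_left {A : SpinorMatrix d} (hA : A.IsHermitian) (x y : Spinor d) :
    inner ℂ (WithLp.toLp 2 (A *ᵥ x.ofLp) : Spinor d) y =
      inner ℂ x (WithLp.toLp 2 (A *ᵥ y.ofLp) : Spinor d) := by
  rw [EuclideanSpace.inner_eq_star_dotProduct, EuclideanSpace.inner_eq_star_dotProduct,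
    Matrix.star_mulVec, hA.eq, dotProduct_comm, ← Matrix.dotProduct_mulVec, dotProduct_comm]

theorem sphereInner_diracMul_left (hγ : IsGammaFamily γ) (Y Z : SpinorField d) :
    sphereInner (diracMul γ Y) Z = sphereInner Y (diracMul γ Z) := by
  simp only [sphereInner, diracMul_apply, inner_mulVec_left (isHermitian_diracSymbol hγ _)]

theorem sphereInner_gammaMul_left (hγ : IsGammaFamily γ) (Y Z : SpinorField d) :
    sphereInner (gammaMul γ Y) Z = sphereInner Y (gammaMul γ Z) := by
  simp only [sphereInner, gammaMul_apply, inner_mulVec_left (hγ.isHermitian _)]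

theorem sphereInner_diracMul_diracMul (hγ : IsGammaFamily γ) (Y Z : SpinorField d) :
    sphereInner (diracMul γ Y) (diracMul γ Z) = sphereInner Y Z := by
  rw [sphereInner_diracMul_left hγ, diracMul_diracMul hγ]

end Symbol

/-! ### The Dirac operator on polynomial spinors -/

section DiracOperator

variable {d : ℕ}

/-- The action of constant matrices on `ℂ^N`-valued polynomials. -/
noncomputable def constMul : SpinorMatrix d →ₐ[ℂ] Module.End ℂ (PolySpinor d) :=
  AlgHom.ofLinearMap
    { toFun := fun A =>
        { toFun := fun p a => ∑ b, A a b • p b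
          map_add' := fun p q => funext fun a => by simp [Finset.sum_add_distrib]
          map_smul' := fun c p => funext fun a => by simp [Finset.smul_sum, smul_comm c] }
      map_add' := fun A B => by
        refine LinearMap.ext fun p => funext fun a => ?_
        simp [add_smul, Finset.sum_add_distrib]
      map_smul' := fun c A => by
        refine LinearMap.ext fun p => funext fun a => ?_
        simp [Finset.smul_sum, mul_smul] }
    (by
      refine LinearMap.ext fun p => funext fun a => ?_
      simp [Matrix.one_apply])
    (fun A B => by
      refine LinearMap.ext fun p => funext fun a => ?_
      simp only [LinearMap.coe_mk, AddHom.coe_mk, Module.End.mul_apply, Matrix.mul_apply,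
        Finset.sum_smul, Finset.smul_sum, mul_smul]
      exact Finset.sum_comm)

theorem constMul_apply (A : SpinorMatrix d) (p : PolySpinor d) (a : Fin (spinorDim d)) :
    constMul A p a = ∑ b, A a b • p b := rfl

/-- The partial derivative on `ℂ^N`-valued polynomials. -/
noncomputable def partialD (j : Fin d) : Module.End ℂ (PolySpinor d) :=
  LinearMap.compLeft (MvPolynomial.pderiv j).toLinearMap _

/-- Multiplication by a coordinate on `ℂ^N`-valued polynomials. -/
noncomputable def coordMul (j : Fin d) : Module.End ℂ (PolySpinor d) :=
  LinearMap.compLeft (LinearMap.mulLeft ℂ (MvPolynomial.X j)) _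

@[simp]
theorem partialD_apply (j : Fin d) (p : PolySpinor d) (a : Fin (spinorDim d)) :
    partialD j p a = MvPolynomial.pderiv j (p a) := rfl

@[simp]
theorem coordMul_apply (j : Fin d) (p : PolySpinor d) (a : Fin (spinorDim d)) :
    coordMul j p a = MvPolynomial.X j * p a := rfl

theorem partialD_mul_constMul (j : Fin d) (A : SpinorMatrix d) :
    partialD j * constMul A = constMul A * partialD j := by
  refine LinearMap.ext fun p => funext fun a => ?_
  simp [constMul_apply, Derivation.map_smul]

theorem coordMul_mul_constMul (j : Fin d) (A : SpinorMatrix d) :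
    coordMul j * constMul A = constMul A * coordMul j := by
  refine LinearMap.ext fun p => funext fun a => ?_
  simp [constMul_apply, Finset.mul_sum]

theorem partialD_mul_coordMul (i j : Fin d) :
    partialD i * coordMul j = coordMul j * partialD i + if i = j then 1 else 0 := by
  refine LinearMap.ext fun p => funext fun a => ?_
  by_cases h : i = j
  · subst h; simp [Derivation.leibniz]
  · simp [Derivation.leibniz, h, MvPolynomial.pderiv_X, Ne.symm h]

theorem partialD_comm (i j : Fin d) : partialD i * partialD j = partialD j * partialD i := by
  refine LinearMap.ext fun p => funext fun a => ?_
  exact pderiv_comm i j (p a)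

variable (γ : Fin (d + 1) → SpinorMatrix d)

/-- The Dirac operator `∑ γ_j ∂_j`. -/
noncomputable def diracOp : Module.End ℂ (PolySpinor d) :=
  ∑ j : Fin d, constMul (γ j.castSucc) * partialD j

/-- Multiplication by `∑ x_j γ_j`. -/
noncomputable def diracX : Module.End ℂ (PolySpinor d) :=
  ∑ j : Fin d, constMul (γ j.castSucc) * coordMul j

variable {γ}

theorem constMul_anticomm (hγ : IsGammaFamily γ) (i j : Fin d) :
    constMul (γ i.castSucc) * constMul (γ j.castSucc) +
      constMul (γ j.castSucc) * constMul (γ i.castSucc) =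
        (if i = j then (2 : ℂ) else 0) • (1 : Module.End ℂ (PolySpinor d)) := by
  rw [← map_mul, ← map_mul, ← map_add, hγ.anticomm, map_smul, map_one]
  simp only [Fin.castSucc_inj]

/-- Partial derivatives commute, so the same symmetrisation as for the symbol applies: the Dirac
operator is a square root of the Laplacian. -/
theorem diracOp_mul_self (hγ : IsGammaFamily γ) :
    diracOp γ * diracOp γ = ∑ j, partialD j * partialD j := by
  have h1 : diracOp γ * diracOp γ = ∑ i : Fin d, ∑ j : Fin d,
      constMul (γ i.castSucc) * constMul (γ j.castSucc) * (partialD i * partialD j) := by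
    simp only [diracOp, Finset.sum_mul_sum]
    refine Finset.sum_congr rfl fun i _ => Finset.sum_congr rfl fun j _ => ?_
    rw [mul_assoc, ← mul_assoc (partialD i), partialD_mul_constMul]
    simp only [mul_assoc]
  have h2 : diracOp γ * diracOp γ = ∑ i : Fin d, ∑ j : Fin d,
      constMul (γ j.castSucc) * constMul (γ i.castSucc) * (partialD i * partialD j) := by
    rw [h1, Finset.sum_comm]
    simp only [partialD_comm]
  have h3 : (2 : ℂ) • (diracOp γ * diracOp γ) =
      (2 : ℂ) • ∑ j : Fin d, partialD j * partialD j := by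
    rw [two_smul]
    nth_rw 1 [h1]
    rw [h2, ← Finset.sum_add_distrib, Finset.smul_sum]
    refine Finset.sum_congr rfl fun i _ => ?_
    rw [← Finset.sum_add_distrib]
    simp only [← add_mul, constMul_anticomm hγ, ite_smul, zero_smul, ite_mul, zero_mul,
      smul_mul_assoc, one_mul, Finset.sum_ite_eq, Finset.mem_univ, if_true]
  exact smul_right_injective _ (two_ne_zero' ℂ) h3

/-- Adding the two orders, the anticommutators leave twice the Euler operator, and moving `∂_i` past
`x_i` contributes one for each of the `d` coordinates. The decomposition of the harmonics rests on
this relation. -/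
theorem diracOp_mul_diracX (hγ : IsGammaFamily γ) :
    diracOp γ * diracX γ = (d : ℂ) • 1 + (2 : ℂ) • ∑ j, coordMul j * partialD j -
      diracX γ * diracOp γ := by
  have h1 : diracOp γ * diracX γ = ∑ i : Fin d, ∑ j : Fin d,
      (constMul (γ i.castSucc) * constMul (γ j.castSucc) * (coordMul j * partialD i) +
        if i = j then 1 else 0) := by
    simp only [diracOp, diracX, Finset.sum_mul_sum]
    refine Finset.sum_congr rfl fun i _ => Finset.sum_congr rfl fun j _ => ?_
    rw [mul_assoc, ← mul_assoc (partialD i), partialD_mul_constMul, mul_assoc (constMul _),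
      partialD_mul_coordMul, mul_add, mul_add]
    split_ifs with h
    · subst h
      rw [mul_one, ← mul_assoc, ← map_mul, hγ.sq, map_one]
    · simp [mul_assoc]
  have h2 : diracX γ * diracOp γ = ∑ i : Fin d, ∑ j : Fin d,
      constMul (γ j.castSucc) * constMul (γ i.castSucc) * (coordMul j * partialD i) := by
    rw [Finset.sum_comm]
    simp only [diracOp, diracX, Finset.sum_mul_sum]
    refine Finset.sum_congr rfl fun i _ => Finset.sum_congr rfl fun j _ => ?_
    rw [mul_assoc, ← mul_assoc (coordMul i), coordMul_mul_constMul]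
    simp only [mul_assoc]
  rw [eq_sub_iff_add_eq, h1, h2, ← Finset.sum_add_distrib, Finset.smul_sum]
  have h3 : (d : ℂ) • (1 : Module.End ℂ (PolySpinor d)) = ∑ i : Fin d, 1 := by
    simp [Nat.cast_smul_eq_nsmul]
  rw [h3, ← Finset.sum_add_distrib]
  refine Finset.sum_congr rfl fun i _ => ?_
  rw [← Finset.sum_add_distrib]
  simp only [add_right_comm _ (ite _ _ _), ← add_mul, constMul_anticomm hγ]
  simp only [Finset.sum_add_distrib, ite_smul, zero_smul, ite_mul, zero_mul,
      smul_mul_assoc, one_mul, Finset.sum_ite_eq, Finset.mem_univ, if_true]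
  rw [add_comm]

/-- Consequently `γ_{d+1}` preserves the kernel of the Dirac operator, and so each `V_k`. -/
theorem constMul_last_mul_diracOp (hγ : IsGammaFamily γ) :
    diracOp γ * constMul (γ (Fin.last d)) = -(constMul (γ (Fin.last d)) * diracOp γ) := by
  rw [diracOp, Finset.mul_sum, Finset.sum_mul, ← Finset.sum_neg_distrib]
  refine Finset.sum_congr rfl fun j _ => ?_
  rw [mul_assoc, partialD_mul_constMul, ← mul_assoc, ← mul_assoc, ← map_mul,
    hγ.mul_comm_neg (Fin.castSucc_ne_last j), map_neg, map_mul]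
  exact neg_mul (constMul (γ (Fin.last d)) * constMul (γ j.castSucc)) (partialD j)

theorem toField_constMul (A : SpinorMatrix d) (p : PolySpinor d) (ω : Sphere d) :
    toField (constMul A p) ω = WithLp.toLp 2 (A *ᵥ (toField p ω).ofLp) := by
  ext a
  simp [constMul_apply, Matrix.mulVec, dotProduct, MvPolynomial.smul_eval]

theorem toField_constMul_last (p : PolySpinor d) :
    toField (constMul (γ (Fin.last d)) p) = gammaMul γ (toField p) := by
  ext1 ω
  rw [toField_constMul, gammaMul_apply]

theorem toField_diracX (p : PolySpinor d) : toField (diracX γ p) = diracMul γ (toField p) := by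
  ext ω a
  rw [diracX, LinearMap.sum_apply, map_sum, ContinuousMap.sum_apply, diracMul_apply, diracSymbol,
    Matrix.sum_mulVec]
  simp only [Module.End.mul_apply, toField_constMul, WithLp.ofLp_sum, Finset.sum_apply]
  refine Finset.sum_congr rfl fun j _ => ?_
  simp only [Matrix.mulVec, dotProduct, toField_apply, coordMul_apply, map_mul,
    MvPolynomial.eval_X, Matrix.smul_apply, smul_eq_mul]
  exact Finset.sum_congr rfl fun b _ => by ring

end DiracOperator

/-! ### Monogenic polynomials and the spaces `V_k` -/

section Monogenic

variable {d : ℕ} {γ : Fin (d + 1) → SpinorMatrix d}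

/-- Homogeneous polynomial solutions of the Dirac equation. -/
noncomputable def monogenic (γ : Fin (d + 1) → SpinorMatrix d) (k : ℕ) : Submodule ℂ (PolySpinor d) :=
  (Submodule.pi Set.univ fun _ => MvPolynomial.homogeneousSubmodule (Fin d) ℂ k) ⊓
    LinearMap.ker (diracOp γ)

theorem mem_monogenic {k : ℕ} {p : PolySpinor d} :
    p ∈ monogenic γ k ↔ (∀ a, (p a).IsHomogeneous k) ∧ diracOp γ p = 0 := by
  simp [monogenic, Submodule.mem_pi]

theorem diracOp_diracOp (hγ : IsGammaFamily γ) (p : PolySpinor d) (a : Fin (spinorDim d)) :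
    diracOp γ (diracOp γ p) a = laplacian (p a) := by
  rw [← Module.End.mul_apply, diracOp_mul_self hγ, LinearMap.sum_apply, Finset.sum_apply,
    laplacian_apply]
  rfl

theorem diracOp_diracX (hγ : IsGammaFamily γ) {p : PolySpinor d} {k : ℕ}
    (hp : ∀ a, (p a).IsHomogeneous k) :
    diracOp γ (diracX γ p) = ((d + 2 * k : ℕ) : ℂ) • p - diracX γ (diracOp γ p) := by
  rw [← Module.End.mul_apply, diracOp_mul_diracX hγ]
  have h : (∑ j, coordMul j * partialD j : Module.End ℂ (PolySpinor d)) p = (k : ℂ) • p := by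
    funext a
    have := (hp a).sum_X_mul_pderiv
    rw [← Nat.cast_smul_eq_nsmul ℂ] at this
    rw [LinearMap.sum_apply, Finset.sum_apply]
    exact this
  simp only [LinearMap.sub_apply, LinearMap.add_apply, LinearMap.smul_apply, h,
    Module.End.mul_apply, Module.End.one_apply]
  push_cast
  module

theorem isHomogeneous_constMul {A : SpinorMatrix d} {p : PolySpinor d} {k : ℕ}
    (hp : ∀ a, (p a).IsHomogeneous k) (a : Fin (spinorDim d)) :
    (constMul A p a).IsHomogeneous k := by
  rw [constMul_apply, ← MvPolynomial.mem_homogeneousSubmodule]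
  exact Submodule.sum_mem _ fun b _ => Submodule.smul_mem _ _ (hp b)

theorem isHomogeneous_diracOp {p : PolySpinor d} {k : ℕ} (hp : ∀ a, (p a).IsHomogeneous k)
    (a : Fin (spinorDim d)) : (diracOp γ p a).IsHomogeneous (k - 1) := by
  rw [diracOp, LinearMap.sum_apply, Finset.sum_apply]
  exact MvPolynomial.IsHomogeneous.sum _ _ _ fun j _ =>
    isHomogeneous_constMul (fun b => (hp b).pderiv) a

theorem isHomogeneous_diracX {p : PolySpinor d} {k : ℕ} (hp : ∀ a, (p a).IsHomogeneous k)
    (a : Fin (spinorDim d)) : (diracX γ p a).IsHomogeneous (k + 1) := by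
  rw [diracX, LinearMap.sum_apply, Finset.sum_apply, add_comm]
  exact MvPolynomial.IsHomogeneous.sum _ _ _ fun j _ =>
    isHomogeneous_constMul (fun b => (MvPolynomial.isHomogeneous_X ℂ j).mul (hp b)) a

theorem harmonic_of_mem_monogenic (hγ : IsGammaFamily γ) {p : PolySpinor d} {k : ℕ}
    (hp : p ∈ monogenic γ k) (a : Fin (spinorDim d)) : p a ∈ harmonicPolynomial d k := by
  rw [mem_monogenic] at hp
  rw [mem_harmonicPolynomial]
  refine ⟨hp.1 a, ?_⟩
  rw [← diracOp_diracOp hγ, hp.2, map_zero, Pi.zero_apply]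

/-- The Dirac operator maps `x p` to a multiple of `p`, which it kills; hence its square, the
Laplacian, annihilates `x p`. -/
theorem harmonic_diracX (hγ : IsGammaFamily γ) {p : PolySpinor d} {k : ℕ}
    (hp : p ∈ monogenic γ k) (a : Fin (spinorDim d)) :
    diracX γ p a ∈ harmonicPolynomial d (k + 1) := by
  rw [mem_monogenic] at hp
  rw [mem_harmonicPolynomial]
  refine ⟨isHomogeneous_diracX hp.1 a, ?_⟩
  rw [← diracOp_diracOp hγ, diracOp_diracX hγ hp.1, hp.2]
  simp [hp.2]

theorem diracOp_mem_monogenic (hγ : IsGammaFamily γ) {p : PolySpinor d} {k : ℕ}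
    (hp : ∀ a, p a ∈ harmonicPolynomial d (k + 1)) : diracOp γ p ∈ monogenic γ k := by
  simp only [mem_harmonicPolynomial] at hp
  rw [mem_monogenic]
  exact ⟨isHomogeneous_diracOp fun a => (hp a).1,
    funext fun a => by rw [diracOp_diracOp hγ, (hp a).2]; rfl⟩

/-- The decomposition `H_{k+1} = M_{k+1} + x M_k`. -/
theorem exists_eq_add_diracX [NeZero d] (hγ : IsGammaFamily γ) {p : PolySpinor d} {k : ℕ}
    (hp : ∀ a, p a ∈ harmonicPolynomial d (k + 1)) :
    ∃ m ∈ monogenic γ (k + 1), ∃ q ∈ monogenic γ k, p = m + diracX γ q := by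
  have hq := diracOp_mem_monogenic hγ hp
  have hq' := Submodule.smul_mem _ ((d + 2 * k : ℕ) : ℂ)⁻¹ hq
  -- On monogenics of degree `k`, such as `D p`, the operator `D x` is multiplication by `d + 2k`;
  -- the inverse coefficient makes the subtraction remove all of `D p`.
  refine ⟨p - diracX γ (((d + 2 * k : ℕ) : ℂ)⁻¹ • diracOp γ p), ?_, _, hq', by simp⟩
  have hd : ((d + 2 * k : ℕ) : ℂ) ≠ 0 := by
    have := NeZero.pos d
    exact Nat.cast_ne_zero.mpr (by omega)
  rw [mem_monogenic] at hq' ⊢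
  refine ⟨fun a => (mem_harmonicPolynomial.mp (hp a)).1.sub (isHomogeneous_diracX hq'.1 a), ?_⟩
  rw [map_sub, diracOp_diracX hγ hq'.1, hq'.2, map_zero, sub_zero, smul_smul,
    mul_inv_cancel₀ hd, one_smul, sub_self]

/-- Divergence theorem for the field with components `⟨γ_j q, p⟩`: its radial component is `⟨x q,
p⟩`, and, the `γ_j` being Hermitian, its divergence is `⟨D q, p⟩ + ⟨q, D p⟩ = 0`. -/
theorem sphereInner_diracX_monogenic (hd : 2 ≤ d) (hγ : IsGammaFamily γ) {p q : PolySpinor d}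
    {k : ℕ} (hp : p ∈ monogenic γ (k + 1)) (hq : q ∈ monogenic γ k) :
    sphereInner (toField (diracX γ q)) (toField p) = 0 := by
  have : NeZero d := ⟨by omega⟩
  rw [mem_monogenic] at hp hq
  have h := sphInt_sum_X_mul (k := k + (k + 1))
    (a := fun j => ∑ a, conjPoly (constMul (γ j.castSucc) q a) * p a)
    (fun j => MvPolynomial.IsHomogeneous.sum _ _ _ fun a _ =>
      ((isHomogeneous_constMul hq.1 a).map _).mul (hp.1 a))
  have h1 : ∑ j, MvPolynomial.X j * ∑ a, conjPoly (constMul (γ j.castSucc) q a) * p a =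
      ∑ a, conjPoly (diracX γ q a) * p a := by
    simp only [Finset.mul_sum]
    rw [Finset.sum_comm]
    refine Finset.sum_congr rfl fun a _ => ?_
    simp only [diracX, LinearMap.sum_apply, Finset.sum_apply, map_sum, Finset.sum_mul,
      ← coordMul_mul_constMul, Module.End.mul_apply, coordMul_apply, map_mul, MvPolynomial.map_X]
    exact Finset.sum_congr rfl fun j _ => by ring
  have h2 : ∑ j, MvPolynomial.pderiv j (∑ a, conjPoly (constMul (γ j.castSucc) q a) * p a) =
      ∑ a, conjPoly (diracOp γ q a) * p a + ∑ b, conjPoly (q b) * diracOp γ p b := by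
    have e1 : ∑ a, conjPoly (diracOp γ q a) * p a =
        ∑ j, ∑ a, p a * MvPolynomial.pderiv j (conjPoly (constMul (γ j.castSucc) q a)) := by
      rw [Finset.sum_comm]
      refine Finset.sum_congr rfl fun a _ => ?_
      simp only [diracOp, LinearMap.sum_apply, Finset.sum_apply, map_sum, Finset.sum_mul,
        ← partialD_mul_constMul, Module.End.mul_apply, partialD_apply, MvPolynomial.pderiv_map]
      exact Finset.sum_congr rfl fun j _ => mul_comm _ _
    have e2 : ∑ b, conjPoly (q b) * diracOp γ p b =
        ∑ j, ∑ a, conjPoly (constMul (γ j.castSucc) q a) * MvPolynomial.pderiv j (p a) := by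
      simp only [diracOp, LinearMap.sum_apply, Finset.sum_apply, Module.End.mul_apply,
        constMul_apply, partialD_apply, Finset.mul_sum, map_sum, Finset.sum_mul]
      rw [Finset.sum_comm]
      refine Finset.sum_congr rfl fun j _ => ?_
      rw [Finset.sum_comm]
      refine Finset.sum_congr rfl fun a _ => Finset.sum_congr rfl fun b _ => ?_
      rw [← (hγ.isHermitian j.castSucc).apply a b, MvPolynomial.smul_eq_C_mul,
        MvPolynomial.smul_eq_C_mul, map_mul, MvPolynomial.map_C]
      simp only [RCLike.star_def, Complex.conj_conj]
      ring
    rw [e1, e2, ← Finset.sum_add_distrib]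
    simp only [map_sum, Derivation.leibniz, smul_eq_mul, ← Finset.sum_add_distrib]
    exact Finset.sum_congr rfl fun j _ => Finset.sum_congr rfl fun b _ => add_comm _ _
  rw [h1, h2, hp.2, hq.2] at h
  have hc : (d : ℂ) + (k + (k + 1) : ℕ) - 1 ≠ 0 := by
    intro h0
    have h3 : ((d + (k + (k + 1)) : ℕ) : ℂ) = (1 : ℕ) := by
      push_cast at h0 ⊢
      linear_combination h0
    have := Nat.cast_injective h3
    omega
  rw [sphereInner_toField, ← map_sum]
  simp only [Pi.zero_apply, map_zero, zero_mul, mul_zero, Finset.sum_const_zero, add_zero] at h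
  exact (mul_eq_zero.mp h).resolve_left hc

/-- The spaces `V_k` consist of the restrictions of monogenic polynomials. -/
theorem harmonicSubspace_eq (hd : 2 ≤ d) (hγ : IsGammaFamily γ) (k : ℕ) :
    harmonicSubspace γ k = (monogenic γ k).map toField := by
  have : NeZero d := ⟨by omega⟩
  induction k with
  | zero =>
    ext Y
    rw [harmonicSubspace, mem_sphericalHarmonic, Submodule.mem_map]
    constructor
    · rintro ⟨p, hp, rfl⟩
      refine ⟨p, mem_monogenic.mpr ⟨fun a => (mem_harmonicPolynomial.mp (hp a)).1, ?_⟩, rfl⟩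
      rw [diracOp, LinearMap.sum_apply]
      refine Finset.sum_eq_zero fun j _ => ?_
      have : partialD j p = 0 := funext fun a =>
        pderiv_eq_zero_of_isHomogeneous_zero (mem_harmonicPolynomial.mp (hp a)).1 j
      rw [Module.End.mul_apply, this, map_zero]
    · rintro ⟨p, hp, rfl⟩
      exact ⟨p, harmonic_of_mem_monogenic hγ hp, rfl⟩
  | succ k ih =>
    ext Y
    rw [harmonicSubspace, Submodule.mem_inf, mem_sphericalHarmonic, Submodule.mem_map, ih]
    constructor
    · rintro ⟨hY, p, hp, rfl⟩
      -- As `m` is already orthogonal to `Φ₀ V_k`, the hypothesis on the sum makes `x q` orthogonal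
      -- to itself.
      obtain ⟨m, hm, q, hq, rfl⟩ := exists_eq_add_diracX hγ hp
      have h0 := hY (toField (diracX γ q)) ⟨_, ⟨q, hq, rfl⟩, (toField_diracX q).symm⟩
      rw [map_add, sphereInner_add_right, sphereInner_diracX_monogenic hd hγ hm hq, zero_add] at h0
      refine ⟨m, hm, ?_⟩
      rw [map_add, eq_zero_of_sphereInner_self h0, add_zero]
    · rintro ⟨p, hp, rfl⟩
      refine ⟨?_, p, harmonic_of_mem_monogenic hγ hp, rfl⟩
      rintro _ ⟨_, ⟨q, hq, rfl⟩, rfl⟩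
      rw [← toField_diracX]
      exact sphereInner_diracX_monogenic hd hγ hp hq

theorem harmonicSubspace_le (k : ℕ) : harmonicSubspace γ k ≤ sphericalHarmonic d k := by
  cases k with
  | zero => exact le_rfl
  | succ k => exact inf_le_right

theorem diracMul_mem_sphericalHarmonic (hd : 2 ≤ d) (hγ : IsGammaFamily γ) {k : ℕ}
    {Y : SpinorField d} (hY : Y ∈ harmonicSubspace γ k) :
    diracMul γ Y ∈ sphericalHarmonic d (k + 1) := by
  rw [harmonicSubspace_eq hd hγ] at hY
  obtain ⟨p, hp, rfl⟩ := hY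
  rw [← toField_diracX]
  exact mem_sphericalHarmonic.mpr ⟨_, harmonic_diracX hγ hp, rfl⟩

theorem sphericalHarmonic_succ_le (hd : 2 ≤ d) (hγ : IsGammaFamily γ) (k : ℕ) :
    sphericalHarmonic d (k + 1) ≤
      harmonicSubspace γ (k + 1) ⊔ (harmonicSubspace γ k).map (diracMul γ) := by
  have : NeZero d := ⟨by omega⟩
  intro Y hY
  obtain ⟨p, hp, rfl⟩ := mem_sphericalHarmonic.mp hY
  obtain ⟨m, hm, q, hq, rfl⟩ := exists_eq_add_diracX hγ hp
  rw [map_add, toField_diracX, harmonicSubspace_eq hd hγ, harmonicSubspace_eq hd hγ]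
  exact Submodule.add_mem_sup ⟨m, hm, rfl⟩ ⟨_, ⟨q, hq, rfl⟩, rfl⟩

theorem gammaMul_mem_harmonicSubspace (hd : 2 ≤ d) (hγ : IsGammaFamily γ) {k : ℕ}
    {Y : SpinorField d} (hY : Y ∈ harmonicSubspace γ k) : gammaMul γ Y ∈ harmonicSubspace γ k := by
  rw [harmonicSubspace_eq hd hγ] at hY ⊢
  obtain ⟨p, hp, rfl⟩ := hY
  rw [← toField_constMul_last]
  refine ⟨_, mem_monogenic.mpr ⟨isHomogeneous_constMul (mem_monogenic.mp hp).1, ?_⟩, rfl⟩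
  rw [← Module.End.mul_apply, constMul_last_mul_diracOp hγ, LinearMap.neg_apply,
    Module.End.mul_apply, (mem_monogenic.mp hp).2, map_zero, neg_zero]

theorem mem_signedSubspace {μ : ℤˣ} {k : ℕ} {Y : SpinorField d} :
    Y ∈ signedSubspace γ μ k ↔
      Y ∈ harmonicSubspace γ k ∧ gammaMul γ Y = ((μ : ℤ) : ℂ) • Y := by
  rw [signedSubspace, Submodule.mem_inf, Module.End.mem_eigenspace_iff]

/-- `γ_{d+1}` is an involution of `V_k`, so `Y` is half the sum of the eigenvectors `Y ± γ_{d+1} Y`.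
-/
theorem harmonicSubspace_le_iSup_signedSubspace (hd : 2 ≤ d) (hγ : IsGammaFamily γ) (k : ℕ) :
    harmonicSubspace γ k ≤ ⨆ μ, signedSubspace γ μ k := by
  intro Y hY
  have hG := gammaMul_mem_harmonicSubspace hd hγ hY
  have h1 : Y + gammaMul γ Y ∈ signedSubspace γ 1 k := by
    refine mem_signedSubspace.mpr ⟨Submodule.add_mem _ hY hG, ?_⟩
    rw [map_add, gammaMul_gammaMul hγ]
    simp [add_comm]
  have h2 : Y - gammaMul γ Y ∈ signedSubspace γ (-1) k := by
    refine mem_signedSubspace.mpr ⟨Submodule.sub_mem _ hY hG, ?_⟩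
    rw [map_sub, gammaMul_gammaMul hγ]
    ext ω a
    simp
  have h3 : Y = (1 / 2 : ℂ) • ((Y + gammaMul γ Y) + (Y - gammaMul γ Y)) := by module
  rw [h3]
  exact Submodule.smul_mem _ _ (Submodule.add_mem _ (Submodule.mem_iSup_of_mem 1 h1)
    (Submodule.mem_iSup_of_mem (-1) h2))

end Monogenic

/-! ### The columns of the blocks -/

section Column

variable {d : ℕ} {γ : Fin (d + 1) → SpinorMatrix d}

/-- The columns of a block. -/
noncomputable def column (γ : Fin (d + 1) → SpinorMatrix d) (μ : ℤˣ) (e : SpinorField d)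
    (c : Fin 2) : SpinorField d :=
  if (μ = 1 ↔ c = 0) then e else diracMul γ e

theorem block_apply (μ : ℤˣ) (e : SpinorField d) (ω : Sphere d) (a : Fin (spinorDim d))
    (c : Fin 2) : block γ μ e ω a c = column γ μ e c ω a := by
  unfold block column
  fin_cases c <;> by_cases h : μ = 1 <;> simp [h, twoColumns]

/-- The degree of a column of a block. -/
def columnDegree (μ : ℤˣ) (k : ℕ) (c : Fin 2) : ℕ :=
  if (μ = 1 ↔ c = 0) then k else k + 1

theorem column_mem_sphericalHarmonic (hd : 2 ≤ d) (hγ : IsGammaFamily γ) {μ : ℤˣ} {k : ℕ}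
    {e : SpinorField d} (he : e ∈ signedSubspace γ μ k) (c : Fin 2) :
    column γ μ e c ∈ sphericalHarmonic d (columnDegree μ k c) := by
  unfold column columnDegree
  split_ifs
  · exact harmonicSubspace_le k (mem_signedSubspace.mp he).1
  · exact diracMul_mem_sphericalHarmonic hd hγ (mem_signedSubspace.mp he).1

variable {ι : ℤˣ → ℕ → Type*} {e : (μ : ℤˣ) → (k : ℕ) → ι μ k → SpinorField d}

theorem IsOrthonormalBasis.mem {W : Submodule ℂ (SpinorField d)} {J : Type*}
    {e : J → SpinorField d} (he : IsOrthonormalBasis W e) (n : J) : e n ∈ W := by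
  rw [← he.span_eq]
  exact Submodule.subset_span ⟨n, rfl⟩

/-- Eigenvectors of a Hermitian operator for distinct real eigenvalues are orthogonal; here the
inner product equals its own negative. -/
theorem sphereInner_signedSubspace (hγ : IsGammaFamily γ) {μ ν : ℤˣ} (hμν : μ ≠ ν) {k l : ℕ}
    {Y Z : SpinorField d} (hY : Y ∈ signedSubspace γ μ k) (hZ : Z ∈ signedSubspace γ ν l) :
    sphereInner Y Z = 0 := by
  have h := sphereInner_gammaMul_left hγ Y Z
  rw [(mem_signedSubspace.mp hY).2, (mem_signedSubspace.mp hZ).2, sphereInner_smul_left,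
    sphereInner_smul_right] at h
  rcases Int.units_eq_one_or μ with rfl | rfl <;> rcases Int.units_eq_one_or ν with rfl | rfl
  · exact absurd rfl hμν
  · simp only [Units.val_one, Units.val_neg, Int.cast_one, Int.cast_neg, map_one] at h
    linear_combination h / 2
  · simp only [Units.val_one, Units.val_neg, Int.cast_one, Int.cast_neg, map_one, map_neg] at h
    linear_combination -h / 2
  · exact absurd rfl hμν

theorem sphereInner_basis (hd : 2 ≤ d) (hγ : IsGammaFamily γ)
    (he : ∀ μ k, IsOrthonormalBasis (signedSubspace γ μ k) (e μ k))
    {i j : Σ p : ℤˣ × ℕ, ι p.1 p.2} (hij : i ≠ j) :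
    sphereInner (e i.1.1 i.1.2 i.2) (e j.1.1 j.1.2 j.2) = 0 := by
  obtain ⟨⟨μ, k⟩, m⟩ := i
  obtain ⟨⟨ν, l⟩, n⟩ := j
  have hm := (he μ k).mem m
  have hn := (he ν l).mem n
  by_cases hkl : k = l
  · by_cases hμν : μ = ν
    · subst hkl hμν
      exact (he μ k).orthogonal m n (by rintro rfl; exact hij rfl)
    · exact sphereInner_signedSubspace hγ hμν hm hn
  · exact sphereInner_eq_zero_of_degree_ne hd hkl
      (harmonicSubspace_le k (mem_signedSubspace.mp hm).1)
      (harmonicSubspace_le l (mem_signedSubspace.mp hn).1)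

/-- `Φ₀ Y` has degree `k + 1`. Against `V_{k+1}` the orthogonality is built into the recursion;
against other degrees it is that of spherical harmonics. -/
theorem sphereInner_diracMul_eq_zero (hd : 2 ≤ d) (hγ : IsGammaFamily γ) {k l : ℕ}
    {Y Z : SpinorField d} (hY : Y ∈ harmonicSubspace γ k) (hZ : Z ∈ harmonicSubspace γ l) :
    sphereInner (diracMul γ Y) Z = 0 := by
  by_cases hkl : k + 1 = l
  · subst hkl
    exact hZ.1 _ ⟨Y, hY, rfl⟩
  · exact sphereInner_eq_zero_of_degree_ne hd hkl (diracMul_mem_sphericalHarmonic hd hγ hY)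
      (harmonicSubspace_le l hZ)

/-- The columns of all the blocks are orthonormal. -/
theorem sphereInner_column (hd : 2 ≤ d) (hγ : IsGammaFamily γ)
    (he : ∀ μ k, IsOrthonormalBasis (signedSubspace γ μ k) (e μ k))
    (i j : Σ p : ℤˣ × ℕ, ι p.1 p.2) (c c' : Fin 2) :
    sphereInner (column γ i.1.1 (e i.1.1 i.1.2 i.2) c) (column γ j.1.1 (e j.1.1 j.1.2 j.2) c') =
      open Classical in if i = j ∧ c = c' then 1 else 0 := by
  have hi := (mem_signedSubspace.mp ((he i.1.1 i.1.2).mem i.2)).1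
  have hj := (mem_signedSubspace.mp ((he j.1.1 j.1.2).mem j.2)).1
  by_cases hij : i = j
  · subst hij
    have h1 := (he i.1.1 i.1.2).norm_one i.2
    have h2 := sphereInner_diracMul_eq_zero hd hγ hi hi
    have h3 := sphereInner_eq_zero_comm h2
    unfold column
    by_cases hμ : i.1.1 = 1 <;> fin_cases c <;> fin_cases c' <;>
      simp [hμ, sphereInner_diracMul_diracMul hγ] <;> simp_all
  · rw [if_neg (fun h => hij h.1)]
    have h1 := sphereInner_basis hd hγ he hij
    unfold column
    split_ifs
    · exact h1
    · exact sphereInner_eq_zero_comm (sphereInner_diracMul_eq_zero hd hγ hj hi)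
    · exact sphereInner_diracMul_eq_zero hd hγ hi hj
    · rw [sphereInner_diracMul_diracMul hγ, h1]

/-- The columns of all the blocks span the spherical harmonics. -/
theorem iSup_sphericalHarmonic_le_span_column (hd : 2 ≤ d) (hγ : IsGammaFamily γ)
    (he : ∀ μ k, IsOrthonormalBasis (signedSubspace γ μ k) (e μ k)) :
    ⨆ k, sphericalHarmonic d k ≤ Submodule.span ℂ (Set.range
      fun z : (Σ p : ℤˣ × ℕ, ι p.1 p.2) × Fin 2 =>
        column γ z.1.1.1 (e z.1.1.1 z.1.1.2 z.1.2) z.2) := by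
  set S := Submodule.span ℂ (Set.range
      fun z : (Σ p : ℤˣ × ℕ, ι p.1 p.2) × Fin 2 =>
        column γ z.1.1.1 (e z.1.1.1 z.1.1.2 z.1.2) z.2)
  have hmem : ∀ μ k (n : ι μ k), e μ k n ∈ S ∧ diracMul γ (e μ k n) ∈ S := by
    intro μ k n
    have h : ∀ c, column γ μ (e μ k n) c ∈ S := fun c => Submodule.subset_span (R := ℂ) (Set.mem_range_self
      (f := fun z : (Σ p : ℤˣ × ℕ, ι p.1 p.2) × Fin 2 =>
        column γ z.1.1.1 (e z.1.1.1 z.1.1.2 z.1.2) z.2) (⟨⟨(μ, k), n⟩, c⟩))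
    have h0 := h 0
    have h1 := h 1
    rcases Int.units_eq_one_or μ with rfl | rfl
    · exact ⟨by simpa [column] using h0, by simpa [column] using h1⟩
    · exact ⟨by simpa [column] using h1, by simpa [column] using h0⟩
  -- Every block contributes both `e` and `Φ₀ e`, so the span contains `V_k` and `Φ₀ V_k` for all
  -- `k`, the summands of the spherical harmonics.
  have hV : ∀ k, harmonicSubspace γ k ≤ S ⊓ S.comap (diracMul γ) := by
    intro k
    refine (harmonicSubspace_le_iSup_signedSubspace hd hγ k).trans (iSup_le fun μ => ?_)
    rw [← (he μ k).span_eq, Submodule.span_le]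
    rintro _ ⟨n, rfl⟩
    exact hmem μ k n
  refine iSup_le fun k => ?_
  cases k with
  | zero => exact (hV 0).trans inf_le_left
  | succ k =>
    refine (sphericalHarmonic_succ_le hd hγ k).trans (sup_le ((hV _).trans inf_le_left) ?_)
    exact Submodule.map_le_iff_le_comap.mpr ((hV k).trans inf_le_right)

end Column

/-! ### Zonal harmonics -/

section Zonal

variable {d : ℕ}

/-- The linear form `x ↦ ω · x`. -/
noncomputable def linearForm (ω : Space d) : MvPolynomial (Fin d) ℂ :=
  ∑ j, (ω j : ℂ) • MvPolynomial.X j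

/-- The derivative in the direction `ω`. -/
noncomputable def dirDeriv (ω : Space d) :
    Derivation ℂ (MvPolynomial (Fin d) ℂ) (MvPolynomial (Fin d) ℂ) :=
  ∑ j, (ω j : ℂ) • MvPolynomial.pderiv j

theorem dirDeriv_apply (ω : Space d) (p : MvPolynomial (Fin d) ℂ) :
    dirDeriv ω p = ∑ j, (ω j : ℂ) • MvPolynomial.pderiv j p := by
  have h : ∀ s : Finset (Fin d), (∑ j ∈ s, (ω j : ℂ) • MvPolynomial.pderiv (R := ℂ) j) p =
      ∑ j ∈ s, (ω j : ℂ) • MvPolynomial.pderiv j p := by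
    intro s
    classical
    induction s using Finset.induction_on with
    | empty => simp
    | insert a s ha ih =>
      rw [Finset.sum_insert ha, Finset.sum_insert ha, Derivation.add_apply, ih,
        Derivation.smul_apply]
  exact h Finset.univ

theorem evalAt_linearForm (ω x : Space d) : evalAt x (linearForm ω) = (inner ℝ ω x : ℝ) := by
  simp [linearForm, PiLp.inner_apply, MvPolynomial.smul_eval, mul_comm, -Complex.coe_smul]

theorem isHomogeneous_linearForm (ω : Space d) : (linearForm ω).IsHomogeneous 1 := by
  rw [linearForm, ← MvPolynomial.mem_homogeneousSubmodule]
  exact Submodule.sum_mem _ fun j _ =>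
    Submodule.smul_mem _ _ (MvPolynomial.isHomogeneous_X ℂ j)

theorem pderiv_linearForm (ω : Space d) (j : Fin d) :
    MvPolynomial.pderiv j (linearForm ω) = MvPolynomial.C (ω j : ℂ) := by
  simp [linearForm, MvPolynomial.pderiv_X, Pi.single_apply, MvPolynomial.smul_eq_C_mul]

theorem dirDeriv_linearForm (ω : Sphere d) : dirDeriv ω (linearForm (ω : Space d)) = 1 := by
  have h : ∑ j, ((ω : Space d) j : ℂ) * ((ω : Space d) j : ℂ) = 1 := by
    have h2 := EuclideanSpace.norm_sq_eq (ω : Space d)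
    rw [norm_eq_of_mem_sphere] at h2
    have h3 := congrArg (fun t : ℝ => (t : ℂ)) h2
    simp only [Real.norm_eq_abs, sq_abs] at h3
    push_cast at h3
    rw [one_pow] at h3
    rw [h3]
    exact Finset.sum_congr rfl fun j _ => (sq _).symm
  simp only [dirDeriv_apply, pderiv_linearForm, MvPolynomial.smul_eq_C_mul, ← map_mul, ← map_sum, h,
    map_one]

theorem dirDeriv_mem_harmonicPolynomial (ω : Space d) {p : MvPolynomial (Fin d) ℂ} {k : ℕ}
    (hp : p ∈ harmonicPolynomial d k) : dirDeriv ω p ∈ harmonicPolynomial d (k - 1) := by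
  rw [dirDeriv_apply]
  exact Submodule.sum_mem _ fun j _ => Submodule.smul_mem _ _ (pderiv_mem_harmonicPolynomial hp j)

/-- Euler's identity at `ω` itself; it shows that the derivative along `ω` inherits a zero at `ω`.
-/
theorem evalAt_dirDeriv_self (ω : Space d) {p : MvPolynomial (Fin d) ℂ} {k : ℕ}
    (hp : p.IsHomogeneous k) : evalAt ω (dirDeriv ω p) = k * evalAt ω p := by
  have h := congrArg (evalAt ω) hp.sum_X_mul_pderiv
  rw [dirDeriv_apply]
  simpa [MvPolynomial.smul_eval, -Complex.coe_smul] using h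

theorem sphInt_linearForm_mul [NeZero d] (ω : Space d) {p : MvPolynomial (Fin d) ℂ} {k : ℕ}
    (hp : p.IsHomogeneous k) :
    ((d : ℂ) + k - 1) * sphInt (linearForm ω * p) = sphInt (dirDeriv ω p) := by
  simp only [linearForm, dirDeriv_apply, Finset.sum_mul, smul_mul_assoc, map_sum, map_smul,
    Finset.mul_sum, smul_eq_mul, ← sphInt_X_mul hp]
  exact Finset.sum_congr rfl fun j _ => by ring

theorem dirDeriv_linearForm_pow_mul (ω : Sphere d) (n : ℕ) (p : MvPolynomial (Fin d) ℂ) :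
    dirDeriv ω (linearForm (ω : Space d) ^ n * p) =
      linearForm (ω : Space d) ^ n * dirDeriv ω p +
        (n : ℂ) • (linearForm (ω : Space d) ^ (n - 1) * p) := by
  rw [Derivation.leibniz, Derivation.leibniz_pow, dirDeriv_linearForm, smul_eq_mul, smul_eq_mul,
    smul_eq_mul, mul_one, Nat.cast_smul_eq_nsmul, nsmul_eq_mul, nsmul_eq_mul]
  ring

theorem natCast_add_sub_one_ne_zero (hd : 2 ≤ d) (n : ℕ) : (d : ℂ) + n - 1 ≠ 0 := by
  intro h0
  have h3 : ((d + n : ℕ) : ℂ) = (1 : ℕ) := by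
    push_cast
    linear_combination h0
  have := Nat.cast_injective h3
  omega

/-- A harmonic polynomial that vanishes at `ω` is orthogonal to the powers of `ω · η`. -/
theorem sphInt_linearForm_pow_mul_eq_zero (hd : 2 ≤ d) (ω : Sphere d) (n : ℕ) :
    ∀ (k : ℕ) (p : MvPolynomial (Fin d) ℂ), p ∈ harmonicPolynomial d k →
      evalAt (ω : Space d) p = 0 → sphInt (linearForm (ω : Space d) ^ n * p) = 0 := by
  have : NeZero d := ⟨by omega⟩
  induction n using Nat.strong_induction_on with
  | _ n ih =>
    intro k p hp h0
    have hph := (mem_harmonicPolynomial.mp hp).1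
    rcases n with _ | n
    -- For exponent zero the claim is orthogonality to constants. The zero at `ω` matters only in
    -- degree zero, where it forces `p = 0`.
    · rw [pow_zero]
      by_cases hk : k = 0
      · subst hk
        rw [← MvPolynomial.totalDegree_zero_iff_isHomogeneous,
          MvPolynomial.totalDegree_eq_zero_iff_eq_C] at hph
        rw [hph, evalAt, MvPolynomial.eval_C] at h0
        rw [hph, h0, map_zero, mul_zero, map_zero]
      · refine sphInt_mul_eq_zero hd (Ne.symm hk) (mem_harmonicPolynomial.mpr
          ⟨MvPolynomial.isHomogeneous_one _ _, ?_⟩) hp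
        simp [laplacian_apply]
    · have hhom : (linearForm (ω : Space d) ^ n * p).IsHomogeneous (1 * n + k) :=
        ((isHomogeneous_linearForm _).pow n).mul hph
      -- Integration by parts trades one factor `ω · η` for a derivative along `ω`. It falls on `p`,
      -- which stays harmonic and zero at `ω`, or on the power; both remaining exponents are below
      -- `n + 1`.
      have h := sphInt_linearForm_mul (ω : Space d) hhom
      rw [dirDeriv_linearForm_pow_mul, map_add, map_smul,
        ih n (by omega) (k - 1) _ (dirDeriv_mem_harmonicPolynomial _ hp)
          (by rw [evalAt_dirDeriv_self _ hph, h0, mul_zero])] at h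
      have h1 : (n : ℂ) • sphInt (linearForm (ω : Space d) ^ (n - 1) * p) = 0 := by
        rcases n with _ | n
        · simp
        · rw [Nat.add_sub_cancel, ih n (by omega) k p hp h0, smul_zero]
      rw [h1, add_zero] at h
      rw [pow_succ', mul_assoc]
      exact (mul_eq_zero.mp h).resolve_left (natCast_add_sub_one_ne_zero hd _)

/-- The zonal harmonic `|x|^k P_k(ω · x / |x|)`. -/
noncomputable def zonal (ω : Space d) : ℕ → MvPolynomial (Fin d) ℂ
  | 0 => 1
  | 1 => linearForm ω
  | k + 2 => ((k : ℂ) + d - 1)⁻¹ • (((2 : ℂ) * k + d) • (linearForm ω * zonal ω (k + 1)) -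
      ((k : ℂ) + 1) • (normSq d * zonal ω k))

theorem zonal_add_two (hd : 2 ≤ d) (ω : Space d) (k : ℕ) :
    ((k : ℂ) + d - 1) • zonal ω (k + 2) =
      ((2 : ℂ) * k + d) • (linearForm ω * zonal ω (k + 1)) -
        ((k : ℂ) + 1) • (normSq d * zonal ω k) := by
  have h : (k : ℂ) + d - 1 ≠ 0 := by
    rw [add_comm (k : ℂ)]
    exact natCast_add_sub_one_ne_zero hd k
  rw [zonal, smul_smul, mul_inv_cancel₀ h, one_smul]

theorem evalAt_zonal (ω η : Sphere d) (k : ℕ) :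
    evalAt (η : Space d) (zonal (ω : Space d) k) =
      (legendre d k (inner ℝ (ω : Space d) (η : Space d)) : ℝ) := by
  induction k using Nat.twoStepInduction with
  | zero => simp [zonal, legendre]
  | one => simp only [zonal, legendre, evalAt_linearForm]
  | more k h0 h1 =>
    rw [zonal, legendre]
    simp only [MvPolynomial.smul_eval, map_sub, map_mul, h0, h1, evalAt_linearForm,
      evalAt_normSq_sphere]
    push_cast
    ring

/-- Gives the zonal harmonic the value one at its pole, so that subtracting `p(ω)` times it creates
a zero at `ω`. -/
theorem legendre_one (hd : 2 ≤ d) (k : ℕ) : legendre d k 1 = 1 := by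
  induction k using Nat.twoStepInduction with
  | zero => rfl
  | one => rfl
  | more k h0 h1 =>
    have : (2 : ℝ) ≤ d := by exact_mod_cast hd
    have hk : (0 : ℝ) ≤ k := k.cast_nonneg
    rw [legendre, h0, h1, div_eq_one_iff_eq (by linarith)]
    ring

theorem dirDeriv_normSq (ω : Space d) : dirDeriv ω (normSq d) = 2 * linearForm ω := by
  simp only [dirDeriv_apply, pderiv_normSq, linearForm, Finset.mul_sum, mul_smul_comm]

/-- Differentiating the three-term recurrence along `ω` yields a recurrence for the derivatives.
Needed for harmonicity, where the Laplacian of `(ω · x) Z` is twice the derivative of `Z` along `ω`.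
-/
theorem dirDeriv_zonal_succ (hd : 2 ≤ d) (ω : Sphere d) (k : ℕ) :
    dirDeriv ω (zonal (ω : Space d) (k + 1)) = ((k : ℂ) + 1) • zonal (ω : Space d) k := by
  have key : ∀ k : ℕ, ((k : ℂ) + d - 1) • dirDeriv ω (zonal (ω : Space d) (k + 2)) =
      ((2 : ℂ) * k + d) • (linearForm (ω : Space d) * dirDeriv ω (zonal (ω : Space d) (k + 1)) +
        zonal (ω : Space d) (k + 1)) -
      ((k : ℂ) + 1) • (normSq d * dirDeriv ω (zonal (ω : Space d) k) +
        (2 : ℂ) • (linearForm (ω : Space d) * zonal (ω : Space d) k)) := by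
    intro k
    rw [← Derivation.map_smul, zonal_add_two hd, map_sub, Derivation.map_smul, Derivation.map_smul,
      Derivation.leibniz, Derivation.leibniz, dirDeriv_linearForm, dirDeriv_normSq]
    simp only [smul_eq_mul, mul_one, ofNat_smul_eq_nsmul, nsmul_eq_mul]
    congr 3
    push_cast
    ring
  have hcancel : ∀ k : ℕ, ∀ p q : MvPolynomial (Fin d) ℂ,
      ((k : ℂ) + d - 1) • p = ((k : ℂ) + d - 1) • q → p = q := fun k p q h =>
    smul_right_injective _ (by
      rw [add_comm (k : ℂ)]
      exact natCast_add_sub_one_ne_zero hd k) h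
  induction k using Nat.twoStepInduction with
  | zero => simp [zonal, dirDeriv_linearForm]
  | one =>
    refine hcancel 0 _ _ ((key 0).trans ?_)
    simp only [zonal, dirDeriv_linearForm, Derivation.map_one_eq_zero, mul_zero, mul_one]
    push_cast
    module
  | more k h0 h1 =>
    apply hcancel (k + 1)
    rw [key (k + 1), h1, h0]
    -- Once `|x|² Z_k` is eliminated by the recurrence, the terms with `ω · x` cancel and `(k + 3)(k
    -- + d) Z_{k+2}` remains.
    have hr := zonal_add_two hd (ω : Space d) k
    rw [eq_sub_iff_add_eq, add_comm, ← eq_sub_iff_add_eq] at hr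
    rw [mul_smul_comm, mul_smul_comm, smul_add (((k + 1 : ℕ) : ℂ) + 1), hr]
    push_cast
    module

theorem zonal_mem_harmonicPolynomial (hd : 2 ≤ d) (ω : Sphere d) (k : ℕ) :
    zonal (ω : Space d) k ∈ harmonicPolynomial d k := by
  have hlin : laplacian (linearForm (ω : Space d)) = 0 :=
    laplacian_eq_zero_of_isHomogeneous one_lt_two (isHomogeneous_linearForm _)
  induction k using Nat.twoStepInduction with
  | zero =>
    exact mem_harmonicPolynomial.mpr ⟨MvPolynomial.isHomogeneous_one _ _,
      laplacian_eq_zero_of_isHomogeneous two_pos (MvPolynomial.isHomogeneous_one _ _)⟩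
  | one => exact mem_harmonicPolynomial.mpr ⟨isHomogeneous_linearForm _, hlin⟩
  | more k h0 h1 =>
    rw [mem_harmonicPolynomial] at h0 h1 ⊢
    constructor
    · rw [zonal, ← MvPolynomial.mem_homogeneousSubmodule]
      refine Submodule.smul_mem _ _ (Submodule.sub_mem _ (Submodule.smul_mem _ _ ?_)
        (Submodule.smul_mem _ _ ?_))
      · have := (isHomogeneous_linearForm (ω : Space d)).mul h1.1
        rwa [show 1 + (k + 1) = k + 2 by ring] at this
      · have := (isHomogeneous_normSq (d := d)).mul h0.1
        rwa [show 2 + k = k + 2 by ring] at this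
    -- With the coefficients of the recurrence this term cancels the `(2d + 4k) Z_k` that comes from
    -- `|x|² Z_k`.
    · have h2 : laplacian (linearForm (ω : Space d) * zonal (ω : Space d) (k + 1)) =
          (2 * ((k : ℂ) + 1)) • zonal (ω : Space d) k := by
        rw [laplacian_mul, hlin, h1.2, mul_zero, mul_zero, zero_add, zero_add, mul_smul,
          ← dirDeriv_zonal_succ hd, dirDeriv_apply]
        simp only [pderiv_linearForm, ← MvPolynomial.smul_eq_C_mul]
        rw [ofNat_smul_eq_nsmul, nsmul_eq_mul]
        rfl
      rw [zonal, map_smul, map_sub, map_smul, map_smul, h2, laplacian_normSq_mul h0.1, h0.2,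
        mul_zero, add_zero]
      push_cast
      module

/-- Funk--Hecke for the powers of `ω · η`. -/
theorem sphInt_linearForm_pow_mul (hd : 2 ≤ d) (ω : Sphere d) (n : ℕ) {k : ℕ}
    {p : MvPolynomial (Fin d) ℂ} (hp : p ∈ harmonicPolynomial d k) :
    sphInt (linearForm (ω : Space d) ^ n * (p - evalAt (ω : Space d) p • zonal (ω : Space d) k)) =
      0 := by
  refine sphInt_linearForm_pow_mul_eq_zero hd ω n k _ (Submodule.sub_mem _ hp
    (Submodule.smul_mem _ _ (zonal_mem_harmonicPolynomial hd ω k))) ?_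
  rw [map_sub, MvPolynomial.smul_eval, evalAt_zonal, real_inner_self_eq_norm_sq,
    norm_eq_of_mem_sphere, one_pow, legendre_one hd]
  simp

end Zonal

/-! ### The weight `(1 - t²)^{(d-3)/2}` -/

section Weight

/-- The weight `(1 - t²)^{(d-3)/2}`. -/
noncomputable def weight (d : ℕ) (t : ℝ) : ℝ := (1 - t ^ 2) ^ (((d : ℝ) - 3) / 2)

theorem one_sub_sq_pos {t : ℝ} (ht : t ∈ Set.Ioo (-1 : ℝ) 1) : 0 < 1 - t ^ 2 := by
  nlinarith [ht.1, ht.2]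

theorem weight_pos (d : ℕ) {t : ℝ} (ht : t ∈ Set.Ioo (-1 : ℝ) 1) : 0 < weight d t :=
  Real.rpow_pos_of_pos (one_sub_sq_pos ht) _

theorem weight_add_two (d : ℕ) {t : ℝ} (ht : t ∈ Set.Ioo (-1 : ℝ) 1) :
    weight (d + 2) t = (1 - t ^ 2) * weight d t := by
  have h : (((d + 2 : ℕ) : ℝ) - 3) / 2 = ((d : ℝ) - 3) / 2 + 1 := by
    push_cast
    ring
  rw [weight, weight, h, Real.rpow_add_one (one_sub_sq_pos ht).ne', mul_comm]

theorem weight_two (t : ℝ) (ht : t ∈ Set.Ioo (-1 : ℝ) 1) : weight 2 t = 1 / √(1 - t ^ 2) := by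
  rw [weight, Real.sqrt_eq_rpow, one_div, ← Real.rpow_neg (one_sub_sq_pos ht).le]
  norm_num

/-- For `d = 2` the exponent is `-1/2` and the weight blows up at both ends; it is integrable as the
derivative of the arcsine. -/
theorem integrableOn_weight_two : IntegrableOn (weight 2) (Set.Ioo (-1 : ℝ) 1) := by
  have h := intervalIntegral.integrableOn_deriv_of_nonneg (a := -1) (b := 1) (g := Real.arcsin)
    (g' := weight 2) Real.continuous_arcsin.continuousOn
    (fun t ht => by
      rw [weight_two t ht]
      exact Real.hasDerivAt_arcsin ht.1.ne' ht.2.ne)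
    (fun t ht => (weight_pos 2 ht).le)
  exact h.mono_set Set.Ioo_subset_Ioc_self

theorem continuous_weight {d : ℕ} (hd : 3 ≤ d) : Continuous (weight d) := by
  have : (3 : ℝ) ≤ d := by exact_mod_cast hd
  exact Continuous.rpow_const (by fun_prop) fun t => Or.inr (by linarith)

theorem integrableOn_weight {d : ℕ} (hd : 2 ≤ d) : IntegrableOn (weight d) (Set.Ioo (-1 : ℝ) 1) := by
  rcases hd.eq_or_lt with rfl | hd
  · exact integrableOn_weight_two
  · exact (continuous_weight hd).integrableOn_Icc.mono_set Set.Ioo_subset_Icc_self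

theorem integrableOn_pow_mul_weight {d : ℕ} (hd : 2 ≤ d) (n : ℕ) :
    IntegrableOn (fun t => t ^ n * weight d t) (Set.Ioo (-1 : ℝ) 1) := by
  refine Integrable.bdd_mul (c := 1) (integrableOn_weight hd) (by fun_prop) ?_
  filter_upwards [ae_restrict_mem measurableSet_Ioo] with t ht
  rw [norm_pow, Real.norm_eq_abs]
  exact pow_le_one₀ (abs_nonneg _) (abs_le.mpr ⟨ht.1.le, ht.2.le⟩)

/-- The recurrence of the moments of the weight. -/
theorem integral_pow_add_two_mul_weight {d : ℕ} (hd : 2 ≤ d) (n : ℕ) :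
    ((n : ℝ) + d) * ∫ t in Set.Ioo (-1 : ℝ) 1, t ^ (n + 2) * weight d t =
      ((n : ℝ) + 1) * ∫ t in Set.Ioo (-1 : ℝ) 1, t ^ n * weight d t := by
  have hd' : (2 : ℝ) ≤ d := by exact_mod_cast hd
  have hexp : ((d + 2 : ℕ) : ℝ) - 3 = d - 1 := by push_cast; ring
  -- The antiderivative carries the weight of dimension `d + 2`, whose exponent `(d - 1)/2` is
  -- positive: it is continuous up to the ends and vanishes there, even if `weight d` is singular.
  have hderiv : ∀ t ∈ Set.Ioo (-1 : ℝ) 1, HasDerivAt (fun t => t ^ (n + 1) * weight (d + 2) t)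
      ((n + 1) * (t ^ n * weight d t) - (n + d) * (t ^ (n + 2) * weight d t)) t := by
    intro t ht
    have h1 : HasDerivAt (fun t : ℝ => 1 - t ^ 2) (-(2 * t)) t := by
      simpa using (hasDerivAt_pow 2 t).const_sub 1
    have h2 := h1.rpow_const (p := (((d + 2 : ℕ) : ℝ) - 3) / 2) (Or.inl (one_sub_sq_pos ht).ne')
    have h3 := (hasDerivAt_pow (n + 1) t).mul h2
    refine h3.congr_deriv ?_
    have h4 : (((d + 2 : ℕ) : ℝ) - 3) / 2 - 1 = ((d : ℝ) - 3) / 2 := by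
      push_cast
      ring
    have h5 : (1 - t ^ 2) ^ ((((d + 2 : ℕ) : ℝ) - 3) / 2) = (1 - t ^ 2) * weight d t :=
      weight_add_two d ht
    have h6 : (1 - t ^ 2) ^ (((d : ℝ) - 3) / 2) = weight d t := rfl
    rw [h4, h5, h6, hexp]
    push_cast
    ring
  have hcont : ContinuousOn (fun t => t ^ (n + 1) * weight (d + 2) t) (Set.Icc (-1 : ℝ) 1) :=
    ((continuous_pow _).mul (continuous_weight (by omega))).continuousOn
  have hi0 := (integrableOn_pow_mul_weight hd n).const_mul ((n : ℝ) + 1)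
  have hi2 := (integrableOn_pow_mul_weight hd (n + 2)).const_mul ((n : ℝ) + d)
  have hint : IntervalIntegrable (fun t => ((n : ℝ) + 1) * (t ^ n * weight d t) -
      (n + d) * (t ^ (n + 2) * weight d t)) volume (-1) 1 := by
    rw [intervalIntegrable_iff_integrableOn_Ioo_of_le (by norm_num)]
    exact hi0.sub hi2
  have h := intervalIntegral.integral_eq_sub_of_hasDerivAt_of_le (by norm_num) hcont hderiv hint
  rw [intervalIntegral.integral_of_le (by norm_num), ← integral_Ioc_eq_integral_Ioo.symm,
    integral_sub hi0 hi2, integral_const_mul, integral_const_mul] at h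
  have hw : ∀ s : ℝ, s ^ 2 = 1 → weight (d + 2) s = 0 := by
    intro s hs
    rw [weight, hs, sub_self, Real.zero_rpow]
    rw [hexp]
    linarith
  rw [hw 1 (by norm_num), hw (-1) (by norm_num)] at h
  linarith

/-- Raising `d` by two multiplies the weight by `1 - t²`, so the recurrence for the second moment
climbs in steps of two, from the arcsine for `d = 2` and the constant weight for `d = 3`. -/
theorem integral_weight {d : ℕ} (hd : 2 ≤ d) :
    ∫ t in Set.Ioo (-1 : ℝ) 1, weight d t =
      √Real.pi * Real.Gamma (((d : ℝ) - 1) / 2) / Real.Gamma ((d : ℝ) / 2) := by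
  obtain ⟨m, rfl⟩ : ∃ m, d = m + 2 := ⟨d - 2, by omega⟩
  induction m using Nat.twoStepInduction with
  | zero =>
    have h := intervalIntegral.integral_eq_sub_of_hasDerivAt_of_le (a := -1) (b := 1)
      (f := Real.arcsin) (f' := weight 2) (by norm_num) Real.continuous_arcsin.continuousOn
      (fun t ht => by
        rw [weight_two t ht]
        exact Real.hasDerivAt_arcsin ht.1.ne' ht.2.ne)
      (by
        rw [intervalIntegrable_iff_integrableOn_Ioo_of_le (by norm_num)]
        exact integrableOn_weight_two)
    rw [intervalIntegral.integral_of_le (by norm_num), integral_Ioc_eq_integral_Ioo] at h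
    rw [zero_add, h, Real.arcsin_one, Real.arcsin_neg_one]
    norm_num
    rw [Real.Gamma_one_half_eq, Real.mul_self_sqrt Real.pi_pos.le]
  | one =>
    have h1 : ∀ t, weight (1 + 2) t = 1 := by
      intro t
      rw [weight]
      norm_num
    simp only [h1]
    have h2 : Real.Gamma ((3 : ℝ) / 2) = 1 / 2 * √Real.pi := by
      rw [show (3 : ℝ) / 2 = 1 / 2 + 1 by norm_num, Real.Gamma_add_one (by norm_num),
        Real.Gamma_one_half_eq]
    have hpi : √Real.pi ≠ 0 := (Real.sqrt_pos.mpr Real.pi_pos).ne'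
    norm_num [h2]
    field_simp
  | more m ih _ =>
    have hd2 : 2 ≤ m + 2 := by omega
    have hr := integral_pow_add_two_mul_weight hd2 0
    simp only [pow_zero, one_mul, zero_add] at hr
    have hs : ∫ t in Set.Ioo (-1 : ℝ) 1, weight (m + 2 + 2) t =
        (∫ t in Set.Ioo (-1 : ℝ) 1, weight (m + 2) t) -
          ∫ t in Set.Ioo (-1 : ℝ) 1, t ^ 2 * weight (m + 2) t := by
      rw [← integral_sub (integrableOn_weight hd2) (integrableOn_pow_mul_weight hd2 2)]
      refine setIntegral_congr_fun measurableSet_Ioo fun t ht => ?_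
      rw [weight_add_two _ ht]
      ring
    rw [hs]
    have ih' := ih hd2
    have g1 : Real.Gamma ((((m + 2 + 2 : ℕ) : ℝ) - 1) / 2) =
        (((m + 2 : ℕ) : ℝ) - 1) / 2 * Real.Gamma ((((m + 2 : ℕ) : ℝ) - 1) / 2) := by
      rw [← Real.Gamma_add_one (by
        have : (0 : ℝ) ≤ m := m.cast_nonneg
        push_cast
        linarith)]
      congr 1
      push_cast
      ring
    have g2 : Real.Gamma (((m + 2 + 2 : ℕ) : ℝ) / 2) =
        ((m + 2 : ℕ) : ℝ) / 2 * Real.Gamma (((m + 2 : ℕ) : ℝ) / 2) := by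
      rw [← Real.Gamma_add_one (by positivity)]
      congr 1
      push_cast
      ring
    rw [g1, g2, mul_left_comm, mul_div_mul_comm, ← ih']
    have hm : ((m + 2 : ℕ) : ℝ) ≠ 0 := by positivity
    simp only [Nat.cast_zero, zero_add, one_mul] at hr
    rw [← hr]
    field_simp

theorem integral_mul_weight (d : ℕ) :
    ∫ t in Set.Ioo (-1 : ℝ) 1, t * weight d t = 0 := by
  have h : ∫ t in (-1 : ℝ)..1, t * weight d t = 0 := by
    have h1 := intervalIntegral.integral_comp_neg (a := -1) (b := 1) fun t => t * weight d t
    have h2 : ∀ t, weight d (-t) = weight d t := fun t => by rw [weight, weight, neg_sq]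
    simp only [h2, neg_mul, intervalIntegral.integral_neg, neg_neg] at h1
    linarith
  rwa [intervalIntegral.integral_of_le (by norm_num), integral_Ioc_eq_integral_Ioo] at h

end Weight

/-! ### Measures determined by their moments -/

section Moments

variable {m : Measure ℝ} [IsFiniteMeasure m]

theorem integrable_of_ae_mem_Icc (h : ∀ᵐ t ∂m, t ∈ Set.Icc (-1 : ℝ) 1) {f : ℝ → ℝ}
    (hf : Continuous f) : Integrable f m := by
  obtain ⟨C, hC⟩ := isCompact_Icc.exists_bound_of_continuousOn (hf.continuousOn (s := Set.Icc (-1) 1))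
  refine Integrable.of_bound hf.aestronglyMeasurable C ?_
  filter_upwards [h] with t ht using hC t ht

theorem abs_integral_sub_le (h : ∀ᵐ t ∂m, t ∈ Set.Icc (-1 : ℝ) 1) {f g : ℝ → ℝ}
    (hf : Continuous f) (hg : Continuous g) {ε : ℝ}
    (hfg : ∀ t ∈ Set.Icc (-1 : ℝ) 1, |g t - f t| < ε) :
    |∫ t, f t ∂m - ∫ t, g t ∂m| ≤ ε * m.real Set.univ := by
  rw [← integral_sub (integrable_of_ae_mem_Icc h hf) (integrable_of_ae_mem_Icc h hg)]
  refine norm_integral_le_of_norm_le_const (μ := m) (f := fun t => f t - g t) ?_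
  filter_upwards [h] with t ht
  rw [Real.norm_eq_abs, abs_sub_comm]
  exact (hfg t ht).le

/-- Finite measures on `[-1, 1]` with the same moments are equal. -/
theorem measure_eq_of_moments {m' : Measure ℝ} [IsFiniteMeasure m']
    (h : ∀ᵐ t ∂m, t ∈ Set.Icc (-1 : ℝ) 1) (h' : ∀ᵐ t ∂m', t ∈ Set.Icc (-1 : ℝ) 1)
    (hm : ∀ n : ℕ, ∫ t, t ^ n ∂m = ∫ t, t ^ n ∂m') : m = m' := by
  have hpoly : ∀ p : Polynomial ℝ, ∫ t, p.eval t ∂m = ∫ t, p.eval t ∂m' := by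
    intro p
    induction p using Polynomial.induction_on' with
    | add p q hp hq =>
      simp only [Polynomial.eval_add]
      rw [integral_add (integrable_of_ae_mem_Icc h p.continuous)
        (integrable_of_ae_mem_Icc h q.continuous), integral_add
        (integrable_of_ae_mem_Icc h' p.continuous) (integrable_of_ae_mem_Icc h' q.continuous),
        hp, hq]
    | monomial n a =>
      simp only [Polynomial.eval_monomial, integral_const_mul, hm]
  refine ext_of_forall_integral_eq_of_IsFiniteMeasure fun f => ?_
  rw [← sub_eq_zero, ← abs_nonpos_iff]
  refine le_of_forall_pos_le_add fun ε hε => ?_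
  set M := m.real Set.univ + m'.real Set.univ + 1 with hM
  have hMpos : 0 < M := by positivity
  obtain ⟨p, hp⟩ := exists_polynomial_near_of_continuousOn (-1) 1 f f.continuous.continuousOn
    (ε / M) (by positivity)
  have e1 := abs_integral_sub_le h f.continuous p.continuous hp
  have e2 := abs_integral_sub_le h' f.continuous p.continuous hp
  rw [hpoly, abs_le] at e1
  rw [abs_le] at e2
  have e3 : ε / M * m.real Set.univ + ε / M * m'.real Set.univ ≤ ε := by
    rw [← mul_add, div_mul_eq_mul_div, div_le_iff₀ hMpos]
    exact mul_le_mul_of_nonneg_left (by linarith) hε.le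
  rw [zero_add, abs_le]
  constructor <;> linarith [e1.1, e1.2, e2.1, e2.2]

end Moments

/-! ### The Funk--Hecke formula -/

section FunkHecke

variable {d : ℕ}

theorem inner_mem_Icc (ω η : Sphere d) :
    inner ℝ (ω : Space d) (η : Space d) ∈ Set.Icc (-1 : ℝ) 1 := by
  have h := abs_real_inner_le_norm (ω : Space d) (η : Space d)
  rw [norm_eq_of_mem_sphere, norm_eq_of_mem_sphere, one_mul] at h
  exact abs_le.mp h

theorem continuous_inner_sphere (ω : Sphere d) :
    Continuous fun η : Sphere d => inner ℝ (ω : Space d) (η : Space d) := by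
  fun_prop

/-- The distribution of `ω · η` under the surface measure. -/
noncomputable def projMeasure (ω : Sphere d) : Measure ℝ :=
  (surfaceMeasure d).map fun η : Sphere d => inner ℝ (ω : Space d) (η : Space d)

instance (ω : Sphere d) : IsFiniteMeasure (projMeasure ω) := by
  unfold projMeasure
  infer_instance

/-- The constant `2 π^{(d-1)/2} / Γ((d-1)/2)`, the area of the sphere `S^{d-2}`. -/
noncomputable def sphereConst (d : ℕ) : ℝ :=
  2 * (Real.pi ^ (((d : ℝ) - 1) / 2) / Real.Gamma (((d : ℝ) - 1) / 2))

theorem sphereConst_pos (hd : 2 ≤ d) : 0 < sphereConst d := by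
  have : (2 : ℝ) ≤ d := by exact_mod_cast hd
  have h := Real.Gamma_pos_of_pos (s := ((d : ℝ) - 1) / 2) (by linarith)
  have := Real.pi_pos
  unfold sphereConst
  positivity

/-- The measure `|S^{d-2}| (1 - t²)^{(d-3)/2} dt` on `(-1, 1)`. -/
noncomputable def weightMeasure (d : ℕ) : Measure ℝ :=
  (volume.restrict (Set.Ioo (-1 : ℝ) 1)).withDensity
    fun t => ENNReal.ofReal (sphereConst d * weight d t)

theorem measurable_weight (d : ℕ) : Measurable (weight d) := by
  unfold weight
  fun_prop

theorem toReal_density_smul (hd : 2 ≤ d) (f : ℝ → ℝ) {t : ℝ} (ht : t ∈ Set.Ioo (-1 : ℝ) 1) :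
    (ENNReal.ofReal (sphereConst d * weight d t)).toReal • f t =
      sphereConst d * (f t * weight d t) := by
  rw [ENNReal.toReal_ofReal (mul_pos (sphereConst_pos hd) (weight_pos d ht)).le, smul_eq_mul]
  ring

theorem integral_weightMeasure (hd : 2 ≤ d) (f : ℝ → ℝ) :
    ∫ t, f t ∂weightMeasure d = sphereConst d * ∫ t in Set.Ioo (-1 : ℝ) 1, f t * weight d t := by
  rw [weightMeasure, integral_withDensity_eq_integral_toReal_smul
    ((measurable_weight d).const_mul _).ennreal_ofReal (.of_forall fun t => ENNReal.ofReal_lt_top),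
    ← integral_const_mul]
  exact setIntegral_congr_fun measurableSet_Ioo fun t ht => toReal_density_smul hd f ht

theorem integrable_weightMeasure (hd : 2 ≤ d) {f : ℝ → ℝ}
    (hf : IntegrableOn (fun t => f t * weight d t) (Set.Ioo (-1 : ℝ) 1)) :
    Integrable f (weightMeasure d) := by
  rw [weightMeasure, integrable_withDensity_iff_integrable_smul'
    ((measurable_weight d).const_mul _).ennreal_ofReal (.of_forall fun t => ENNReal.ofReal_lt_top)]
  refine (hf.const_mul (sphereConst d)).congr ?_
  filter_upwards [ae_restrict_mem measurableSet_Ioo] with t ht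
  exact (toReal_density_smul hd f ht).symm

theorem isFiniteMeasure_weightMeasure (hd : 2 ≤ d) : IsFiniteMeasure (weightMeasure d) := by
  have h := integrable_weightMeasure hd (f := fun _ => (1 : ℝ))
    (by simpa using integrableOn_weight hd)
  rw [integrable_const_iff] at h
  exact h.resolve_left one_ne_zero

theorem integral_projMeasure (ω : Sphere d) {f : ℝ → ℝ}
    (hf : AEStronglyMeasurable f (projMeasure ω)) :
    ∫ t, f t ∂projMeasure ω = ∫ η, f (inner ℝ (ω : Space d) (η : Space d)) ∂surfaceMeasure d :=
  integral_map (continuous_inner_sphere ω).measurable.aemeasurable hf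

theorem ofReal_moment_projMeasure (ω : Sphere d) (n : ℕ) :
    ((∫ t, t ^ n ∂projMeasure ω : ℝ) : ℂ) = sphInt (linearForm (ω : Space d) ^ n) := by
  rw [integral_projMeasure ω (by fun_prop), ← integral_complex_ofReal, sphInt_apply]
  simp only [map_pow, evalAt_linearForm, Complex.ofReal_pow]

/-- Integration by parts along `ω`, where `ω · x` has derivative one. The weight obeys the same
recurrence. -/
theorem moment_projMeasure_add_two (hd : 2 ≤ d) (ω : Sphere d) (n : ℕ) :
    ((n : ℝ) + d) * ∫ t, t ^ (n + 2) ∂projMeasure ω =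
      ((n : ℝ) + 1) * ∫ t, t ^ n ∂projMeasure ω := by
  have : NeZero d := ⟨by omega⟩
  apply Complex.ofReal_injective
  push_cast [ofReal_moment_projMeasure]
  have h := sphInt_linearForm_mul (ω : Space d) ((isHomogeneous_linearForm (ω : Space d)).pow (n + 1))
  rw [← pow_succ', ← mul_one (linearForm (ω : Space d) ^ (n + 1)), dirDeriv_linearForm_pow_mul,
    Derivation.map_one_eq_zero, mul_zero, zero_add, map_smul, mul_one, Nat.add_sub_cancel,
    smul_eq_mul] at h
  push_cast at h
  linear_combination h

theorem moment_one_projMeasure (hd : 2 ≤ d) (ω : Sphere d) : ∫ t, t ∂projMeasure ω = 0 := by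
  have : NeZero d := ⟨by omega⟩
  have h1 := ofReal_moment_projMeasure ω 1
  have h := sphInt_linearForm_mul (ω : Space d) (MvPolynomial.isHomogeneous_one (Fin d) ℂ)
  rw [Derivation.map_one_eq_zero, map_zero] at h
  have h2 := (mul_eq_zero.mp h).resolve_left (natCast_add_sub_one_ne_zero hd 0)
  rw [mul_one] at h2
  simp only [pow_one, h2] at h1
  exact_mod_cast h1

/-- The volume of the unit ball gives the area of the sphere. This matches the zeroth moments and so
fixes the constant in the density. -/
theorem surfaceMeasure_real_univ (hd : 2 ≤ d) :
    (surfaceMeasure d).real Set.univ =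
      sphereConst d * ∫ t in Set.Ioo (-1 : ℝ) 1, weight d t := by
  have : NeZero d := ⟨by omega⟩
  have hd0 : (0 : ℝ) < d := by exact_mod_cast NeZero.pos d
  have hd2 : (2 : ℝ) ≤ d := by exact_mod_cast hd
  have hG1 : Real.Gamma (((d : ℝ) - 1) / 2) ≠ 0 := (Real.Gamma_pos_of_pos (by linarith)).ne'
  have hG2 : Real.Gamma ((d : ℝ) / 2) ≠ 0 := (Real.Gamma_pos_of_pos (by linarith)).ne'
  rw [Measure.toSphere_real_apply_univ, integral_weight hd, sphereConst, measureReal_def,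
    EuclideanSpace.volume_ball, finrank_euclideanSpace_fin, Fintype.card_fin,
    Real.Gamma_add_one (by positivity), ENNReal.ofReal_one, one_pow, one_mul,
    ENNReal.toReal_ofReal (by have := Real.Gamma_pos_of_pos (s := (d : ℝ) / 2) (by linarith); positivity)]
  have hpi : √Real.pi ^ d = Real.pi ^ (((d : ℝ) - 1) / 2) * √Real.pi := by
    rw [Real.sqrt_eq_rpow, ← Real.rpow_natCast, ← Real.rpow_mul Real.pi_pos.le,
      ← Real.rpow_add Real.pi_pos]
    congr 1
    ring
  rw [hpi]
  field_simp

/-- The distribution of `ω · η` has the density `|S^{d-2}| (1 - t²)^{(d-3)/2}`. -/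
theorem projMeasure_eq (hd : 2 ≤ d) (ω : Sphere d) : projMeasure ω = weightMeasure d := by
  have := isFiniteMeasure_weightMeasure hd
  have hd2 : (2 : ℝ) ≤ d := by exact_mod_cast hd
  refine measure_eq_of_moments ?_ ?_ fun n => ?_
  · exact (ae_map_iff (p := fun t => t ∈ Set.Icc (-1 : ℝ) 1)
      (continuous_inner_sphere ω).measurable.aemeasurable measurableSet_Icc).mpr
      (.of_forall fun η => inner_mem_Icc ω η)
  · refine (withDensity_absolutelyContinuous _ _).ae_le ?_
    filter_upwards [ae_restrict_mem measurableSet_Ioo] with t ht using Set.Ioo_subset_Icc_self ht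
  -- Both moment sequences satisfy the same two-step recurrence, so total mass and first moment
  -- decide.
  · induction n using Nat.twoStepInduction with
    | zero =>
      rw [integral_weightMeasure hd, integral_projMeasure ω (by fun_prop)]
      simp [surfaceMeasure_real_univ hd]
    | one =>
      rw [integral_weightMeasure hd]
      simp only [pow_one, moment_one_projMeasure hd, integral_mul_weight, mul_zero]
    | more n h0 _ =>
      rw [integral_weightMeasure hd] at h0 ⊢
      have h1 := moment_projMeasure_add_two hd ω n
      have h2 := integral_pow_add_two_mul_weight hd n
      have hn : (n : ℝ) + d ≠ 0 := by positivity
      apply mul_left_cancel₀ hn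
      rw [h1, h0, mul_left_comm, mul_left_comm ((n : ℝ) + d), h2]

/-- A continuous function orthogonal to the powers of `ω · η` is orthogonal to all integrable
functions of `ω · η`. -/
theorem integral_comp_inner_mul_eq_zero (ω : Sphere d) {u : Sphere d → ℂ} (hu : Continuous u)
    (h : ∀ n : ℕ, ∫ η, ((inner ℝ (ω : Space d) (η : Space d) ^ n : ℝ) : ℂ) * u η
      ∂surfaceMeasure d = 0)
    {f : ℝ → ℝ} (hf : Integrable f (projMeasure ω)) :
    ∫ η, (f (inner ℝ (ω : Space d) (η : Space d)) : ℂ) * u η ∂surfaceMeasure d = 0 := by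
  obtain ⟨B, hB⟩ := isCompact_univ.exists_bound_of_continuousOn hu.continuousOn
  have hB0 : ∀ η, ‖u η‖ ≤ |B| := fun η => (hB η trivial).trans (le_abs_self B)
  have hcont : ∀ g : ℝ → ℝ, Continuous g →
      Integrable (fun η : Sphere d => (g (inner ℝ (ω : Space d) (η : Space d)) : ℂ) * u η)
        (surfaceMeasure d) := fun g hg =>
    integrable_of_continuous ((Complex.continuous_ofReal.comp
      (hg.comp (continuous_inner_sphere ω))).mul hu)
  have hpoly : ∀ p : Polynomial ℝ,
      ∫ η, ((p.eval (inner ℝ (ω : Space d) (η : Space d)) : ℝ) : ℂ) * u η ∂surfaceMeasure d = 0 := by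
    intro p
    induction p using Polynomial.induction_on' with
    | add p q hp hq =>
      simp only [Polynomial.eval_add, Complex.ofReal_add, add_mul]
      rw [integral_add (hcont _ p.continuous) (hcont _ q.continuous), hp, hq, add_zero]
    | monomial n a =>
      simp only [Polynomial.eval_monomial, Complex.ofReal_mul, mul_assoc, integral_const_mul, h,
        mul_zero]
  have hsmall : ∀ {z : ℂ} {C : ℝ}, 0 ≤ C → (∀ ε > 0, ‖z‖ ≤ ε * C) → z = 0 := by
    intro z C hC hz
    rw [← norm_le_zero_iff]
    refine le_of_forall_pos_le_add fun ε hε => ?_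
    have h1 := hz (ε / (C + 1)) (by positivity)
    have h2 : ε / (C + 1) * C ≤ ε := by
      rw [div_mul_eq_mul_div, div_le_iff₀ (by positivity)]
      exact mul_le_mul_of_nonneg_left (by linarith) hε.le
    linarith
  -- Weierstrass approximation on `[-1, 1]`, with `u` bounded on the compact sphere.
  have hg0 : ∀ g : ℝ → ℝ, Continuous g →
      ∫ η, (g (inner ℝ (ω : Space d) (η : Space d)) : ℂ) * u η ∂surfaceMeasure d = 0 := by
    intro g hg
    refine hsmall (C := |B| * (surfaceMeasure d).real Set.univ) (by positivity) fun ε hε => ?_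
    obtain ⟨p, hp⟩ := exists_polynomial_near_of_continuousOn (-1) 1 g hg.continuousOn ε hε
    rw [← sub_zero (∫ η, _ ∂_), ← hpoly p, ← integral_sub (hcont g hg) (hcont _ p.continuous),
      ← mul_assoc]
    refine norm_integral_le_of_norm_le_const (.of_forall fun η => ?_)
    rw [← sub_mul, ← Complex.ofReal_sub, norm_mul, Complex.norm_real, Real.norm_eq_abs,
      abs_sub_comm]
    exact mul_le_mul (hp _ (inner_mem_Icc ω η)).le (hB0 η) (norm_nonneg _) hε.le
  refine hsmall (C := |B|) (abs_nonneg B) fun ε hε => ?_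
  -- Density of continuous functions in `L¹` of the law of `ω · η` extends the claim to merely
  -- integrable `f`.
  obtain ⟨g, -, hfg, hg, hgi⟩ := hf.exists_hasCompactSupport_integral_sub_le hε
  have hmap : AEMeasurable (fun η : Sphere d => inner ℝ (ω : Space d) (η : Space d))
      (surfaceMeasure d) := (continuous_inner_sphere ω).measurable.aemeasurable
  have hdiff : Integrable (fun η : Sphere d =>
      f (inner ℝ (ω : Space d) (η : Space d)) - g (inner ℝ (ω : Space d) (η : Space d)))
      (surfaceMeasure d) := (hf.sub hgi).comp_aemeasurable hmap
  have hfi : Integrable (fun η : Sphere d => f (inner ℝ (ω : Space d) (η : Space d)))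
      (surfaceMeasure d) := hf.comp_aemeasurable hmap
  have hfu : Integrable (fun η : Sphere d => (f (inner ℝ (ω : Space d) (η : Space d)) : ℂ) * u η)
      (surfaceMeasure d) :=
    hfi.ofReal.mul_bdd (c := |B|) hu.aestronglyMeasurable (.of_forall hB0)
  rw [← sub_zero (∫ η, _ ∂_), ← hg0 g hg, ← integral_sub hfu (hcont g hg)]
  calc ‖∫ η, ((f (inner ℝ (ω : Space d) (η : Space d)) : ℂ) * u η -
        (g (inner ℝ (ω : Space d) (η : Space d)) : ℂ) * u η) ∂surfaceMeasure d‖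
      ≤ ∫ η, ‖f (inner ℝ (ω : Space d) (η : Space d)) -
          g (inner ℝ (ω : Space d) (η : Space d))‖ * |B| ∂surfaceMeasure d := by
        refine norm_integral_le_of_norm_le (hdiff.norm.mul_const _) (.of_forall fun η => ?_)
        rw [← sub_mul, ← Complex.ofReal_sub, norm_mul, Complex.norm_real]
        exact mul_le_mul_of_nonneg_left (hB0 η) (norm_nonneg _)
    _ = (∫ t, ‖f t - g t‖ ∂projMeasure ω) * |B| := by
        rw [integral_mul_const, integral_projMeasure ω (f := fun t => ‖f t - g t‖)
          (hf.sub hgi).norm.aestronglyMeasurable]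
    _ ≤ ε * |B| := mul_le_mul_of_nonneg_right hfg (abs_nonneg B)

theorem continuous_legendre (d k : ℕ) : Continuous (legendre d k) := by
  induction k using Nat.twoStepInduction with
  | zero => exact continuous_const
  | one => exact continuous_id
  | more k h0 h1 =>
    have h : legendre d (k + 2) = fun t =>
        ((2 * k + d) * t * legendre d (k + 1) t - (k + 1) * legendre d k t) / (k + d - 1) := rfl
    rw [h]
    fun_prop

/-- The Funk--Hecke formula. -/
theorem funk_hecke (hd : 2 ≤ d) (ω : Sphere d) {f : ℝ → ℝ}
    (hf : IntegrableOn (fun t => f t * weight d t) (Set.Ioo (-1 : ℝ) 1)) {k : ℕ}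
    {p : MvPolynomial (Fin d) ℂ} (hp : p ∈ harmonicPolynomial d k) :
    Integrable (fun η : Sphere d =>
      (f (inner ℝ (ω : Space d) (η : Space d)) : ℂ) * evalAt (η : Space d) p) (surfaceMeasure d) ∧
    ∫ η, (f (inner ℝ (ω : Space d) (η : Space d)) : ℂ) * evalAt (η : Space d) p ∂surfaceMeasure d =
      evalAt (ω : Space d) p * ((sphereConst d *
        ∫ t in Set.Ioo (-1 : ℝ) 1, f t * legendre d k t * weight d t : ℝ) : ℂ) := by
  have hfρ : Integrable f (projMeasure ω) := by
    rw [projMeasure_eq hd]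
    exact integrable_weightMeasure hd hf
  have hfi : Integrable (fun η : Sphere d => f (inner ℝ (ω : Space d) (η : Space d)))
      (surfaceMeasure d) :=
    hfρ.comp_aemeasurable (continuous_inner_sphere ω).measurable.aemeasurable
  have hint : ∀ q : MvPolynomial (Fin d) ℂ, Integrable (fun η : Sphere d =>
      (f (inner ℝ (ω : Space d) (η : Space d)) : ℂ) * evalAt (η : Space d) q)
      (surfaceMeasure d) := by
    intro q
    obtain ⟨B, hB⟩ := isCompact_univ.exists_bound_of_continuousOn
      (continuous_evalAt_sphere q).continuousOn
    exact hfi.ofReal.mul_bdd (c := B) (continuous_evalAt_sphere q).aestronglyMeasurable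
      (.of_forall fun η => hB η trivial)
  refine ⟨hint p, ?_⟩
  -- The part of `p` vanishing at `ω` is invisible to functions of `ω · η`; only `p(ω)` times the
  -- zonal harmonic contributes.
  have h := integral_comp_inner_mul_eq_zero ω
    (continuous_evalAt_sphere (p - evalAt (ω : Space d) p • zonal (ω : Space d) k))
    (fun n => by
      have h1 := sphInt_linearForm_pow_mul hd ω n hp
      rw [sphInt_apply] at h1
      simpa only [map_mul, map_pow, evalAt_linearForm, Complex.ofReal_pow] using h1) hfρ
  have h2 : ∫ η, (f (inner ℝ (ω : Space d) (η : Space d)) : ℂ) *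
      evalAt (η : Space d) (zonal (ω : Space d) k) ∂surfaceMeasure d =
        ((sphereConst d *
          ∫ t in Set.Ioo (-1 : ℝ) 1, f t * legendre d k t * weight d t : ℝ) : ℂ) := by
    rw [← integral_weightMeasure hd, ← projMeasure_eq hd ω, integral_projMeasure ω
      (f := fun t => f t * legendre d k t) (hfρ.aestronglyMeasurable.mul (continuous_legendre d k).aestronglyMeasurable),
      ← integral_complex_ofReal]
    simp only [evalAt_zonal, Complex.ofReal_mul]
  rw [← h2, ← integral_const_mul, ← sub_eq_zero,
    ← integral_sub (hint p) ((hint _).const_mul _), ← h]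
  refine integral_congr_ae (.of_forall fun η => ?_)
  simp only [map_sub, MvPolynomial.smul_eval]
  ring

end FunkHecke

/-! ### Products of radial and spherical functions in `L²(ℝ^d)` -/

section Radial

variable {d : ℕ}

/-- The space `L²(ℝ_{>0}, ℂ)`. -/
abbrev RadialScalarL2 : Type := Lp ℂ 2 (volume.restrict (Set.Ioi (0 : ℝ)))

/-- The function `ξ ↦ |ξ|^{-(d-1)/2} u(|ξ|) φ(ξ/|ξ|)`. -/
noncomputable def radialScalar (φ : SpinorField d) (u : ℝ → ℂ) (ξ : Space d) : Spinor d :=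
  open Classical in
  if hξ : ξ = 0 then 0 else (‖ξ‖ ^ (-((d : ℝ) - 1) / 2)) • u ‖ξ‖ • φ (direction ξ hξ)

theorem radialScalar_smul (φ : SpinorField d) (u : ℝ → ℂ) (ω : Sphere d) {r : ℝ} (hr : 0 < r) :
    radialScalar φ u (r • (ω : Space d)) = (r ^ (-((d : ℝ) - 1) / 2)) • u r • φ ω := by
  rw [radialScalar, dif_neg (sphere_smul_ne_zero hr ω), direction_smul hr, norm_sphere_smul hr]

theorem radialScalar_congr (φ : SpinorField d) {u v : ℝ → ℂ} {ξ : Space d} (h : u ‖ξ‖ = v ‖ξ‖) :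
    radialScalar φ u ξ = radialScalar φ v ξ := by
  simp only [radialScalar, h]

theorem inner_radialScalar_smul (φ ψ : SpinorField d) (u v : ℝ → ℂ) (ω : Sphere d) (r : ℝ)
    (hr : 0 < r) :
    inner ℂ (radialScalar φ u (r • (ω : Space d))) (radialScalar ψ v (r • (ω : Space d))) =
      inner ℂ (φ ω) (ψ ω) * (((r ^ (-((d : ℝ) - 1)) : ℝ) : ℂ) * inner ℂ (u r) (v r)) := by
  rw [radialScalar_smul _ _ _ hr, radialScalar_smul _ _ _ hr, ← Complex.coe_smul,
    ← Complex.coe_smul (r ^ (-((d : ℝ) - 1) / 2)) (v r • ψ ω)]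
  simp only [inner_smul_left, inner_smul_right, RCLike.inner_apply, Complex.conj_ofReal]
  have h : r ^ (-((d : ℝ) - 1)) = r ^ (-((d : ℝ) - 1) / 2) * r ^ (-((d : ℝ) - 1) / 2) := by
    rw [← Real.rpow_add hr]
    congr 1
    ring
  rw [h]
  push_cast
  ring

/-- The matrix function with given columns. -/
noncomputable def ofColumns (φ : Fin 2 → SpinorField d) (ω : Sphere d) : Matrix (Fin (spinorDim d)) (Fin 2) ℂ :=
  Matrix.of fun a c => φ c ω a

theorem radialTerm_ofColumns (φ : Fin 2 → SpinorField d) (g : ℝ → EuclideanSpace ℂ (Fin 2))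
    (ξ : Space d) :
    radialTerm (ofColumns φ) g ξ = ∑ c, radialScalar (φ c) (fun r => g r c) ξ := by
  by_cases h : ξ = 0
  · simp [radialTerm, radialScalar, h]
  · simp only [radialTerm, radialScalar, h, dite_false, ← Finset.smul_sum]
    congr 1
    ext a
    simp [ofColumns, Matrix.mulVec, dotProduct, mul_comm]

variable [NeZero d]

/-- The Jacobian `r^{d-1}` cancels the square of the prefactor `|ξ|^{-(d-1)/2}`, which is why the
expansion has this exponent. -/
theorem pow_smul_rpow_mul {r : ℝ} (hr : 0 < r) (z : ℂ) :
    r ^ (d - 1) • (((r ^ (-((d : ℝ) - 1)) : ℝ) : ℂ) * z) = z := by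
  have h1 : 1 ≤ d := NeZero.one_le
  have h : r ^ (d - 1) * r ^ (-((d : ℝ) - 1)) = 1 := by
    rw [← Real.rpow_natCast, ← Real.rpow_add hr, Nat.cast_sub h1]
    simp
  rw [← Complex.coe_smul, smul_eq_mul, ← mul_assoc, ← Complex.ofReal_mul, h, Complex.ofReal_one,
    one_mul]

theorem aestronglyMeasurable_polar_iff {F : Type*} [NormedAddCommGroup F] {f : Space d → F} :
    AEStronglyMeasurable (fun z : Sphere d × Set.Ioi (0 : ℝ) => f ((z.2 : ℝ) • (z.1 : Space d)))
      ((surfaceMeasure d).prod (Measure.volumeIoiPow (d - 1))) ↔ AEStronglyMeasurable f := by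
  rw [← measurePreserving_polar.map_eq, measurableEmbedding_polar.aestronglyMeasurable_map_iff]
  rfl

theorem aestronglyMeasurable_radialScalar (φ : SpinorField d) {u : ℝ → ℂ}
    (hu : StronglyMeasurable u) : AEStronglyMeasurable (radialScalar φ u) := by
  rw [← aestronglyMeasurable_polar_iff]
  have h : StronglyMeasurable fun z : Sphere d × Set.Ioi (0 : ℝ) =>
      ((z.2 : ℝ) ^ (-((d : ℝ) - 1) / 2)) • u z.2 • φ z.1 := by
    have h1 : StronglyMeasurable fun z : Sphere d × Set.Ioi (0 : ℝ) =>
        (z.2 : ℝ) ^ (-((d : ℝ) - 1) / 2) := Measurable.stronglyMeasurable (by fun_prop)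
    have h2 : StronglyMeasurable fun z : Sphere d × Set.Ioi (0 : ℝ) => u z.2 :=
      hu.comp_measurable (measurable_subtype_coe.comp measurable_snd)
    have h3 : StronglyMeasurable fun z : Sphere d × Set.Ioi (0 : ℝ) => φ z.1 :=
      φ.continuous.stronglyMeasurable.comp_measurable measurable_fst
    exact h1.smul (h2.smul h3)
  refine h.aestronglyMeasurable.congr (.of_forall fun z => ?_)
  exact (radialScalar_smul φ u z.1 z.2.2).symm

theorem integrable_inner_radialScalar (φ ψ : SpinorField d) {u v : ℝ → ℂ}
    (hu : MemLp u 2 (volume.restrict (Set.Ioi (0 : ℝ))))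
    (hv : MemLp v 2 (volume.restrict (Set.Ioi (0 : ℝ)))) :
    Integrable fun x => inner ℂ (radialScalar φ u x) (radialScalar ψ v x) := by
  refine integrable_polar (inner_radialScalar_smul φ ψ u v) (integrable_sphereInner φ ψ) ?_
  have h : Integrable (fun r => inner ℂ (u r) (v r)) (volume.restrict (Set.Ioi (0 : ℝ))) := by
    have := L2.integrable_inner (𝕜 := ℂ) hu.toLp hv.toLp
    refine this.congr ?_
    filter_upwards [hu.coeFn_toLp, hv.coeFn_toLp] with r h1 h2
    rw [h1, h2]
  refine h.congr ?_
  filter_upwards [ae_restrict_mem measurableSet_Ioi] with r hr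
  exact (pow_smul_rpow_mul hr _).symm

theorem integral_inner_radialScalar (φ ψ : SpinorField d) (u v : ℝ → ℂ) :
    ∫ x, inner ℂ (radialScalar φ u x) (radialScalar ψ v x) =
      sphereInner φ ψ * ∫ r in Set.Ioi (0 : ℝ), inner ℂ (u r) (v r) := by
  rw [integral_polar (inner_radialScalar_smul φ ψ u v), sphereInner]
  congr 1
  exact setIntegral_congr_fun measurableSet_Ioi fun r hr => pow_smul_rpow_mul hr _

theorem memLp_radialScalar (φ : SpinorField d) (u : RadialScalarL2) :
    MemLp (radialScalar φ u) 2 := by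
  have hm := aestronglyMeasurable_radialScalar φ (Lp.stronglyMeasurable u)
  rw [memLp_two_iff_integrable_sq_norm hm]
  have h := (integrable_inner_radialScalar φ φ (Lp.memLp u) (Lp.memLp u)).re
  refine h.congr (.of_forall fun x => ?_)
  exact inner_self_eq_norm_sq (𝕜 := ℂ) _

/-- The element `|ξ|^{-(d-1)/2} u(|ξ|) φ(ξ/|ξ|)` of `L²(ℝ^d, ℂ^N)`. -/
noncomputable def radialProd : SpinorField d →ₗ[ℂ] RadialScalarL2 →ₗ[ℂ] SpinorL2 d :=
  LinearMap.mk₂ ℂ (fun φ u => (memLp_radialScalar φ u).toLp)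
    (fun φ ψ u => by
      rw [← MemLp.toLp_add, MemLp.toLp_eq_toLp_iff]
      refine .of_forall fun ξ => ?_
      by_cases h : ξ = 0
      · simp [radialScalar, h]
      · simp [radialScalar, h])
    (fun c φ u => by
      rw [← MemLp.toLp_const_smul, MemLp.toLp_eq_toLp_iff]
      refine .of_forall fun ξ => ?_
      by_cases h : ξ = 0
      · simp [radialScalar, h]
      · simp only [radialScalar, h, dite_false, Pi.smul_apply, ContinuousMap.smul_apply]
        rw [smul_comm _ c, smul_comm _ c])
    (fun φ u v => by
      rw [← MemLp.toLp_add, MemLp.toLp_eq_toLp_iff]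
      filter_upwards [ae_of_ae_norm (d := d) (Lp.coeFn_add u v)] with ξ hξ
      rw [radialScalar_congr φ hξ, Pi.add_apply]
      by_cases h : ξ = 0
      · simp [radialScalar, h]
      · simp [radialScalar, h, add_smul])
    (fun c φ u => by
      rw [← MemLp.toLp_const_smul, MemLp.toLp_eq_toLp_iff]
      filter_upwards [ae_of_ae_norm (d := d) (Lp.coeFn_smul c u)] with ξ hξ
      rw [radialScalar_congr φ hξ, Pi.smul_apply]
      by_cases h : ξ = 0
      · simp [radialScalar, h]
      · simp only [radialScalar, h, dite_false, Pi.smul_apply, smul_assoc]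
        rw [smul_comm _ c])

theorem coeFn_radialProd (φ : SpinorField d) (u : RadialScalarL2) :
    radialProd φ u =ᵐ[volume] radialScalar φ u :=
  (memLp_radialScalar φ u).coeFn_toLp

/-- Polar coordinates separate the integral, so the construction acts as a tensor product:
orthonormality on the sphere passes to `L²(ℝ^d)`. -/
theorem inner_radialProd (φ ψ : SpinorField d) (u v : RadialScalarL2) :
    inner ℂ (radialProd φ u) (radialProd ψ v) = sphereInner φ ψ * inner ℂ u v := by
  rw [L2.inner_def, L2.inner_def, ← integral_inner_radialScalar]
  refine integral_congr_ae ?_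
  filter_upwards [coeFn_radialProd φ u, coeFn_radialProd ψ v] with x h1 h2
  rw [h1, h2]

/-- The coordinates on `L²(ℝ_{>0}, ℂ²)`. -/
noncomputable def radialCoord (c : Fin 2) : RadialL2 →ₗ[ℂ] RadialScalarL2 :=
  (ContinuousLinearMap.compLpL 2 (volume.restrict (Set.Ioi (0 : ℝ)))
    (EuclideanSpace.proj c : EuclideanSpace ℂ (Fin 2) →L[ℂ] ℂ)).toLinearMap

theorem coeFn_radialCoord (c : Fin 2) (g : RadialL2) :
    radialCoord c g =ᵐ[volume.restrict (Set.Ioi (0 : ℝ))] fun r => g r c :=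
  ContinuousLinearMap.coeFn_compLp _ g

theorem sum_inner_radialCoord (g h : RadialL2) :
    ∑ c, inner ℂ (radialCoord c g) (radialCoord c h) = inner ℂ g h := by
  simp only [L2.inner_def]
  rw [← integral_finsetSum _ fun c _ => L2.integrable_inner (radialCoord c g) (radialCoord c h)]
  refine integral_congr_ae ?_
  filter_upwards [ae_all_iff.mpr fun c => coeFn_radialCoord c g,
    ae_all_iff.mpr fun c => coeFn_radialCoord c h] with r h1 h2
  simp only [h1, h2, PiLp.inner_apply]

/-- The inclusions of `ℂ` into the coordinate axes of `L²(ℝ_{>0}, ℂ²)`. -/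
theorem exists_radialCoord_eq (c : Fin 2) (u : RadialScalarL2) :
    ∃ g : RadialL2, ∀ c', radialCoord c' g = if c' = c then u else 0 := by
  let S : ℂ →L[ℂ] EuclideanSpace ℂ (Fin 2) :=
    ContinuousLinearMap.smulRight (1 : ℂ →L[ℂ] ℂ) (EuclideanSpace.single c (1 : ℂ))
  refine ⟨S.compLp u, fun c' => ?_⟩
  apply Lp.ext
  filter_upwards [coeFn_radialCoord c' (S.compLp u), S.coeFn_compLp u,
    Lp.coeFn_zero ℂ 2 (volume.restrict (Set.Ioi (0 : ℝ)))] with r h1 h2 h3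
  rw [h1, h2]
  split_ifs with h
  · simp [S, h]
  · rw [h3]
    simp [S, h]

/-- The map `g ↦ |ξ|^{-(d-1)/2} E(ξ/|ξ|) g(|ξ|)`, `E` the matrix function with given columns. -/
noncomputable def radialMap (φ : Fin 2 → SpinorField d) : RadialL2 →ₗ[ℂ] SpinorL2 d :=
  ∑ c, radialProd (φ c) ∘ₗ radialCoord c

theorem radialMap_apply (φ : Fin 2 → SpinorField d) (g : RadialL2) :
    radialMap φ g = ∑ c, radialProd (φ c) (radialCoord c g) := by
  simp [radialMap]

theorem coeFn_radialMap (φ : Fin 2 → SpinorField d) (g : RadialL2) :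
    radialMap φ g =ᵐ[volume] radialTerm (ofColumns φ) g := by
  rw [radialMap_apply]
  have h := fun c => ae_of_ae_norm (d := d) (coeFn_radialCoord c g)
  filter_upwards [Lp.coeFn_finsetSum Finset.univ fun c => radialProd (φ c) (radialCoord c g),
    ae_all_iff.mpr h, ae_all_iff.mpr fun c => coeFn_radialProd (φ c) (radialCoord c g)]
    with ξ h1 h2 h3
  rw [h1, radialTerm_ofColumns, Finset.sum_apply]
  exact Finset.sum_congr rfl fun c _ => (h3 c).trans (radialScalar_congr _ (h2 c))

theorem inner_radialMap (φ ψ : Fin 2 → SpinorField d) (g h : RadialL2) :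
    inner ℂ (radialMap φ g) (radialMap ψ h) =
      ∑ c, ∑ c', sphereInner (φ c) (ψ c') * inner ℂ (radialCoord c g) (radialCoord c' h) := by
  simp only [radialMap_apply, sum_inner, inner_sum, inner_radialProd]
  exact Finset.sum_comm

end Radial

/-! ### Density of the polynomials cut off to balls -/

section Density

variable {d : ℕ}

/-- Stone–Weierstrass on the ball: coordinates separate points, and conjugating coefficients makes
the polynomial functions closed under star. -/
theorem exists_evalAt_near (R : ℝ) {f : Space d → ℂ} (hf : Continuous f) {ε : ℝ} (hε : 0 < ε) :
    ∃ p : MvPolynomial (Fin d) ℂ, ∀ x ∈ Metric.closedBall (0 : Space d) R,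
      ‖f x - evalAt x p‖ < ε := by
  set K := Metric.closedBall (0 : Space d) R
  have : CompactSpace K := isCompact_iff_compactSpace.mp (isCompact_closedBall 0 R)
  let ev : MvPolynomial (Fin d) ℂ →ₐ[ℂ] C(K, ℂ) := MvPolynomial.aeval fun j =>
    { toFun := fun x : K => ((x : Space d) j : ℂ)
      continuous_toFun := by fun_prop }
  have hev : ∀ p (x : K), ev p x = evalAt (x : Space d) p := by
    intro p x
    induction p using MvPolynomial.induction_on with
    | C a => simp [ev]
    | add p q hp hq => simp [hp, hq]
    | mul_X p i hp => simp [hp, ev]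
  let A : StarSubalgebra ℂ C(K, ℂ) :=
    { ev.range with
      star_mem' := by
        rintro _ ⟨p, rfl⟩
        refine ⟨conjPoly p, ?_⟩
        ext x
        change ev (conjPoly p) x = star (ev p x)
        rw [hev, hev, evalAt_conjPoly]
        rfl }
  have hA : A.SeparatesPoints := by
    intro x y hxy
    obtain ⟨j, hj⟩ : ∃ j, (x : Space d) j ≠ (y : Space d) j := by
      by_contra! h
      exact hxy (Subtype.ext (PiLp.ext h))
    refine ⟨ev (MvPolynomial.X j), ⟨ev (MvPolynomial.X j), ⟨MvPolynomial.X j, rfl⟩, rfl⟩, ?_⟩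
    rw [hev, hev]
    simpa using hj
  have htop := ContinuousMap.starSubalgebra_topologicalClosure_eq_top_of_separatesPoints A hA
  let F : C(K, ℂ) := ⟨fun x => f x, hf.comp continuous_subtype_val⟩
  have hF : F ∈ closure (A : Set C(K, ℂ)) := by
    have : F ∈ A.topologicalClosure := by rw [htop]; trivial
    exact this
  obtain ⟨_, ⟨p, rfl⟩, hp⟩ := Metric.mem_closure_iff.mp hF ε hε
  refine ⟨p, fun x hx => ?_⟩
  have h := (ContinuousMap.dist_apply_le_dist (f := F) (g := ev p) ⟨x, hx⟩).trans_lt hp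
  rw [hev, dist_eq_norm] at h
  exact h

/-- A polynomial spinor cut off to a ball. -/
noncomputable def ballPoly (R : ℝ) (p : PolySpinor d) : Space d → Spinor d :=
  (Metric.closedBall 0 R).indicator fun x => WithLp.toLp 2 fun a => evalAt x (p a)

theorem continuous_polySpinor (p : PolySpinor d) :
    Continuous fun x : Space d => (WithLp.toLp 2 fun a => evalAt x (p a) : Spinor d) :=
  (PiLp.continuous_toLp 2 _).comp (continuous_pi fun a => continuous_evalAt (p a))

theorem memLp_ballPoly (R : ℝ) (p : PolySpinor d) : MemLp (ballPoly R p) 2 volume := by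
  rw [ballPoly, memLp_indicator_iff_restrict Metric.isClosed_closedBall.measurableSet]
  obtain ⟨C, hC⟩ := (isCompact_closedBall (0 : Space d) R).exists_bound_of_continuousOn
    (continuous_polySpinor p).continuousOn
  have : IsFiniteMeasure ((volume : Measure (Space d)).restrict (Metric.closedBall 0 R)) :=
    ⟨by rw [Measure.restrict_apply_univ]; exact measure_closedBall_lt_top⟩
  refine MemLp.of_bound (continuous_polySpinor p).aestronglyMeasurable C ?_
  filter_upwards [ae_restrict_mem Metric.isClosed_closedBall.measurableSet] with x hx using hC x hx

/-- Polynomial spinors cut off to a ball, as elements of `L²`. -/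
noncomputable def ballPolyL2 (R : ℝ) : PolySpinor d →ₗ[ℂ] SpinorL2 d where
  toFun p := (memLp_ballPoly R p).toLp
  map_add' p q := by
    rw [← MemLp.toLp_add, MemLp.toLp_eq_toLp_iff]
    refine .of_forall fun x => ?_
    by_cases hx : x ∈ Metric.closedBall 0 R
    · simp only [Pi.add_apply, ballPoly, Set.indicator_of_mem hx]
      ext a
      simp
    · simp only [Pi.add_apply, ballPoly, Set.indicator_of_notMem hx, add_zero]
  map_smul' c p := by
    rw [RingHom.id_apply, ← MemLp.toLp_const_smul, MemLp.toLp_eq_toLp_iff]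
    refine .of_forall fun x => ?_
    by_cases hx : x ∈ Metric.closedBall 0 R
    · simp only [Pi.smul_apply, ballPoly, Set.indicator_of_mem hx]
      ext a
      simp [MvPolynomial.smul_eval]
    · simp only [Pi.smul_apply, ballPoly, Set.indicator_of_notMem hx, smul_zero]

theorem coeFn_ballPolyL2 (R : ℝ) (p : PolySpinor d) :
    ballPolyL2 R p =ᵐ[volume] ballPoly R p :=
  (memLp_ballPoly R p).coeFn_toLp

theorem exists_ballPolyL2_near (f : SpinorL2 d) {ε : ℝ} (hε : 0 < ε) :
    ∃ R p, ‖f - ballPolyL2 R p‖ ≤ ε := by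
  obtain ⟨g, hgs, hfg, hg, hgm⟩ := (Lp.memLp f).exists_hasCompactSupport_eLpNorm_sub_le
    (by simp) (ε := ENNReal.ofReal (ε / 2)) (by simpa using hε)
  obtain ⟨R, hR⟩ := hgs.isCompact.isBounded.subset_closedBall 0
  set V : ENNReal := volume (Metric.closedBall (0 : Space d) R) ^ (1 / (2 : ENNReal).toReal) with hV
  have hVtop : V ≠ ⊤ := ENNReal.rpow_ne_top_of_nonneg (by positivity) measure_closedBall_lt_top.ne
  set N : ℝ := ((spinorDim d : ℕ) : ℝ) with hN
  have hN1 : (1 : ℝ) ≤ N := by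
    rw [hN]
    exact_mod_cast Nat.one_le_two_pow
  -- Componentwise error `δ` gives a spinor error of at most `N δ`, and integration over the ball
  -- multiplies by `V`, the square root of its volume. The added one avoids division by zero.
  set δ : ℝ := ε / 2 / ((V.toReal + 1) * N) with hδ
  have hδ0 : 0 < δ := by positivity
  have hgc : ∀ a, Continuous fun x => g x a := fun a => by fun_prop
  choose p hp using fun a => exists_evalAt_near R (hgc a) hδ0
  refine ⟨R, p, ?_⟩
  have hbound : ∀ x, ‖g x - ballPoly R p x‖ ≤
      ‖(Metric.closedBall (0 : Space d) R).indicator (fun _ => N * δ) x‖ := by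
    intro x
    by_cases hx : x ∈ Metric.closedBall (0 : Space d) R
    · rw [ballPoly, Set.indicator_of_mem hx, Set.indicator_of_mem hx,
        Real.norm_of_nonneg (by positivity)]
      refine abs_le_of_sq_le_sq' ?_ (by positivity) |>.2
      rw [EuclideanSpace.norm_sq_eq]
      calc ∑ a, ‖(g x - WithLp.toLp 2 fun a => evalAt x (p a)) a‖ ^ 2
          ≤ ∑ _a : Fin (spinorDim d), δ ^ 2 := by
            refine Finset.sum_le_sum fun a _ => ?_
            exact pow_le_pow_left₀ (norm_nonneg _) (hp a x hx).le 2
        _ = N * δ ^ 2 := by simp [hN]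
        _ ≤ (N * δ) ^ 2 := by
          rw [mul_pow]
          exact mul_le_mul_of_nonneg_right (by nlinarith) (by positivity)
    · have h0 : g x = 0 := by
        by_contra h
        exact hx (hR (subset_tsupport g h))
      rw [ballPoly, Set.indicator_of_notMem hx, Set.indicator_of_notMem hx, h0]
      simp
  have h2 : eLpNorm (g - ballPoly R p) 2 volume ≤ ENNReal.ofReal (ε / 2) := by
    refine (eLpNorm_mono hbound).trans ((eLpNorm_indicator_const_le _ _).trans ?_)
    rw [← hV, ← ofReal_norm, Real.norm_of_nonneg (by positivity), ← ENNReal.ofReal_toReal hVtop,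
      ← ENNReal.ofReal_mul (by positivity)]
    refine ENNReal.ofReal_le_ofReal ?_
    have hv : 0 ≤ V.toReal := ENNReal.toReal_nonneg
    rw [hδ]
    calc N * (ε / 2 / ((V.toReal + 1) * N)) * V.toReal = ε / 2 * (V.toReal / (V.toReal + 1)) := by
          field_simp
      _ ≤ ε / 2 * 1 := by
        refine mul_le_mul_of_nonneg_left ?_ (by positivity)
        rw [div_le_one (by positivity)]
        linarith
      _ = ε / 2 := mul_one _
  have h3 : eLpNorm (⇑f - ballPoly R p) 2 volume ≤ ENNReal.ofReal ε := by
    have he : ⇑f - ballPoly R p = (⇑f - g) + (g - ballPoly R p) := by abel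
    rw [he]
    refine (eLpNorm_add_le ((Lp.aestronglyMeasurable f).sub hg.aestronglyMeasurable)
      (hg.aestronglyMeasurable.sub (memLp_ballPoly R p).1) (by norm_num)).trans ?_
    refine (add_le_add hfg h2).trans ?_
    rw [← ENNReal.ofReal_add (by positivity) (by positivity), add_halves]
  have h4 : eLpNorm (⇑(f - ballPolyL2 R p)) 2 volume = eLpNorm (⇑f - ballPoly R p) 2 volume := by
    refine eLpNorm_congr_ae ?_
    filter_upwards [Lp.coeFn_sub f (ballPolyL2 R p), coeFn_ballPolyL2 R p] with x h1 h2
    rw [h1, Pi.sub_apply, h2, Pi.sub_apply]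
  rw [Lp.norm_def, h4]
  exact ENNReal.toReal_le_of_le_ofReal hε.le h3

/-- A closed subspace that contains the cut-off polynomials is everything. -/
theorem eq_top_of_ballPolyL2_mem {W : Submodule ℂ (SpinorL2 d)} (hW : IsClosed (W : Set (SpinorL2 d)))
    (h : ∀ R p, ballPolyL2 R p ∈ W) : W = ⊤ := by
  rw [eq_top_iff]
  intro f _
  rw [← SetLike.mem_coe, ← hW.closure_eq, Metric.mem_closure_iff]
  intro ε hε
  obtain ⟨R, p, hp⟩ := exists_ballPolyL2_near f (half_pos hε)
  exact ⟨_, h R p, by rw [dist_eq_norm]; linarith⟩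

variable [NeZero d]

/-- A homogeneous polynomial cut off to a ball is the product of a radial and a spherical
function. -/
theorem exists_radialProd_eq_ballPolyL2 (R : ℝ) {p : PolySpinor d} {k : ℕ}
    (hp : ∀ a, (p a).IsHomogeneous k) : ∃ u, radialProd (toField p) u = ballPolyL2 R p := by
  -- The exponent cancels the prefactor `r^{-(d-1)/2}` and supplies the `r^k` of homogeneity.
  let u : ℝ → ℂ := (Set.Ioc (0 : ℝ) R).indicator fun r =>
    ((r ^ ((k : ℝ) + ((d : ℝ) - 1) / 2) : ℝ) : ℂ)
  have hd1 : (1 : ℝ) ≤ d := by exact_mod_cast NeZero.one_le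
  have hexp : 0 ≤ (k : ℝ) + ((d : ℝ) - 1) / 2 := by
    have : (0 : ℝ) ≤ k := k.cast_nonneg
    linarith
  have hu : MemLp u 2 (volume.restrict (Set.Ioi (0 : ℝ))) := by
    rw [memLp_indicator_iff_restrict measurableSet_Ioc]
    have : IsFiniteMeasure ((volume.restrict (Set.Ioi (0 : ℝ))).restrict (Set.Ioc (0 : ℝ) R)) :=
      ⟨by
        rw [Measure.restrict_apply_univ]
        exact (Measure.restrict_apply_le _ _).trans_lt measure_Ioc_lt_top⟩
    refine MemLp.of_bound (Measurable.aestronglyMeasurable (by fun_prop))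
      (R ^ ((k : ℝ) + ((d : ℝ) - 1) / 2)) ?_
    filter_upwards [ae_restrict_mem measurableSet_Ioc] with r hr
    rw [Complex.norm_real, Real.norm_of_nonneg (Real.rpow_nonneg hr.1.le _)]
    exact Real.rpow_le_rpow hr.1.le hr.2 hexp
  refine ⟨hu.toLp, Lp.ext ?_⟩
  filter_upwards [coeFn_radialProd (toField p) hu.toLp, coeFn_ballPolyL2 R p,
    ae_of_ae_norm (d := d) hu.coeFn_toLp, Measure.ae_ne volume (0 : Space d)] with ξ h1 h2 h3 h4
  rw [h1, h2, radialScalar_congr _ h3]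
  obtain ⟨ω, r, hr, rfl⟩ : ∃ (ω : Sphere d) (r : ℝ), 0 < r ∧ ξ = r • (ω : Space d) :=
    ⟨direction ξ h4, ‖ξ‖, norm_pos_iff.mpr h4, (norm_smul_direction h4).symm⟩
  rw [radialScalar_smul _ _ _ hr]
  by_cases hrR : r ≤ R
  · have hmem : r • (ω : Space d) ∈ Metric.closedBall (0 : Space d) R := by
      rw [mem_closedBall_zero_iff, norm_sphere_smul hr]
      exact hrR
    rw [ballPoly, Set.indicator_of_mem hmem]
    simp only [u]
    rw [Set.indicator_of_mem (show r ∈ Set.Ioc 0 R from ⟨hr, hrR⟩), Complex.coe_smul, smul_smul,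
      ← Real.rpow_add hr]
    have he : -((d : ℝ) - 1) / 2 + ((k : ℝ) + ((d : ℝ) - 1) / 2) = k := by ring
    rw [he, Real.rpow_natCast]
    ext a
    simp [evalAt_smul (hp a)]
  · have hmem : r • (ω : Space d) ∉ Metric.closedBall (0 : Space d) R := by
      rw [mem_closedBall_zero_iff, norm_sphere_smul hr]
      exact hrR
    rw [ballPoly, Set.indicator_of_notMem hmem]
    simp only [u]
    rw [Set.indicator_of_notMem (fun h => hrR h.2), zero_smul, smul_zero]

/-- A closed subspace that contains the products of radial functions and spherical harmonics is
everything. -/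
theorem eq_top_of_radialProd_mem {W : Submodule ℂ (SpinorL2 d)}
    (hW : IsClosed (W : Set (SpinorL2 d)))
    (h : ∀ Y ∈ ⨆ k, sphericalHarmonic d k, ∀ u, radialProd Y u ∈ W) : W = ⊤ := by
  refine eq_top_of_ballPolyL2_mem hW fun R p => ?_
  rw [← Finset.univ_sum_single p, map_sum]
  refine Submodule.sum_mem _ fun a _ => ?_
  -- Only homogeneous polynomials factor into radius and direction, so components and degrees are
  -- split first.
  have hsum := MvPolynomial.sum_homogeneousComponent (p a)
  rw [← hsum, ← LinearMap.coe_single (R := ℂ), map_sum, map_sum]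
  refine Submodule.sum_mem _ fun k _ => ?_
  have hhom : ∀ b, ((LinearMap.single ℂ (fun _ : Fin (spinorDim d) => MvPolynomial (Fin d) ℂ) a
      (MvPolynomial.homogeneousComponent k (p a))) b).IsHomogeneous k := by
    intro b
    by_cases hb : b = a
    · subst hb
      simpa using MvPolynomial.homogeneousComponent_isHomogeneous k (p b)
    · simpa [Pi.single_eq_of_ne hb] using MvPolynomial.isHomogeneous_zero _ _ _
  obtain ⟨u, hu⟩ := exists_radialProd_eq_ballPolyL2 R hhom
  rw [← hu]
  exact h _ (toField_mem_iSup_of_isHomogeneous hhom) u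

end Density

/-! ### Expansions along orthogonal families -/

section Expansion

variable {d : ℕ} [NeZero d] {I : Type*} {φ : I → Fin 2 → SpinorField d}

/-- The columns are orthonormal. -/
def ColumnsOrthonormal (φ : I → Fin 2 → SpinorField d) : Prop :=
  ∀ i j c c', sphereInner (φ i c) (φ j c') = open Classical in if i = j ∧ c = c' then 1 else 0

theorem ColumnsOrthonormal.inner_radialMap_self (hφ : ColumnsOrthonormal φ) (i : I)
    (g h : RadialL2) : inner ℂ (radialMap (φ i) g) (radialMap (φ i) h) = inner ℂ g h := by
  rw [inner_radialMap, ← sum_inner_radialCoord]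
  refine Finset.sum_congr rfl fun c _ => ?_
  rw [Finset.sum_eq_single c]
  · rw [hφ, if_pos ⟨rfl, rfl⟩, one_mul]
  · intro c' _ hc
    rw [hφ, if_neg (fun h => hc h.2.symm), zero_mul]
  · simp

/-- The isometry `g ↦ |ξ|^{-(d-1)/2} E(ξ/|ξ|) g(|ξ|)` for a block `E` with orthonormal columns. -/
noncomputable def ColumnsOrthonormal.isometry (hφ : ColumnsOrthonormal φ) (i : I) :
    RadialL2 →ₗᵢ[ℂ] SpinorL2 d :=
  (radialMap (φ i)).isometryOfInner (hφ.inner_radialMap_self i)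

theorem ColumnsOrthonormal.isometry_apply (hφ : ColumnsOrthonormal φ) (i : I) (g : RadialL2) :
    hφ.isometry i g = radialMap (φ i) g := rfl

theorem ColumnsOrthonormal.orthogonalFamily (hφ : ColumnsOrthonormal φ) :
    OrthogonalFamily ℂ (fun _ : I => RadialL2) hφ.isometry := by
  intro i j hij g h
  rw [hφ.isometry_apply, hφ.isometry_apply, inner_radialMap]
  refine Finset.sum_eq_zero fun c _ => Finset.sum_eq_zero fun c' _ => ?_
  rw [hφ, if_neg (fun h => hij h.1), zero_mul]

/-- The span of the ranges contains every radial function times a column, hence times a spherical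
harmonic, and these products are total by density of the cut-off polynomials. -/
theorem ColumnsOrthonormal.isHilbertSum (hφ : ColumnsOrthonormal φ)
    (hspan : ⨆ k, sphericalHarmonic d k ≤
      Submodule.span ℂ (Set.range fun z : I × Fin 2 => φ z.1 z.2)) :
    IsHilbertSum ℂ (fun _ : I => RadialL2) hφ.isometry := by
  refine IsHilbertSum.mk hφ.orthogonalFamily (eq_top_of_radialProd_mem
    (Submodule.isClosed_topologicalClosure _) fun Y hY u => ?_).ge
  refine Submodule.le_topologicalClosure _ ?_
  replace hY := hspan hY
  induction hY using Submodule.span_induction with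
  | mem Y h =>
    obtain ⟨⟨i, c⟩, rfl⟩ := h
    obtain ⟨g, hg⟩ := exists_radialCoord_eq c u
    refine Submodule.mem_iSup_of_mem i ⟨g, ?_⟩
    change radialMap (φ i) g = _
    rw [radialMap_apply, Finset.sum_eq_single c]
    · rw [hg, if_pos rfl]
    · intro c' _ hc
      rw [hg, if_neg hc, map_zero]
    · simp
  | zero => simp
  | add Y Z _ _ hY hZ =>
    rw [map_add, LinearMap.add_apply]
    exact Submodule.add_mem _ hY hZ
  | smul c Y _ hY =>
    rw [map_smul, LinearMap.smul_apply]
    exact Submodule.smul_mem _ c hY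

theorem isBlockExpansion_iff (hφ : ColumnsOrthonormal φ) (f : SpinorL2 d) (g : I → RadialL2) :
    IsBlockExpansion (fun i => ofColumns (φ i)) f g ↔ HasSum (fun i => hφ.isometry i (g i)) f := by
  rw [IsBlockExpansion, HasSum, SummationFilter.unconditional_filter,
    tendsto_iff_edist_tendsto_0]
  refine tendsto_congr fun s => ?_
  rw [edist_comm, edist_eq_enorm_sub, Lp.enorm_def]
  refine eLpNorm_congr_ae ?_
  have h : ∀ᵐ ξ : Space d, ∀ i ∈ s, hφ.isometry i (g i) ξ = radialTerm (ofColumns (φ i)) (g i) ξ :=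
    (ae_ball_iff s.countable_toSet).mpr fun i _ => coeFn_radialMap (φ i) (g i)
  filter_upwards [h, Lp.coeFn_sub f (∑ i ∈ s, hφ.isometry i (g i)),
    Lp.coeFn_finsetSum s fun i => hφ.isometry i (g i)] with ξ h1 h2 h3
  rw [h2, Pi.sub_apply, h3, Finset.sum_apply]
  congr 1
  exact Finset.sum_congr rfl fun i hi => (h1 i hi).symm

theorem hasSum_norm_sq_lp {G : I → Type*} [∀ i, NormedAddCommGroup (G i)] (v : lp G 2) :
    HasSum (fun i => ‖v i‖ ^ 2) (‖v‖ ^ 2) := by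
  have h := lp.hasSum_norm (p := 2) (by norm_num) v
  simpa using h

theorem memLp_of_summable {g : I → RadialL2} (hg : Summable fun i => ‖g i‖ ^ 2) :
    Memℓp (E := fun _ : I => RadialL2) g 2 :=
  memℓp_gen (by simpa using hg)

theorem exists_isBlockExpansion (hφ : ColumnsOrthonormal φ) {g : I → RadialL2}
    (hg : Summable fun i => ‖g i‖ ^ 2) :
    ∃ f : SpinorL2 d, IsBlockExpansion (fun i => ofColumns (φ i)) f g ∧
      HasSum (fun i => ‖g i‖ ^ 2) (‖f‖ ^ 2) := by
  let v : lp (fun _ : I => RadialL2) 2 := ⟨g, memLp_of_summable hg⟩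
  refine ⟨hφ.orthogonalFamily.linearIsometry v, ?_, ?_⟩
  · rw [isBlockExpansion_iff hφ]
    exact hφ.orthogonalFamily.hasSum_linearIsometry v
  · rw [LinearIsometry.norm_map]
    exact hasSum_norm_sq_lp v

theorem existsUnique_isBlockExpansion (hφ : ColumnsOrthonormal φ)
    (hspan : ⨆ k, sphericalHarmonic d k ≤
      Submodule.span ℂ (Set.range fun z : I × Fin 2 => φ z.1 z.2)) (f : SpinorL2 d) :
    ∃! g : I → RadialL2, IsBlockExpansion (fun i => ofColumns (φ i)) f g ∧
      HasSum (fun i => ‖g i‖ ^ 2) (‖f‖ ^ 2) := by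
  obtain ⟨v, rfl⟩ := (hφ.isHilbertSum hspan).surjective_isometry f
  refine ⟨v, ⟨?_, ?_⟩, ?_⟩
  · rw [isBlockExpansion_iff hφ]
    exact hφ.orthogonalFamily.hasSum_linearIsometry v
  · rw [LinearIsometry.norm_map]
    exact hasSum_norm_sq_lp v
  · rintro g ⟨h1, h2⟩
    rw [isBlockExpansion_iff hφ] at h1
    -- The norm identity places the competing family in `ℓ²`; uniqueness is then injectivity of the
    -- isometry.
    let w : lp (fun _ : I => RadialL2) 2 := ⟨g, memLp_of_summable h2.summable⟩
    have h3 := h1.unique (hφ.orthogonalFamily.hasSum_linearIsometry w)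
    have h4 := hφ.orthogonalFamily.linearIsometry.injective h3
    exact congrArg (fun v : lp (fun _ : I => RadialL2) 2 => (v : I → RadialL2)) h4.symm

end Expansion

/-! ### The operators on the blocks -/

section Blocks

variable {d : ℕ} {γ : Fin (d + 1) → SpinorMatrix d}

theorem block_eq_ofColumns (μ : ℤˣ) (e : SpinorField d) :
    block γ μ e = ofColumns (column γ μ e) := by
  funext ω
  ext a c
  exact block_apply μ e ω a c

theorem mul_block_apply (A : SpinorMatrix d) (μ : ℤˣ) (e : SpinorField d) (ω : Sphere d)
    (a : Fin (spinorDim d)) (c : Fin 2) :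
    (A * block γ μ e ω) a c = (A *ᵥ (column γ μ e c ω).ofLp) a := by
  simp only [Matrix.mul_apply, block_apply, Matrix.mulVec, dotProduct]

/-- The involution `Φ₀` exchanges the two columns of a block, and homogeneity of the symbol supplies
`|ξ|`. -/
theorem diracSymbol_mul_block (hγ : IsGammaFamily γ) {ξ : Space d} (hξ : ξ ≠ 0) (μ : ℤˣ)
    (e : SpinorField d) :
    diracSymbol γ ξ * block γ μ e (direction ξ hξ) =
      (‖ξ‖ : ℂ) • (block γ μ e (direction ξ hξ) * pauli1) := by
  have h1 : diracSymbol γ ξ = (‖ξ‖ : ℂ) • diracSymbol γ (direction ξ hξ : Space d) := by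
    rw [← diracSymbol_smul, norm_smul_direction]
  rw [h1, Matrix.smul_mul]
  congr 1
  set ω := direction ξ hξ
  have h2 : ∀ (Y : SpinorField d) a, (diracSymbol γ (ω : Space d) *ᵥ (Y ω).ofLp) a =
      diracMul γ Y ω a := fun Y a => rfl
  ext a c
  rw [mul_block_apply, h2, Matrix.mul_apply, Fin.sum_univ_two, block_apply, block_apply]
  unfold column pauli1
  by_cases h : μ = 1 <;> fin_cases c <;> simp [h, diracMul_diracMul hγ]

/-- By anticommutation `Φ₀ e` has eigenvalue `-μ`; the order of the columns puts eigenvalue `1`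
first for either sign. -/
theorem gamma_last_mul_block (hγ : IsGammaFamily γ) {μ : ℤˣ} {k : ℕ} {e : SpinorField d}
    (he : e ∈ signedSubspace γ μ k) (ω : Sphere d) :
    γ (Fin.last d) * block γ μ e ω = block γ μ e ω * pauli3 := by
  have h2 : ∀ (Y : SpinorField d) a, (γ (Fin.last d) *ᵥ (Y ω).ofLp) a =
      gammaMul γ Y ω a := fun Y a => rfl
  have h3 := (mem_signedSubspace.mp he).2
  ext a c
  rw [mul_block_apply, h2, Matrix.mul_apply, Fin.sum_univ_two, block_apply, block_apply]
  unfold column pauli3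
  rcases Int.units_eq_one_or μ with rfl | rfl <;> fin_cases c <;>
    simp [gammaMul_diracMul hγ, h3]

/-- Funk–Hecke for `f(t) = F(r √(2(1 - t)))`; the prefactor `1/2` absorbs the two in `sphereConst`.
-/
theorem funk_hecke_column (hd : 2 ≤ d) {F : ℝ → ℝ} {r : ℝ} (hF : FunkHeckeIntegrable d F r)
    (ψ : ℝ → ℝ) {k : ℕ} {Y : SpinorField d} (hY : Y ∈ sphericalHarmonic d k) (ω : Sphere d)
    (a : Fin (spinorDim d)) :
    Integrable (fun η => (funkHeckeKernel F r ω η : ℂ) * Y η a) (surfaceMeasure d) ∧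
    ((1 / 2 * r ^ (d - 2) * ψ r ^ 2 : ℝ) : ℂ) *
      ∫ η, (funkHeckeKernel F r ω η : ℂ) * Y η a ∂surfaceMeasure d =
      Y ω a * (multiplier d F ψ k r : ℂ) := by
  obtain ⟨p, hp, rfl⟩ := mem_sphericalHarmonic.mp hY
  obtain ⟨h1, h2⟩ := funk_hecke hd ω (f := fun t => F (r * √(2 * (1 - t)))) hF (hp a)
  refine ⟨h1, ?_⟩
  have h3 : ∫ η, (funkHeckeKernel F r ω η : ℂ) * toField p η a ∂surfaceMeasure d = _ := h2
  rw [h3, toField_apply, multiplier, sphereConst]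
  simp only [weight]
  push_cast
  ring

theorem block_mul_multiplierMatrix_apply (μ : ℤˣ) (e : SpinorField d) (ω : Sphere d)
    (F ψ : ℝ → ℝ) (k : ℕ) (r : ℝ) (a : Fin (spinorDim d)) (c : Fin 2) :
    (block γ μ e ω * multiplierMatrix d F ψ μ k r) a c =
      column γ μ e c ω a * (multiplier d F ψ (columnDegree μ k c) r : ℂ) := by
  rw [Matrix.mul_apply, Fin.sum_univ_two, block_apply, block_apply]
  unfold multiplierMatrix columnDegree
  by_cases h : μ = 1 <;> fin_cases c <;> simp [h]

end Blocks

end DiracHarmonics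

theorem theorem3p5 (d : ℕ) (hd : 2 ≤ d) (γ : Fin (d + 1) → SpinorMatrix d)
    (hγ : IsGammaFamily γ) (ι : ℤˣ → ℕ → Type*)
    (e : (μ : ℤˣ) → (k : ℕ) → ι μ k → SpinorField d)
    (he : ∀ μ k, IsOrthonormalBasis (signedSubspace γ μ k) (e μ k)) :
    -- the expansion, over the indices `i = ((μ, k), n)`
    (∀ f : SpinorL2 d, ∃! g : (Σ p : ℤˣ × ℕ, ι p.1 p.2) → RadialL2,
      IsBlockExpansion (fun i => block γ i.1.1 (e i.1.1 i.1.2 i.2)) f g ∧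
      HasSum (fun i => ‖g i‖ ^ 2) (‖f‖ ^ 2)) ∧
    (∀ g : (Σ p : ℤˣ × ℕ, ι p.1 p.2) → RadialL2, Summable (fun i => ‖g i‖ ^ 2) →
      ∃ f : SpinorL2 d,
        IsBlockExpansion (fun i => block γ i.1.1 (e i.1.1 i.1.2 i.2)) f g ∧
        HasSum (fun i => ‖g i‖ ^ 2) (‖f‖ ^ 2)) ∧
    -- the action of the Funk--Hecke operator on the blocks
    (∀ w ψ F : ℝ → ℝ, (∀ r, 0 < r → 0 ≤ w r) → (∀ r, 0 < r → 0 ≤ ψ r) →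
      IsRadialFourierTransform d w F →
      ∀ (ξ : Space d) (hξ : ξ ≠ 0), FunkHeckeIntegrable d F ‖ξ‖ →
      ∀ (μ : ℤˣ) (k : ℕ) (n : ι μ k),
        (∀ a c, Integrable (fun η =>
          (funkHeckeKernel F ‖ξ‖ (direction ξ hξ) η : ℂ) * block γ μ (e μ k n) η a c)
          (surfaceMeasure d)) ∧
        funkHeckeOperator F ψ ‖ξ‖ (block γ μ (e μ k n)) (direction ξ hξ) =
          block γ μ (e μ k n) (direction ξ hξ) * multiplierMatrix d F ψ μ k ‖ξ‖) ∧
    -- the action of `Φ₀` and of `γ_{d+1}` on the blocks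
    (∀ (ξ : Space d) (hξ : ξ ≠ 0) (μ : ℤˣ) (k : ℕ) (n : ι μ k),
      diracSymbol γ ξ * block γ μ (e μ k n) (direction ξ hξ) =
        (‖ξ‖ : ℂ) • (block γ μ (e μ k n) (direction ξ hξ) * pauli1) ∧
      γ (Fin.last d) * block γ μ (e μ k n) (direction ξ hξ) =
        block γ μ (e μ k n) (direction ξ hξ) * pauli3) := by
  have : NeZero d := ⟨by omega⟩
  have hφ : ColumnsOrthonormal fun i : (Σ p : ℤˣ × ℕ, ι p.1 p.2) =>
      column γ i.1.1 (e i.1.1 i.1.2 i.2) := fun i j c c' =>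
    (sphereInner_column hd hγ he i j c c').trans (by congr)
  have hspan := iSup_sphericalHarmonic_le_span_column hd hγ he
  simp only [block_eq_ofColumns (γ := γ)]
  refine ⟨fun f => existsUnique_isBlockExpansion hφ hspan f,
    fun g hg => exists_isBlockExpansion hφ hg, ?_, ?_⟩
  · intro w ψ F _ _ _ ξ hξ hF μ k n
    -- Each column is a spherical harmonic of a single degree, so the matrix identity holds column
    -- by column.
    have h := fun a c => funk_hecke_column hd hF ψ
      (column_mem_sphericalHarmonic hd hγ ((he μ k).mem n) c) (direction ξ hξ) a
    refine ⟨fun a c => (h a c).1, ?_⟩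
    ext a c
    rw [← block_eq_ofColumns, block_mul_multiplierMatrix_apply, ← (h a c).2]
    simp only [funkHeckeOperator, Matrix.of_apply, block_apply]
  · intro ξ hξ μ k n
    rw [← block_eq_ofColumns]
    exact ⟨diracSymbol_mul_block hγ hξ μ _, gamma_last_mul_block hγ ((he μ k).mem n) _⟩
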